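/- Let $n\ge 2$. There is a constant $C>0$ depending only on $n$ such that the following holds. Let $m\in\mathbb N$, let $u_0\in L^\infty(\mathbb R^n;\mathbb R^n)$ satisfy $\operatorname{div}u_0=0$ in the sense of distributions, and let $d_0\in W^{1,\infty}(\mathbb R^n;\mathbb R^m)$ satisfy $|d_0|=1$ a.e. Consider the Cauchy problem for the liquid crystal system $$u_t+(u\cdot\nabla)u-\Delta u+\nabla p=-\operatorname{div}(\nabla d\odot\nabla d),\qquad \operatorname{div}u=0,\qquad d_t+(u\cdot\nabla)d=\Delta d+|\nabla d|^2d,$$ $$(u,d)|_{t=0}=(u_0,d_0),\qquad (\nabla d\odot\nabla d)_{ij}=\partial_id\cdot\partial_jd .$$ A mild solution on $\mathbb R^n\times[0,T]$ is a measurable pair $(u,d)$, bounded on $[0,T]$ with values in $L^\infty\times W^{1,\infty}$, such that for all $t\in[0,T]$, a.e. in $\mathbb R^n$, $$u(t)=e^{t\Delta}u_0-\int_0^te^{(t-s)\Delta}\mathbb P\operatorname{div}(u\otimes u+\nabla d\odot\nabla d)\,ds,\qquad d(t)=e^{t\Delta}d_0+\int_0^te^{(t-s)\Delta}\big(|\nabla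 d|^2d-(u\cdot\nabla)d\big)\,ds,$$ where $\mathbb P$ is the Helmholtz projection, with Fourier symbol $\delta_{ij}-\xi_i\xi_j/|\xi|^2$, and $e^{t\Delta}\mathbb P_{ij}\partial_k$, $t>0$, acts on $L^\infty$ as the convolution with the inverse Fourier transform of its symbol. Then for every $T>0$ with $T\,(\|u_0\|_\infty+\|\nabla d_0\|_\infty)^2\le C$ there is a mild solution $(u,d)$ on $\mathbb R^n\times[0,T]$ with $|d(t)|=1$ a.e. for every $t\in[0,T]$. It is the unique mild solution on $\mathbb R^n\times[0,T]$ with initial data $(u_0,d_0)$: any other one agrees with it a.e. in $\mathbb R^n$ for every $t\in[0,T]$. In particular the existence time can be taken to be at least $C(\|u_0\|_\infty+\|\nabla d_0\|_\infty)^{-2}$ (arbitrarily large if $u_0=0$ and $\nabla d_0=0$). Moreover: (i) $u\in C^{1/2}([\delta,T];W^{k,\infty})$ and $d\in \mathrm{Lip}([\delta,T];W^{k+1,\infty})$ for every integer $k\ge0$ and every $0<\delta<T$; (ii) the functions $t\mapsto\|u(t)\|_\infty$ and $t\mapsto\|\nabla d(t)\|_\infty$ are continuous on $[0,T]$, and $$\lim_{t\to0^+}\|u(t)\|_\infty=\|u_0\|_\infty,\qquad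 \lim_{t\to0^+}\|\nabla d(t)\|_\infty=\|\nabla d_0\|_\infty .$$ -/

import Mathlib

open MeasureTheory Set Filter Topology
open scoped ENNReal NNReal FourierTransform

noncomputable section

namespace LiquidCrystal

/-- The Euclidean space `ℝⁿ`. -/
abbrev E (n : ℕ) : Type := EuclideanSpace ℝ (Fin n)

/-- Values of the gradient `(∂₁ d, …, ∂ₙ d)` of a map `d : ℝⁿ → ℝᵐ`. The norm of this space is the
Frobenius norm, so that `‖∇d‖² = ∑ i, |∂ᵢ d|²`. -/
abbrev Grad (n m : ℕ) : Type := PiLp 2 (fun _ : Fin n => E m)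

/-- The `i`-th standard basis vector of `ℝⁿ`. -/
def e {n : ℕ} (i : Fin n) : E n := EuclideanSpace.single i (1 : ℝ)

section Sobolev

variable {n : ℕ} {V : Type*} [NormedAddCommGroup V] [NormedSpace ℝ V]

/-- Real valued test functions, the elements of `C_c^∞(ℝⁿ)`. -/
def IsTest (φ : E n → ℝ) : Prop :=
  ContDiff ℝ (⊤ : ℕ∞) φ ∧ HasCompactSupport φ

/-- `g` is the weak partial derivative `∂_{α 0} ⋯ ∂_{α (l-1)} f`. -/
def HasWeakPartial {l : ℕ} (α : Fin l → Fin n) (f g : E n → V) : Prop :=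
  LocallyIntegrable f volume ∧ LocallyIntegrable g volume ∧
    ∀ φ : E n → ℝ, IsTest φ →
      ∫ x, (iteratedFDeriv ℝ l φ x (fun j => e (α j))) • f x
        = (-1 : ℝ) ^ l • ∫ x, φ x • g x

/-- The `W^{k,∞}` norm, the largest of the `L^∞` norms of the weak partial derivatives of order at
most `k`. Weak derivatives are unique up to null sets, so the infimum is over functions that all
have the same norm. It is `⊤` when there is no weak derivative, so the norm is finite exactly on
`W^{k,∞}`. -/
def sobolevNorm (k : ℕ) (f : E n → V) : ℝ≥0∞ :=
  ⨆ (l : ℕ) (_ : l ≤ k) (α : Fin l → Fin n),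
    ⨅ (g : E n → V) (_ : HasWeakPartial α f g), eLpNorm g ⊤ volume

/-- The real valued `L^∞` norm. -/
def supNorm (f : E n → V) : ℝ := (eLpNorm f ⊤ volume).toReal

/-- `w` belongs to the Hölder space `C^γ(J; W^{k,∞})`, the Lipschitz space for `γ = 1`. -/
def HolderSobolev (γ : ℝ) (J : Set ℝ) (k : ℕ) (w : ℝ → E n → V) : Prop :=
  ∃ M : ℝ≥0, (∀ t ∈ J, sobolevNorm k (w t) ≤ M) ∧
    ∀ s ∈ J, ∀ t ∈ J,
      sobolevNorm k (fun x => w t x - w s x) ≤ M * ENNReal.ofReal (|t - s| ^ γ)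

end Sobolev

/-- `g` is the weak gradient of `f : ℝⁿ → ℝᵐ`. -/
def HasWeakGrad {n m : ℕ} (f : E n → E m) (g : E n → Grad n m) : Prop :=
  ∀ i : Fin n, HasWeakPartial (fun _ : Fin 1 => i) f (fun x => g x i)

open Classical in
/-- The weak gradient, determined up to a null set when it exists. -/
def weakGrad {n m : ℕ} (f : E n → E m) : E n → Grad n m :=
  if h : ∃ g, HasWeakGrad f g then h.choose else 0

/-- `div v = 0` in the sense of distributions. -/
def IsDivFree {n : ℕ} (v : E n → E n) : Prop :=
  ∀ φ : E n → ℝ, IsTest φ → ∫ x, fderiv ℝ φ x (v x) = 0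

/-- The heat kernel `(4πt)^{-n/2} exp (-|x|²/(4t))`. -/
def heatKernel {n : ℕ} (t : ℝ) (x : E n) : ℝ :=
  (4 * Real.pi * t) ^ (-(n : ℝ) / 2) * Real.exp (-‖x‖ ^ 2 / (4 * t))

/-- The heat semigroup `e^{tΔ}`, `t ≥ 0`, with `e^{0Δ}` the identity. -/
def heat {n : ℕ} {V : Type*} [NormedAddCommGroup V] [NormedSpace ℝ V]
    (t : ℝ) (f : E n → V) (x : E n) : V :=
  if t = 0 then f x else ∫ y, heatKernel t (x - y) • f y

/-- The Fourier symbol `δᵢⱼ - ξᵢ ξⱼ / |ξ|²` of the Helmholtz projection `ℙ` onto divergence-free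
fields. -/
def helmholtzSymbol {n : ℕ} (i j : Fin n) (ξ : E n) : ℝ :=
  (if i = j then 1 else 0) - ξ i * ξ j / ‖ξ‖ ^ 2

/-- The convolution kernel of `e^{tΔ} ℙᵢⱼ ∂ₖ`, `t > 0`: the inverse Fourier transform of the product
of the symbols `exp (-4π²t|ξ|²)` of `e^{tΔ}`, `δᵢⱼ - ξᵢ ξⱼ / |ξ|²` of `ℙ` and `2πi ξₖ` of `∂ₖ`
(it is real valued). -/
def projKernel {n : ℕ} (t : ℝ) (i j k : Fin n) (x : E n) : ℝ :=
  (𝓕⁻ (fun ξ : E n => ((Real.exp (-(4 * Real.pi ^ 2 * t * ‖ξ‖ ^ 2)) : ℝ) : ℂ)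
    * (helmholtzSymbol i j ξ : ℂ) * (2 * Real.pi * Complex.I * (ξ k : ℂ))) x).re

/-- `e^{tΔ} ℙ div F` for `t > 0` and a bounded matrix field `F`, where `(div F)ⱼ = ∑ₖ ∂ₖ Fⱼₖ`. -/
def heatProjDiv {n : ℕ} (t : ℝ) (F : E n → Matrix (Fin n) (Fin n) ℝ) (x : E n) : E n :=
  WithLp.toLp 2 fun i => ∑ j, ∑ k, ∫ y, projKernel t i j k (x - y) * F y j k

/-- The matrix field `u ⊗ u + ∇d ⊙ ∇d`, where `Dd` stands for `∇d`. -/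
def stress {n m : ℕ} (u : E n → E n) (Dd : E n → Grad n m) (x : E n) :
    Matrix (Fin n) (Fin n) ℝ :=
  Matrix.of fun j k => u x j * u x k + inner ℝ (Dd x j) (Dd x k)

/-- The field `|∇d|² d - (u · ∇) d`, where `Dd` stands for `∇d`. -/
def dForce {n m : ℕ} (u : E n → E n) (d : E n → E m) (Dd : E n → Grad n m) (x : E n) : E m :=
  ‖Dd x‖ ^ 2 • d x - ∑ i, u x i • Dd x i

/-- `(u, d)` is a (bounded) mild solution on `ℝⁿ × [0, T]` with initial data `(u₀, d₀)`: it is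
measurable and bounded with values in `L^∞ × W^{1,∞}`, and satisfies the two integral equations at
all times `t ∈ [0, T]`. Functions of `x` are identified when equal almost everywhere. -/
structure IsMildSolution {n m : ℕ} (T : ℝ) (u₀ : E n → E n) (d₀ : E n → E m)
    (u : ℝ → E n → E n) (d : ℝ → E n → E m) : Prop where
  measurable_u : AEStronglyMeasurable (Function.uncurry u)
    ((volume.restrict (Icc 0 T)).prod volume)
  measurable_d : AEStronglyMeasurable (Function.uncurry d)
    ((volume.restrict (Icc 0 T)).prod volume)
  /-- The gradient, defined for each time up to a null set, has a jointly measurable version. -/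
  measurable_grad : ∃ Dd : ℝ → E n → Grad n m,
    AEStronglyMeasurable (Function.uncurry Dd) ((volume.restrict (Icc 0 T)).prod volume) ∧
    ∀ t ∈ Icc 0 T, Dd t =ᵐ[volume] weakGrad (d t)
  bounded : ∃ M : ℝ≥0, ∀ t ∈ Icc 0 T, sobolevNorm 0 (u t) ≤ M ∧ sobolevNorm 1 (d t) ≤ M
  eq_u : ∀ t ∈ Icc 0 T, ∀ᵐ x ∂volume,
    u t x = heat t u₀ x
      - ∫ s in (0 : ℝ)..t, heatProjDiv (t - s) (stress (u s) (weakGrad (d s))) x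
  eq_d : ∀ t ∈ Icc 0 T, ∀ᵐ x ∂volume,
    d t x = heat t d₀ x
      + ∫ s in (0 : ℝ)..t, heat (t - s) (dForce (u s) (d s) (weakGrad (d s))) x

end LiquidCrystal

end

/-! The system is read as a semilinear heat equation for the triple (u, d, ∇d), with the gradient as
an unknown of its own. Differentiating the equation of d puts the derivative on the heat kernel, so
the triple satisfies a closed integral equation. Its nonlinearities are polynomials without
derivatives, and its kernels e^{tΔ}, e^{tΔ}∂ₖ, e^{tΔ}ℙᵢⱼ∂ₖ all have L¹ norm O(t^{-1/2}) on bounded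
time intervals. Only the last kernel is not Gaussian: ℙ is not bounded on L^∞, but the pressure part
of e^{tΔ}ℙᵢⱼ∂ₖ is the integral over s > t of third derivatives of the heat kernel, whose L¹ norms
O(s^{-3/2}) integrate to O(t^{-1/2}) (`symKernel_pressureSym`, `symKernel_projSym_bound`).

Existence and uniqueness. With A²T equal to the threshold, u/A, d and ∇d/A are bounded by one
initially, and the Picard map contracts by 1/2 on the ball of radius two (`exists_isSol`). The third
component remains the gradient of the second (`hasWeakGrad_sysMild`). A competing mild solution is
known only up to null sets; one application of the Picard map turns it into a solution at every
point, and such solutions are unique by iteration over short windows (`IsSol.unique`,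
`IsSol.ae_eq_of_isMildSolution`).

Regularity. Spatial increments obey a singular integral inequality that makes solutions Lipschitz at
positive times (`IsSol.lipschitz`). By Rademacher's theorem and dominated convergence the pair (w,
Dw) then solves a system with the same kernels (`IsSol.isSol_derivSol`), so every bound propagates
to all orders. The t^{-1/2} singularity gives Hölder exponent 1/2 in time. The component d is driven
by the heat kernel alone, which is not singular in L¹, and is therefore Lipschitz in time
(`IsSol.norm_proj_sub_le`).

Unit length. Formally ρ = |d|² - 1 solves ρ_t + u·∇ρ = Δρ + 2|∇d|²ρ with ρ(0) = 0, and the maximum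
principle gives ρ = 0. The argument is run in discrete time, which needs no time derivative. One
step of length h replaces |d|² by e^{hΔ}|d|² evaluated at x - hu, plus 2h|∇d|²ρ and an error
O(h^{3/2}) (`exists_abs_normSq_step_le`), and the errors of t/h steps add up to O(√h). Since
regularity holds only for positive times, the iteration starts at δ > 0, where |ρ| = O(√δ) because
d₀ is Lipschitz (`IsSol.norm_director_eq_one`).

Sup norms. At time zero e^{tΔ}f need not converge to f in L^∞, but its norm converges: the heat flow
is a contraction, and mollification shows that the norm cannot drop in the limit
(`ae_norm_le_of_frequently_heat`). -/

noncomputable section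

namespace LiquidCrystal

/-! ### The heat kernel -/

section HeatKernel

variable {n : ℕ}

theorem heatKernel_nonneg {t : ℝ} (ht : 0 < t) (x : E n) : 0 ≤ heatKernel t x := by
  unfold heatKernel; positivity

theorem measurable_heatKernel : Measurable (Function.uncurry (heatKernel (n := n))) := by
  unfold heatKernel Function.uncurry
  exact ((measurable_const.mul measurable_fst).pow_const _).mul
    (Real.measurable_exp.comp (((measurable_snd.norm.pow_const 2).neg).div
      (measurable_const.mul measurable_fst)))

theorem continuous_heatKernel (t : ℝ) : Continuous (heatKernel (n := n) t) := by
  unfold heatKernel; fun_prop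

theorem heatKernel_neg (t : ℝ) (x : E n) : heatKernel t (-x) = heatKernel t x := by
  simp [heatKernel]

theorem heatKernel_eq_exp (t : ℝ) (x : E n) :
    heatKernel t x = (4 * Real.pi * t) ^ (-(n : ℝ) / 2) * Real.exp (-(1 / (4 * t)) * ‖x‖ ^ 2) := by
  unfold heatKernel; congr 2; ring

theorem integral_heatKernel {t : ℝ} (ht : 0 < t) : ∫ x : E n, heatKernel t x = 1 := by
  simp_rw [heatKernel_eq_exp]
  rw [integral_const_mul, GaussianFourier.integral_rexp_neg_mul_sq_norm (by positivity)]
  rw [show Real.pi / (1 / (4 * t)) = 4 * Real.pi * t by field_simp, finrank_euclideanSpace,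
    Fintype.card_fin, ← Real.rpow_add (by positivity)]
  rw [show -(n : ℝ) / 2 + n / 2 = 0 by ring, Real.rpow_zero]

theorem integrable_heatKernel {t : ℝ} (ht : 0 < t) : Integrable (heatKernel (n := n) t) :=
  Integrable.of_integral_ne_zero (by rw [integral_heatKernel ht]; exact one_ne_zero)

/-- The dimensional constant `2^{n/2}`. -/
def gaussConst (n : ℕ) : ℝ := (2 : ℝ) ^ ((n : ℝ) / 2)

theorem one_le_gaussConst (n : ℕ) : 1 ≤ gaussConst n :=
  Real.one_le_rpow (by norm_num) (by positivity)

/-- Half of the Gaussian exponent is set aside to absorb polynomial weights; the other half is the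
heat kernel at time 2t, of mass one. Moment bounds follow without evaluating Gaussian moments, and
2^{n/2} is the ratio of the normalisations. -/
theorem heatKernel_eq_two_mul {t : ℝ} (ht : 0 < t) (x : E n) :
    heatKernel t x = gaussConst n * Real.exp (-(‖x‖ / √(8 * t)) ^ 2) * heatKernel (2 * t) x := by
  unfold heatKernel gaussConst
  rw [show 4 * Real.pi * (2 * t) = 2 * (4 * Real.pi * t) by ring,
    Real.mul_rpow (x := 2) (y := 4 * Real.pi * t) (by norm_num) (by positivity), div_pow,
    Real.sq_sqrt (by positivity)]
  have h1 : (2 : ℝ) ^ ((n : ℝ) / 2) * 2 ^ (-(n : ℝ) / 2) = 1 := by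
    rw [← Real.rpow_add (by norm_num), show (n : ℝ) / 2 + -(n : ℝ) / 2 = 0 by ring, Real.rpow_zero]
  have h2 : Real.exp (-‖x‖ ^ 2 / (4 * t))
      = Real.exp (-(‖x‖ ^ 2 / (8 * t))) * Real.exp (-‖x‖ ^ 2 / (4 * (2 * t))) := by
    rw [← Real.exp_add]; congr 1; field_simp; ring
  rw [h2]
  linear_combination (-((4 * Real.pi * t) ^ (-(n : ℝ) / 2)
    * (Real.exp (-(‖x‖ ^ 2 / (8 * t))) * Real.exp (-‖x‖ ^ 2 / (4 * (2 * t)))))) * h1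

/-- The bound 1 + s² + s⁴/2 ≤ exp(s²) is enough for powers up to three. The cube is the largest
weight needed: it appears in the Taylor remainder of the variance in `abs_heat_normSq_sub_le`. -/
theorem pow_le_two_mul_exp_sq {s : ℝ} {k : ℕ} (hk : k ≤ 3) :
    s ^ k ≤ 2 * Real.exp (s ^ 2) := by
  have h := Real.quadratic_le_exp_of_nonneg (sq_nonneg s)
  interval_cases k <;> nlinarith [sq_nonneg (s - 1), sq_nonneg (s * (s - 1)), sq_nonneg (s ^ 2)]

theorem norm_pow_mul_heatKernel_le {t : ℝ} (ht : 0 < t) {k : ℕ} (hk : k ≤ 3) (x : E n) :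
    ‖x‖ ^ k * heatKernel t x
      ≤ 2 * gaussConst n * √(8 * t) ^ k * heatKernel (2 * t) x := by
  rw [heatKernel_eq_two_mul ht]
  have hs : 0 < √(8 * t) := by positivity
  set s := ‖x‖ / √(8 * t) with hsd
  have hx : ‖x‖ = s * √(8 * t) := by rw [hsd]; field_simp
  have h1 := pow_le_two_mul_exp_sq (s := s) hk
  have h2 : s ^ k * Real.exp (-s ^ 2) ≤ 2 := by
    rw [Real.exp_neg, ← div_eq_mul_inv, div_le_iff₀ (Real.exp_pos _)]; exact h1
  have h3 := heatKernel_nonneg (show 0 < 2 * t by positivity) x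
  have h4 : 0 ≤ gaussConst n := zero_le_one.trans (one_le_gaussConst n)
  rw [hx, mul_pow]
  calc s ^ k * √(8 * t) ^ k * (gaussConst n * Real.exp (-s ^ 2) * heatKernel (2 * t) x)
      = (s ^ k * Real.exp (-s ^ 2)) * (gaussConst n * √(8 * t) ^ k * heatKernel (2 * t) x) := by
        ring
    _ ≤ 2 * (gaussConst n * √(8 * t) ^ k * heatKernel (2 * t) x) := by gcongr
    _ = _ := by ring

theorem integrable_norm_pow_mul_heatKernel {t : ℝ} (ht : 0 < t) {k : ℕ} (hk : k ≤ 3) :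
    Integrable (fun x : E n => ‖x‖ ^ k * heatKernel t x) := by
  refine Integrable.mono' ((integrable_heatKernel (show 0 < 2 * t by positivity)).const_mul
    (2 * gaussConst n * √(8 * t) ^ k)) ?_ ?_
  · exact ((continuous_norm.pow k).mul (continuous_heatKernel t)).aestronglyMeasurable
  · filter_upwards with x
    rw [Real.norm_of_nonneg (mul_nonneg (by positivity) (heatKernel_nonneg ht x))]
    exact norm_pow_mul_heatKernel_le ht hk x

theorem integral_norm_pow_mul_heatKernel_le {t : ℝ} (ht : 0 < t) {k : ℕ} (hk : k ≤ 3) :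
    ∫ x : E n, ‖x‖ ^ k * heatKernel t x ≤ 2 * gaussConst n * √(8 * t) ^ k := by
  have h := integral_mono (integrable_norm_pow_mul_heatKernel ht hk)
    ((integrable_heatKernel (n := n) (show 0 < 2 * t by positivity)).const_mul
    (2 * gaussConst n * √(8 * t) ^ k)) (fun x => norm_pow_mul_heatKernel_le ht hk x)
  rwa [integral_const_mul, integral_heatKernel (by positivity), mul_one] at h

/-- The kernel `∂ₖ` of the heat kernel. -/
def gradKernel (t : ℝ) (k : Fin n) (x : E n) : ℝ := -(x k) / (2 * t) * heatKernel t x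

theorem measurable_gradKernel (k : Fin n) :
    Measurable (Function.uncurry (fun t (x : E n) => gradKernel t k x)) := by
  unfold gradKernel
  have h : Measurable fun p : ℝ × E n => p.2 k :=
    (by fun_prop : Continuous fun p : ℝ × E n => p.2 k).measurable
  exact (h.neg.div (measurable_const.mul measurable_fst)).mul measurable_heatKernel

theorem continuous_gradKernel (t : ℝ) (k : Fin n) : Continuous (gradKernel (n := n) t k) := by
  unfold gradKernel
  have := continuous_heatKernel (n := n) t
  fun_prop

theorem abs_coord_le (x : E n) (k : Fin n) : |x k| ≤ ‖x‖ := by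
  simpa using PiLp.norm_apply_le x k

theorem abs_gradKernel_le {t : ℝ} (ht : 0 < t) (k : Fin n) (x : E n) :
    |gradKernel t k x| ≤ 1 / (2 * t) * (‖x‖ ^ 1 * heatKernel t x) := by
  unfold gradKernel
  rw [abs_mul, abs_div, abs_neg, abs_of_pos (show 0 < 2 * t by positivity),
    abs_of_nonneg (heatKernel_nonneg ht x), pow_one, div_mul_eq_mul_div, div_mul_eq_mul_div,
    one_mul]
  have := heatKernel_nonneg ht x
  gcongr
  exact abs_coord_le x k

theorem integrable_gradKernel {t : ℝ} (ht : 0 < t) (k : Fin n) :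
    Integrable (gradKernel (n := n) t k) :=
  Integrable.mono' ((integrable_norm_pow_mul_heatKernel ht (k := 1) (by norm_num)).const_mul _)
    (continuous_gradKernel t k).aestronglyMeasurable
    (Eventually.of_forall fun x => abs_gradKernel_le ht k x)

theorem sqrt_div_self_eq {t : ℝ} (ht : 0 < t) : √t / t = t ^ (-(1 / 2) : ℝ) := by
  rw [Real.rpow_neg ht.le, ← Real.sqrt_eq_rpow]
  have := Real.mul_self_sqrt ht.le
  have h2 : 0 < √t := Real.sqrt_pos.2 ht
  field_simp
  nlinarith

theorem integral_abs_gradKernel_le {t : ℝ} (ht : 0 < t) (k : Fin n) :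
    ∫ x : E n, |gradKernel t k x| ≤ 4 * gaussConst n * t ^ (-(1 / 2) : ℝ) := by
  have h1 := integral_mono (integrable_gradKernel ht k).abs
    ((integrable_norm_pow_mul_heatKernel ht (k := 1) (by norm_num)).const_mul _)
    (fun x => abs_gradKernel_le ht k x)
  rw [integral_const_mul] at h1
  have h2 := integral_norm_pow_mul_heatKernel_le (n := n) ht (k := 1) (by norm_num)
  have h3 : 1 / (2 * t) * ∫ x : E n, ‖x‖ ^ 1 * heatKernel t x
      ≤ 1 / (2 * t) * (2 * gaussConst n * √(8 * t) ^ 1) := by gcongr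
  refine h1.trans (h3.trans ?_)
  rw [← sqrt_div_self_eq ht, Real.sqrt_mul (by norm_num), pow_one]
  have h8 : √8 ≤ 4 := by rw [Real.sqrt_le_left (by norm_num)]; norm_num
  have hg := one_le_gaussConst n
  calc 1 / (2 * t) * (2 * gaussConst n * (√8 * √t)) = √8 * gaussConst n * (√t / t) := by
        field_simp
    _ ≤ _ := by gcongr

theorem hasFDerivAt_heatKernel {t : ℝ} (x : E n) :
    HasFDerivAt (heatKernel (n := n) t) ((-(1 / (2 * t)) * heatKernel t x) • innerSL ℝ x) x := by
  have h1 : HasFDerivAt (fun x : E n => ‖x‖ ^ 2) (2 • innerSL ℝ x) x :=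
    (hasStrictFDerivAt_norm_sq x).hasFDerivAt
  have h2 := ((h1.const_mul (-(1 / (4 * t)))).exp).const_mul ((4 * Real.pi * t) ^ (-(n : ℝ) / 2))
  have h3 : heatKernel (n := n) t = fun x => (4 * Real.pi * t) ^ (-(n : ℝ) / 2)
      * Real.exp (-(1 / (4 * t)) * ‖x‖ ^ 2) := funext (heatKernel_eq_exp t)
  rw [h3]
  refine h2.congr_fderiv ?_
  ext v
  simp
  ring

theorem fderiv_heatKernel_apply (t : ℝ) (x : E n) (k : Fin n) :
    fderiv ℝ (heatKernel (n := n) t) x (e k) = gradKernel t k x := by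
  rw [(hasFDerivAt_heatKernel x).fderiv]
  simp [gradKernel, e, EuclideanSpace.inner_single_right]
  ring

/-- Since x_j G = -2t ∂_j G, integration by parts moves the derivative onto x_i and leaves δ_ij
times the mass. This exact second moment produces the term 2h|∇d|² in the evolution of |d|². -/
theorem integral_coord_mul_coord_mul_heatKernel {t : ℝ} (ht : 0 < t) (i j : Fin n) :
    ∫ x : E n, x i * x j * heatKernel t x = if i = j then 2 * t else 0 := by
  have hc : ∀ x : E n, fderiv ℝ (fun x : E n => x i) x (e j) = if i = j then 1 else 0 := by
    intro x
    have : (fun x : E n => x i) = (EuclideanSpace.proj i : E n →L[ℝ] ℝ) := rfl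
    rw [this, ContinuousLinearMap.fderiv]
    simp [e]
  have i2 : Integrable (fun x : E n => x i * x j * heatKernel t x) := by
    refine Integrable.mono' (integrable_norm_pow_mul_heatKernel ht (k := 2) (by norm_num)) ?_ ?_
    · have := continuous_heatKernel (n := n) t
      exact (by fun_prop : Continuous _).aestronglyMeasurable
    · filter_upwards with x
      rw [Real.norm_eq_abs, abs_mul, abs_mul, abs_of_nonneg (heatKernel_nonneg ht x), sq]
      have := heatKernel_nonneg ht x
      gcongr <;> exact abs_coord_le x _
  have i1 : Integrable (fun x : E n => x i * heatKernel t x) := by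
    refine Integrable.mono' (integrable_norm_pow_mul_heatKernel ht (k := 1) (by norm_num)) ?_ ?_
    · have := continuous_heatKernel (n := n) t
      exact (by fun_prop : Continuous _).aestronglyMeasurable
    · filter_upwards with x
      rw [Real.norm_eq_abs, abs_mul, abs_of_nonneg (heatKernel_nonneg ht x), pow_one]
      have := heatKernel_nonneg ht x
      gcongr; exact abs_coord_le x _
  have key := integral_mul_fderiv_eq_neg_fderiv_mul_of_integrable
    (μ := (volume : Measure (E n))) (f := fun x : E n => x i) (g := heatKernel t) (v := e j)
    (by simp_rw [hc]; exact (integrable_heatKernel ht).const_mul _)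
    (by simp_rw [fderiv_heatKernel_apply]
        refine (i2.const_mul (-(1 / (2 * t)))).congr (Eventually.of_forall fun x => ?_)
        simp [gradKernel]; ring)
    i1 (fun x _ => by fun_prop) (fun x _ => (hasFDerivAt_heatKernel x).differentiableAt)
  simp_rw [fderiv_heatKernel_apply, hc] at key
  rw [integral_const_mul, integral_heatKernel ht] at key
  have h5 : ∫ x : E n, x i * gradKernel t j x
      = -(1 / (2 * t)) * ∫ x : E n, x i * x j * heatKernel t x := by
    rw [← integral_const_mul]; congr 1; ext x; simp [gradKernel]; ring
  rw [h5] at key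
  field_simp at key
  rw [mul_comm] at key
  split_ifs at key ⊢ <;> linarith

end HeatKernel

/-! ### Kernels given by their Fourier symbols -/

section Symbols

variable {n : ℕ}

/-- The Fourier symbol of the heat semigroup. -/
def heatSym (t : ℝ) (ξ : E n) : ℂ := ((Real.exp (-(4 * Real.pi ^ 2 * t * ‖ξ‖ ^ 2)) : ℝ) : ℂ)

theorem norm_heatSym (t : ℝ) (ξ : E n) :
    ‖heatSym t ξ‖ = Real.exp (-(4 * Real.pi ^ 2 * t * ‖ξ‖ ^ 2)) := by
  unfold heatSym
  rw [Complex.norm_real, Real.norm_of_nonneg (Real.exp_pos _).le]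

theorem heatSym_add (s t : ℝ) (ξ : E n) : heatSym (s + t) ξ = heatSym s ξ * heatSym t ξ := by
  unfold heatSym
  rw [← Complex.ofReal_mul, ← Real.exp_add]; congr 2; ring

theorem measurable_heatSym : Measurable (Function.uncurry (heatSym (n := n))) := by
  unfold heatSym Function.uncurry
  fun_prop

theorem continuous_heatSym (t : ℝ) : Continuous (heatSym (n := n) t) := by
  unfold heatSym; fun_prop

/-- As a function of ξ the heat symbol is a scalar multiple of the heat kernel at time 1/(16π²t), so
the moment bounds above apply to it. -/
theorem integrable_norm_pow_mul_heatSym {t : ℝ} (ht : 0 < t) {k : ℕ} (hk : k ≤ 3) :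
    Integrable (fun ξ : E n => ‖ξ‖ ^ k * ‖heatSym t ξ‖) := by
  have hs : 0 < 1 / (16 * Real.pi ^ 2 * t) := by positivity
  set s := 1 / (16 * Real.pi ^ 2 * t) with hsd
  have hp : (0 : ℝ) < (4 * Real.pi * s) ^ (-(n : ℝ) / 2) := by positivity
  refine ((integrable_norm_pow_mul_heatKernel (n := n) hs hk).const_mul
    ((4 * Real.pi * s) ^ (-(n : ℝ) / 2))⁻¹).congr (Eventually.of_forall fun ξ => ?_)
  simp only
  rw [norm_heatSym, heatKernel_eq_exp,
    show -(1 / (4 * s)) * ‖ξ‖ ^ 2 = -(4 * Real.pi ^ 2 * t * ‖ξ‖ ^ 2) by rw [hsd]; field_simp; ring]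
  field_simp

theorem integrable_heatSym_mul {t : ℝ} (ht : 0 < t) {k : ℕ} (hk : k ≤ 3) {m : E n → ℂ}
    (hm : Measurable m) {c : ℝ} (hb : ∀ ξ, ‖m ξ‖ ≤ c * ‖ξ‖ ^ k) :
    Integrable (fun ξ : E n => heatSym t ξ * m ξ) := by
  refine Integrable.mono' ((integrable_norm_pow_mul_heatSym ht hk).const_mul c)
    ((continuous_heatSym t).measurable.mul hm).aestronglyMeasurable ?_
  filter_upwards with ξ
  rw [norm_mul]
  have := hb ξ
  have h0 := norm_nonneg (heatSym t ξ)
  nlinarith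

theorem fourier_heatKernel {t : ℝ} (ht : 0 < t) :
    𝓕 (fun x : E n => (heatKernel t x : ℂ)) = heatSym t := by
  ext ξ
  have hb : (0 : ℝ) < 1 / (4 * t) := by positivity
  have key := fourier_gaussian_innerProductSpace (V := E n) (b := ((1 / (4 * t) : ℝ) : ℂ))
    (by rw [Complex.ofReal_re]; exact hb) ξ
  have h1 : (fun x : E n => (heatKernel t x : ℂ)) = fun x =>
      (((4 * Real.pi * t) ^ (-(n : ℝ) / 2) : ℝ) : ℂ) *
        Complex.exp (-((1 / (4 * t) : ℝ) : ℂ) * ‖x‖ ^ 2) := by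
    ext x
    rw [heatKernel_eq_exp]
    push_cast
    rfl
  have h1' : 𝓕 (fun x : E n => (heatKernel t x : ℂ)) ξ
      = (((4 * Real.pi * t) ^ (-(n : ℝ) / 2) : ℝ) : ℂ) *
        𝓕 (fun x : E n => Complex.exp (-((1 / (4 * t) : ℝ) : ℂ) * ‖x‖ ^ 2)) ξ := by
    rw [h1, Real.fourier_eq', Real.fourier_eq', ← integral_const_mul]
    congr 1; funext x; simp only [smul_eq_mul]; ring
  rw [h1', key, finrank_euclideanSpace, Fintype.card_fin]
  have h2 : ((Real.pi : ℂ) / ((1 / (4 * t) : ℝ) : ℂ)) ^ ((n : ℂ) / 2)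
      = (((4 * Real.pi * t) ^ ((n : ℝ) / 2) : ℝ) : ℂ) := by
    rw [Complex.ofReal_cpow (by positivity)]
    congr 1
    · push_cast; field_simp
    · push_cast; rfl
  rw [h2, ← mul_assoc, ← Complex.ofReal_mul, ← Real.rpow_add (by positivity),
    show -(n : ℝ) / 2 + n / 2 = 0 by ring, Real.rpow_zero, Complex.ofReal_one, one_mul]
  unfold heatSym
  rw [Complex.ofReal_exp]
  congr 1
  push_cast
  field_simp

theorem norm_innerSL_smul_le (c : ℝ) (x : E n) : ‖c • innerSL ℝ x‖ ≤ |c| * ‖x‖ := by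
  rw [norm_smul, innerSL_apply_norm, Real.norm_eq_abs]

theorem norm_fderiv_heatKernel_le {t : ℝ} (ht : 0 < t) (x : E n) :
    ‖fderiv ℝ (heatKernel (n := n) t) x‖ ≤ 1 / (2 * t) * (‖x‖ ^ 1 * heatKernel t x) := by
  rw [(hasFDerivAt_heatKernel x).fderiv]
  refine (norm_innerSL_smul_le _ _).trans (le_of_eq ?_)
  rw [abs_mul, abs_neg, abs_of_pos (by positivity), abs_of_nonneg (heatKernel_nonneg ht x)]
  ring

theorem continuous_fderiv_heatKernel (t : ℝ) : Continuous (fderiv ℝ (heatKernel (n := n) t)) := by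
  have : fderiv ℝ (heatKernel (n := n) t)
      = fun x => (-(1 / (2 * t)) * heatKernel t x) • innerSL ℝ x :=
    funext fun x => (hasFDerivAt_heatKernel x).fderiv
  rw [this]
  have := continuous_heatKernel (n := n) t
  fun_prop

theorem fourier_gradKernel {t : ℝ} (ht : 0 < t) (k : Fin n) :
    𝓕 (fun x : E n => (gradKernel t k x : ℂ))
      = fun ξ => heatSym t ξ * (2 * Real.pi * Complex.I * (ξ k : ℂ)) := by
  have hd : ∀ x : E n, HasFDerivAt (fun x : E n => (heatKernel t x : ℂ))
      (Complex.ofRealCLM ∘L fderiv ℝ (heatKernel (n := n) t) x) x := fun x =>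
    Complex.ofRealCLM.hasFDerivAt.comp x
      (hasFDerivAt_heatKernel x).differentiableAt.hasFDerivAt
  have hfd : fderiv ℝ (fun x : E n => (heatKernel t x : ℂ))
      = fun x => Complex.ofRealCLM ∘L fderiv ℝ (heatKernel (n := n) t) x :=
    funext fun x => (hd x).fderiv
  have hint : Integrable (fderiv ℝ (fun x : E n => (heatKernel t x : ℂ))) := by
    rw [hfd]
    refine Integrable.mono' ((integrable_norm_pow_mul_heatKernel ht (k := 1) (by norm_num)).const_mul
      (1 / (2 * t))) ?_ (Eventually.of_forall fun x => ?_)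
    · have := continuous_fderiv_heatKernel (n := n) t
      exact (by fun_prop : Continuous _).aestronglyMeasurable
    · refine (ContinuousLinearMap.opNorm_comp_le _ _).trans ?_
      rw [Complex.ofRealCLM_norm, one_mul]
      exact norm_fderiv_heatKernel_le ht x
  have key := Real.fourier_fderiv (f := fun x : E n => (heatKernel t x : ℂ))
    (integrable_heatKernel ht).ofReal (fun x => (hd x).differentiableAt) hint
  ext ξ
  have k2 := congrArg (fun F : E n → E n →L[ℝ] ℂ => F ξ (e k)) key
  rw [Real.fourier_continuousLinearMap_apply hint, fourier_heatKernel ht] at k2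
  have h3 : (fun x => (fderiv ℝ (fun x : E n => (heatKernel t x : ℂ)) x) (e k))
      = fun x => (gradKernel t k x : ℂ) := by
    ext x
    rw [hfd, ← fderiv_heatKernel_apply]; rfl
  rw [h3] at k2
  rw [k2]
  have h4 : innerSL ℝ ξ (e k) = ξ k := by
    rw [innerSL_apply_apply]; simp [e, EuclideanSpace.inner_single_right]
  rw [VectorFourier.fourierSMulRight_apply, neg_apply, neg_apply, h4]
  simp
  ring

/-- The kernel with Fourier symbol `heatSym t * m`. -/
def symKernel (m : E n → ℂ) (t : ℝ) (x : E n) : ℂ := 𝓕⁻ (fun ξ => heatSym t ξ * m ξ) x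

/-- Fubini requires only one genuinely integrable kernel; the other factor may be any inverse
transform of an integrable symbol. This matters for the Helmholtz symbols, whose kernels are not
known to be integrable beforehand. -/
theorem integral_mul_fourierInv {g m : E n → ℂ} (hg : Integrable g) (hm : Integrable m) (x : E n) :
    ∫ y, g (x - y) * 𝓕⁻ m y = 𝓕⁻ (fun ξ => 𝓕 g ξ * m ξ) x := by
  have hI : Integrable (Function.uncurry fun y ξ : E n =>
      g (x - y) * (Complex.exp (((2 * Real.pi * inner ℝ ξ y : ℝ) : ℂ) * Complex.I) * m ξ))
      (volume.prod volume) := by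
    have h1 : Integrable (fun p : E n × E n => g (x - p.1) * m p.2) (volume.prod volume) :=
      (hg.comp_sub_left x).mul_prod hm
    refine h1.mono ?_ (Eventually.of_forall fun p => ?_)
    · have h2 : AEStronglyMeasurable (fun p : E n × E n =>
          Complex.exp (((2 * Real.pi * inner ℝ p.2 p.1 : ℝ) : ℂ) * Complex.I))
          (volume.prod volume) := (by fun_prop : Continuous _).aestronglyMeasurable
      refine (h2.mul h1.aestronglyMeasurable).congr (Eventually.of_forall fun p => ?_)
      simp only [Function.uncurry, Pi.mul_apply]; ring
    · simp only [Function.uncurry, norm_mul, Complex.norm_exp_ofReal_mul_I, one_mul, le_refl]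
  simp_rw [Real.fourierInv_eq', Real.fourier_eq', smul_eq_mul, ← integral_const_mul]
  rw [integral_integral_swap hI]
  refine integral_congr_ae (Eventually.of_forall fun ξ => ?_)
  simp only
  have h3 : ∀ y : E n, g (x - y) * (Complex.exp (((2 * Real.pi * inner ℝ ξ y : ℝ) : ℂ) * Complex.I)
      * m ξ) = (Complex.exp (((2 * Real.pi * inner ℝ ξ x : ℝ) : ℂ) * Complex.I) * m ξ) *
        (fun z => Complex.exp (((-2 * Real.pi * inner ℝ z ξ : ℝ) : ℂ) * Complex.I) * g z)
          (x - y) := by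
    intro y
    have : Complex.exp (((2 * Real.pi * inner ℝ ξ y : ℝ) : ℂ) * Complex.I)
        = Complex.exp (((2 * Real.pi * inner ℝ ξ x : ℝ) : ℂ) * Complex.I)
          * Complex.exp (((-2 * Real.pi * inner ℝ (x - y) ξ : ℝ) : ℂ) * Complex.I) := by
      rw [← Complex.exp_add, ← add_mul, ← Complex.ofReal_add]
      congr 3
      rw [inner_sub_left, real_inner_comm ξ x, real_inner_comm ξ y]; ring
    simp only [this]; ring
  simp_rw [h3]
  rw [integral_const_mul, integral_sub_left_eq_self
    (fun z => Complex.exp (((-2 * Real.pi * inner ℝ z ξ : ℝ) : ℂ) * Complex.I) * g z)]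
  ring

theorem integral_heatKernel_mul_symKernel {m : E n → ℂ} {a t : ℝ} (ha : 0 < a)
    (hm : Integrable fun ξ => heatSym t ξ * m ξ) (x : E n) :
    ∫ y, (heatKernel a (x - y) : ℂ) * symKernel m t y = symKernel m (t + a) x := by
  unfold symKernel
  rw [integral_mul_fourierInv (g := fun x => (heatKernel a x : ℂ)) (integrable_heatKernel ha).ofReal
    hm, fourier_heatKernel ha]
  refine congrArg (fun f : E n → ℂ => 𝓕⁻ f x) (funext fun ξ => ?_)
  simp only [heatSym_add]; ring

theorem integral_gradKernel_mul_symKernel {m : E n → ℂ} {a t : ℝ} (ha : 0 < a) (k : Fin n)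
    (hm : Integrable fun ξ => heatSym t ξ * m ξ) (x : E n) :
    ∫ y, (gradKernel a k (x - y) : ℂ) * symKernel m t y
      = symKernel (fun ξ => 2 * Real.pi * Complex.I * (ξ k : ℂ) * m ξ) (t + a) x := by
  unfold symKernel
  rw [integral_mul_fourierInv (g := fun x => (gradKernel a k x : ℂ))
    (integrable_gradKernel ha k).ofReal hm, fourier_gradKernel ha]
  refine congrArg (fun f : E n → ℂ => 𝓕⁻ f x) (funext fun ξ => ?_)
  simp only [heatSym_add]; ring

theorem norm_two_pi_I_mul_coord_le (k : Fin n) (ξ : E n) :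
    ‖2 * Real.pi * Complex.I * (ξ k : ℂ)‖ ≤ 2 * Real.pi * ‖ξ‖ ^ 1 := by
  rw [norm_mul, norm_mul, norm_mul, Complex.norm_I, Complex.norm_real, Complex.norm_real,
    Real.norm_of_nonneg Real.pi_pos.le, Complex.norm_ofNat, pow_one, mul_one]
  have := abs_coord_le ξ k
  gcongr
  exact this

theorem measurable_two_pi_I_mul_coord (k : Fin n) :
    Measurable fun ξ : E n => 2 * Real.pi * Complex.I * (ξ k : ℂ) :=
  (by fun_prop : Continuous fun ξ : E n => 2 * Real.pi * Complex.I * (ξ k : ℂ)).measurable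

theorem symKernel_one {t : ℝ} (ht : 0 < t) (x : E n) :
    symKernel (fun _ => 1) t x = heatKernel t x := by
  have hc : Continuous (fun x : E n => (heatKernel t x : ℂ)) :=
    Complex.continuous_ofReal.comp (continuous_heatKernel t)
  have h1 : Integrable (heatSym (n := n) t) := by
    simpa using integrable_heatSym_mul (n := n) ht (k := 0) (by norm_num) (m := fun _ => 1)
      measurable_const (c := 1) (by simp)
  have := hc.fourierInv_fourier_eq (integrable_heatKernel ht).ofReal
    (by rw [fourier_heatKernel ht]; exact h1)
  rw [fourier_heatKernel ht] at this
  unfold symKernel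
  simp only [mul_one]
  exact congrFun this x

theorem symKernel_grad {t : ℝ} (ht : 0 < t) (k : Fin n) (x : E n) :
    symKernel (fun ξ => 2 * Real.pi * Complex.I * (ξ k : ℂ)) t x = gradKernel t k x := by
  have hc : Continuous (fun x : E n => (gradKernel t k x : ℂ)) :=
    Complex.continuous_ofReal.comp (continuous_gradKernel t k)
  have h1 := integrable_heatSym_mul (n := n) ht (k := 1) (by norm_num)
    (measurable_two_pi_I_mul_coord k) (norm_two_pi_I_mul_coord_le k)
  have := hc.fourierInv_fourier_eq (integrable_gradKernel ht k).ofReal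
    (by rw [fourier_gradKernel ht]; exact h1)
  rw [fourier_gradKernel ht] at this
  exact congrFun this x

theorem stronglyMeasurable_symKernel {m : E n → ℂ} (hm : Measurable m) :
    StronglyMeasurable (Function.uncurry (symKernel m)) := by
  have : Function.uncurry (symKernel m) = fun p : ℝ × E n => ∫ ξ : E n,
      Complex.exp (((2 * Real.pi * inner ℝ ξ p.2 : ℝ) : ℂ) * Complex.I)
        * (heatSym p.1 ξ * m ξ) := by
    ext p
    simp only [Function.uncurry, symKernel, Real.fourierInv_eq', smul_eq_mul]
  rw [this]
  refine StronglyMeasurable.integral_prod_right (f := fun (p : ℝ × E n) (ξ : E n) =>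
      Complex.exp (((2 * Real.pi * inner ℝ ξ p.2 : ℝ) : ℂ) * Complex.I)
        * (heatSym p.1 ξ * m ξ)) ?_
  refine Measurable.stronglyMeasurable ?_
  refine Measurable.mul ?_ (Measurable.mul ?_ (hm.comp measurable_snd))
  · exact (by fun_prop : Continuous fun q : (ℝ × E n) × E n =>
      Complex.exp (((2 * Real.pi * inner ℝ q.2 q.1.2 : ℝ) : ℂ) * Complex.I)).measurable
  · exact measurable_heatSym.comp ((measurable_fst.comp measurable_fst).prodMk measurable_snd)

theorem integrable_convolution_norm_le {f g : E n → ℂ} (hf : Integrable f) (hg : Integrable g) :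
    Integrable (fun x => ∫ y, f (x - y) * g y) ∧
      ∫ x, ‖∫ y, f (x - y) * g y‖ ≤ (∫ x, ‖f x‖) * ∫ x, ‖g x‖ := by
  have h1 : Integrable (fun p : E n × E n => f (p.1 - p.2) * g p.2) (volume.prod volume) := by
    have := hg.convolution_integrand (ContinuousLinearMap.mul ℝ ℂ) hf
    simpa [mul_comm] using this
  refine ⟨h1.integral_prod_left, ?_⟩
  calc ∫ x, ‖∫ y, f (x - y) * g y‖ ≤ ∫ x, ∫ y, ‖f (x - y) * g y‖ :=
        integral_mono h1.integral_prod_left.norm h1.norm.integral_prod_left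
          fun x => norm_integral_le_integral_norm _
    _ = ∫ y, ∫ x, ‖f (x - y) * g y‖ := integral_integral_swap h1.norm
    _ = ∫ y, (∫ x, ‖f x‖) * ‖g y‖ := by
        congr 1; ext y
        simp_rw [norm_mul]
        rw [integral_mul_const, integral_sub_right_eq_self (fun x => ‖f x‖)]
    _ = _ := integral_const_mul _ _

/-- One further derivative is bought with an extra time a: it is a convolution with `gradKernel a
k`, and Young's inequality multiplies the L¹ norm by O(a^{-1/2}). -/
theorem symKernel_grad_mul_bound {m : E n → ℂ} {a t B : ℝ} (ha : 0 < a) (k : Fin n)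
    (hm : Integrable fun ξ => heatSym t ξ * m ξ)
    (hi : Integrable (symKernel m t)) (hB : ∫ x, ‖symKernel m t x‖ ≤ B) :
    Integrable (symKernel (fun ξ => 2 * Real.pi * Complex.I * (ξ k : ℂ) * m ξ) (t + a)) ∧
      ∫ x, ‖symKernel (fun ξ => 2 * Real.pi * Complex.I * (ξ k : ℂ) * m ξ) (t + a) x‖
        ≤ 4 * gaussConst n * a ^ (-(1 / 2) : ℝ) * B := by
  have hg : Integrable fun x : E n => (gradKernel a k x : ℂ) := (integrable_gradKernel ha k).ofReal
  have h := integrable_convolution_norm_le hg hi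
  have h0 : symKernel (fun ξ => 2 * Real.pi * Complex.I * (ξ k : ℂ) * m ξ) (t + a)
      = fun x => ∫ y, (gradKernel a k (x - y) : ℂ) * symKernel m t y :=
    funext fun x => (integral_gradKernel_mul_symKernel ha k hm x).symm
  rw [h0]
  refine ⟨h.1, h.2.trans ?_⟩
  have h2 := integral_abs_gradKernel_le ha k
  have h3 : 0 ≤ ∫ x : E n, ‖symKernel m t x‖ := integral_nonneg fun x => norm_nonneg _
  simp_rw [Complex.norm_real, Real.norm_eq_abs]
  gcongr
  exact (integral_nonneg fun x => abs_nonneg _).trans h2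

/-- The symbol `(2πi)³ ξᵢ ξⱼ ξₖ`. -/
def cubicSym (i j k : Fin n) (ξ : E n) : ℂ :=
  2 * Real.pi * Complex.I * (ξ i : ℂ) * (2 * Real.pi * Complex.I * (ξ j : ℂ)
    * (2 * Real.pi * Complex.I * (ξ k : ℂ) * 1))

/-- The time t is split into quarters: one carries the heat kernel, each of the other three carries
one derivative. The factor 8 is the cube of (1/4)^{-1/2}. -/
theorem cubicSym_bound {t : ℝ} (ht : 0 < t) (i j k : Fin n) :
    Integrable (symKernel (cubicSym i j k) t) ∧
      ∫ x, ‖symKernel (cubicSym i j k) t x‖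
        ≤ 8 * (4 * gaussConst n) ^ 3 * t ^ (-(3 / 2) : ℝ) := by
  have ha : 0 < t / 4 := by positivity
  have m0 : Measurable (fun _ : E n => (1 : ℂ)) := measurable_const
  have i0 := integrable_heatSym_mul (n := n) ha (k := 0) (by norm_num) m0 (c := 1) (by simp)
  have e0 : symKernel (fun _ : E n => (1 : ℂ)) (t / 4) = fun x => (heatKernel (t / 4) x : ℂ) :=
    funext fun x => symKernel_one ha x
  have b0 : ∫ x : E n, ‖symKernel (fun _ : E n => (1 : ℂ)) (t / 4) x‖ ≤ 1 := by
    rw [e0]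
    simp_rw [Complex.norm_real, Real.norm_of_nonneg (heatKernel_nonneg ha _)]
    exact (integral_heatKernel ha).le
  have h1 := symKernel_grad_mul_bound ha k i0 (by rw [e0]; exact (integrable_heatKernel ha).ofReal)
    b0
  have m1 := (measurable_two_pi_I_mul_coord k).mul m0
  have n1 : ∀ ξ : E n, ‖2 * Real.pi * Complex.I * (ξ k : ℂ) * 1‖ ≤ 2 * Real.pi * ‖ξ‖ ^ 1 := by
    intro ξ; rw [mul_one]; exact norm_two_pi_I_mul_coord_le k ξ
  have i1 := integrable_heatSym_mul (n := n) (show 0 < t / 4 + t / 4 by positivity) (k := 1)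
    (by norm_num) m1 n1
  have h2 := symKernel_grad_mul_bound ha j i1 h1.1 h1.2
  have m2 := (measurable_two_pi_I_mul_coord j).mul m1
  have n2 : ∀ ξ : E n, ‖2 * Real.pi * Complex.I * (ξ j : ℂ)
      * (2 * Real.pi * Complex.I * (ξ k : ℂ) * 1)‖ ≤ (2 * Real.pi) ^ 2 * ‖ξ‖ ^ 2 := by
    intro ξ; rw [norm_mul]
    calc _ ≤ (2 * Real.pi * ‖ξ‖ ^ 1) * (2 * Real.pi * ‖ξ‖ ^ 1) := by
          gcongr
          · exact norm_two_pi_I_mul_coord_le j ξ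
          · exact n1 ξ
      _ = _ := by ring
  have i2 := integrable_heatSym_mul (n := n) (show 0 < t / 4 + t / 4 + t / 4 by positivity) (k := 2)
    (by norm_num) m2 n2
  have h3 := symKernel_grad_mul_bound ha i i2 h2.1 h2.2
  rw [show t / 4 + t / 4 + t / 4 + t / 4 = t by ring] at h3
  refine ⟨h3.1, h3.2.trans (le_of_eq ?_)⟩
  have hp : (t / 4) ^ (-(1 / 2) : ℝ) = 2 * t ^ (-(1 / 2) : ℝ) := by
    rw [Real.div_rpow ht.le (by norm_num), Real.rpow_neg (by norm_num : (0 : ℝ) ≤ 4),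
      ← Real.sqrt_eq_rpow, show (4 : ℝ) = 2 ^ 2 by norm_num, Real.sqrt_sq (by norm_num)]
    field_simp
  have hq : t ^ (-(3 / 2) : ℝ)
      = t ^ (-(1 / 2) : ℝ) * (t ^ (-(1 / 2) : ℝ) * t ^ (-(1 / 2) : ℝ)) := by
    rw [← Real.rpow_add ht, ← Real.rpow_add ht]; norm_num
  rw [hp, hq]; ring

end Symbols

/-! ### The kernel of `e^{tΔ} ℙ ∂ₖ` -/

section ProjKernel

variable {n : ℕ}

/-- The symbol of `ℙᵢⱼ ∂ₖ`. -/
def projSym (i j k : Fin n) (ξ : E n) : ℂ :=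
  (helmholtzSymbol i j ξ : ℂ) * (2 * Real.pi * Complex.I * (ξ k : ℂ))

/-- The part of the symbol of `ℙᵢⱼ ∂ₖ` that comes from the pressure. -/
def pressureSym (i j k : Fin n) (ξ : E n) : ℂ :=
  -((ξ i * ξ j / ‖ξ‖ ^ 2 : ℝ) : ℂ) * (2 * Real.pi * Complex.I * (ξ k : ℂ))

theorem projKernel_eq (t : ℝ) (i j k : Fin n) (x : E n) :
    projKernel t i j k x = (symKernel (projSym i j k) t x).re := by
  unfold projKernel symKernel projSym heatSym
  simp only [mul_assoc]

theorem measurable_coord (i : Fin n) : Measurable fun ξ : E n => ξ i :=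
  (by fun_prop : Continuous fun ξ : E n => ξ i).measurable

theorem measurable_pressureSym (i j k : Fin n) : Measurable (pressureSym i j k) := by
  unfold pressureSym
  exact (Complex.measurable_ofReal.comp (((measurable_coord i).mul (measurable_coord j)).div
    (measurable_norm.pow_const 2))).neg.mul (measurable_two_pi_I_mul_coord k)

theorem projSym_eq (i j k : Fin n) (ξ : E n) : projSym i j k ξ
    = (if i = j then 1 else 0) * (2 * Real.pi * Complex.I * (ξ k : ℂ)) + pressureSym i j k ξ := by
  unfold projSym pressureSym helmholtzSymbol
  split_ifs <;> push_cast <;> ring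

theorem measurable_projSym (i j k : Fin n) : Measurable (projSym i j k) := by
  have : projSym i j k = fun ξ => (if i = j then 1 else 0)
      * (2 * Real.pi * Complex.I * (ξ k : ℂ)) + pressureSym i j k ξ := funext (projSym_eq i j k)
  rw [this]
  exact ((measurable_two_pi_I_mul_coord k).const_mul _).add (measurable_pressureSym i j k)

theorem norm_pressureSym_le (i j k : Fin n) (ξ : E n) :
    ‖pressureSym i j k ξ‖ ≤ 2 * Real.pi * ‖ξ‖ ^ 1 := by
  unfold pressureSym
  rw [norm_mul, norm_neg, Complex.norm_real, Real.norm_eq_abs, abs_div, abs_mul,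
    abs_of_nonneg (sq_nonneg ‖ξ‖)]
  have h1 : |ξ i| * |ξ j| / ‖ξ‖ ^ 2 ≤ 1 := by
    apply div_le_one_of_le₀ _ (sq_nonneg _)
    rw [sq]
    gcongr <;> exact abs_coord_le ξ _
  calc _ ≤ 1 * (2 * Real.pi * ‖ξ‖ ^ 1) := by
        gcongr
        exact norm_two_pi_I_mul_coord_le k ξ
    _ = _ := one_mul _

theorem integrable_heatSym_mul_pressureSym {t : ℝ} (ht : 0 < t) (i j k : Fin n) :
    Integrable fun ξ => heatSym t ξ * pressureSym i j k ξ :=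
  integrable_heatSym_mul ht (k := 1) (by norm_num) (measurable_pressureSym i j k)
    (norm_pressureSym_le i j k)

theorem integrable_heatSym_mul_grad {t : ℝ} (ht : 0 < t) (k : Fin n) :
    Integrable fun ξ : E n => heatSym t ξ * (2 * Real.pi * Complex.I * (ξ k : ℂ)) :=
  integrable_heatSym_mul ht (k := 1) (by norm_num) (measurable_two_pi_I_mul_coord k)
    (norm_two_pi_I_mul_coord_le k)

theorem integrable_heatSym_mul_projSym {t : ℝ} (ht : 0 < t) (i j k : Fin n) :
    Integrable fun ξ => heatSym t ξ * projSym i j k ξ := by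
  refine (((integrable_heatSym_mul_grad ht k).const_mul (if i = j then 1 else 0)).add
    (integrable_heatSym_mul_pressureSym ht i j k)).congr (Eventually.of_forall fun ξ => ?_)
  simp only [projSym_eq, Pi.add_apply]; ring

theorem measurable_cubicSym (i j k : Fin n) : Measurable (cubicSym i j k) := by
  unfold cubicSym
  exact (measurable_two_pi_I_mul_coord i).mul ((measurable_two_pi_I_mul_coord j).mul
    ((measurable_two_pi_I_mul_coord k).mul measurable_const))

/-- Since the time derivative of the heat symbol is -4π²|ξ|² times itself, this identity says that
the heat symbol times the cubic symbol is minus the time derivative of the heat symbol times the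
pressure symbol. At ξ = 0 both sides vanish. -/
theorem cubicSym_eq (i j k : Fin n) (ξ : E n) : cubicSym i j k ξ
    = (4 * Real.pi ^ 2 * ‖ξ‖ ^ 2 : ℝ) * pressureSym i j k ξ := by
  unfold cubicSym pressureSym
  rcases eq_or_ne ξ 0 with rfl | h
  · simp
  have h' : (‖ξ‖ : ℂ) ≠ 0 := by exact_mod_cast (norm_ne_zero_iff.2 h)
  push_cast
  field_simp
  linear_combination 4 * ((ξ i : ℂ) * (ξ j : ℂ) * (ξ k : ℂ)) * Complex.I_sq

theorem integral_Ioi_heatSym {t : ℝ} {ξ : E n} (h : ξ ≠ 0) :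
    IntegrableOn (fun s => Real.exp (-(4 * Real.pi ^ 2 * s * ‖ξ‖ ^ 2))) (Ioi t) ∧
    ∫ s in Ioi t, Real.exp (-(4 * Real.pi ^ 2 * s * ‖ξ‖ ^ 2))
      = (4 * Real.pi ^ 2 * ‖ξ‖ ^ 2)⁻¹ * Real.exp (-(4 * Real.pi ^ 2 * t * ‖ξ‖ ^ 2)) := by
  have h' := norm_pos_iff.2 h
  have hneg : -(4 * Real.pi ^ 2 * ‖ξ‖ ^ 2) < 0 := by
    have : 0 < 4 * Real.pi ^ 2 * ‖ξ‖ ^ 2 := by positivity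
    linarith
  have he : ∀ s : ℝ, -(4 * Real.pi ^ 2 * s * ‖ξ‖ ^ 2) = -(4 * Real.pi ^ 2 * ‖ξ‖ ^ 2) * s :=
    fun s => by ring
  simp_rw [he]
  refine ⟨integrableOn_exp_mul_Ioi hneg t, ?_⟩
  rw [integral_exp_mul_Ioi hneg]
  field_simp

/-- The time integral over (t, ∞) of the modulus is exactly the modulus of the heat symbol at t
times the pressure symbol, which is integrable in ξ. -/
theorem integrable_heatSym_mul_cubicSym_prod {t : ℝ} (ht : 0 < t) (i j k : Fin n) :
    Integrable (fun p : E n × ℝ => heatSym p.2 p.1 * cubicSym i j k p.1)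
      (volume.prod (volume.restrict (Ioi t))) := by
  have hm : AEStronglyMeasurable (fun p : E n × ℝ => heatSym p.2 p.1 * cubicSym i j k p.1)
      (volume.prod (volume.restrict (Ioi t))) :=
    ((measurable_heatSym.comp measurable_swap).mul
      ((measurable_cubicSym i j k).comp measurable_fst)).aestronglyMeasurable
  rw [integrable_prod_iff hm]
  constructor
  · refine Eventually.of_forall fun ξ => ?_
    rcases eq_or_ne ξ 0 with rfl | h
    · simp [cubicSym]
    · have h1 : Integrable (fun s => heatSym s ξ) (volume.restrict (Ioi t)) :=
        (integral_Ioi_heatSym h).1.ofReal (𝕜 := ℂ)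
      exact (h1.mul_const (cubicSym i j k ξ) :)
  · refine (integrable_heatSym_mul_pressureSym ht i j k).norm.congr
      (Eventually.of_forall fun ξ => ?_)
    simp only [norm_mul, norm_heatSym]
    rw [integral_mul_const, cubicSym_eq, norm_mul, Complex.norm_real,
      Real.norm_of_nonneg (by positivity)]
    rcases eq_or_ne ξ 0 with rfl | h
    · simp [pressureSym]
    · rw [(integral_Ioi_heatSym h).2]
      have h' := norm_pos_iff.2 h
      field_simp

/-- The pressure symbol is not smooth at the origin. Integrating its time derivative from t to
infinity removes the factor |ξ|^{-2} and leaves third derivatives of the heat kernel, whose L¹ norms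
are under control. -/
theorem symKernel_pressureSym {t : ℝ} (ht : 0 < t) (i j k : Fin n) (x : E n) :
    symKernel (pressureSym i j k) t x = ∫ s in Ioi t, symKernel (cubicSym i j k) s x := by
  have hs : ∀ ξ : E n, heatSym t ξ * pressureSym i j k ξ
      = ∫ s in Ioi t, heatSym s ξ * cubicSym i j k ξ := by
    intro ξ
    rw [integral_mul_const, cubicSym_eq]
    rcases eq_or_ne ξ 0 with rfl | h
    · simp [pressureSym]
    · have h1 : ∫ s in Ioi t, heatSym s ξ
          = (((4 * Real.pi ^ 2 * ‖ξ‖ ^ 2)⁻¹ * Real.exp (-(4 * Real.pi ^ 2 * t * ‖ξ‖ ^ 2)) : ℝ) : ℂ) := by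
        rw [← (integral_Ioi_heatSym h).2, ← integral_complex_ofReal]; rfl
      rw [h1]
      have h' : (‖ξ‖ : ℂ) ≠ 0 := by exact_mod_cast (norm_ne_zero_iff.2 h)
      unfold heatSym
      have := Real.pi_ne_zero
      have h'' : (Real.pi : ℂ) ≠ 0 := by exact_mod_cast this
      simp only [Complex.ofReal_mul, Complex.ofReal_inv, Complex.ofReal_pow, Complex.ofReal_ofNat]
      field_simp
  unfold symKernel
  simp_rw [Real.fourierInv_eq', smul_eq_mul, hs, ← integral_const_mul]
  refine integral_integral_swap (f := fun (ξ : E n) (s : ℝ) =>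
    Complex.exp (((2 * Real.pi * inner ℝ ξ x : ℝ) : ℂ) * Complex.I)
      * (heatSym s ξ * cubicSym i j k ξ)) ?_
  have h0 := integrable_heatSym_mul_cubicSym_prod ht i j k
  refine h0.mono ?_ (Eventually.of_forall fun p => ?_)
  · have h2 : AEStronglyMeasurable (fun p : E n × ℝ =>
        Complex.exp (((2 * Real.pi * inner ℝ p.1 x : ℝ) : ℂ) * Complex.I))
        (volume.prod (volume.restrict (Ioi t))) := (by fun_prop : Continuous _).aestronglyMeasurable
    exact h2.mul h0.aestronglyMeasurable
  · simp only [Function.uncurry, norm_mul, Complex.norm_exp_ofReal_mul_I, one_mul, le_refl]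

/-- The rate s^{-3/2} is integrable at infinity with integral 2 t^{-1/2}, the same order as one
derivative of the heat kernel. -/
theorem integrable_symKernel_cubicSym_prod {t : ℝ} (ht : 0 < t) (i j k : Fin n) :
    Integrable (fun p : ℝ × E n => symKernel (cubicSym i j k) p.1 p.2)
      ((volume.restrict (Ioi t)).prod volume) ∧
    ∫ s in Ioi t, ∫ x, ‖symKernel (cubicSym i j k) s x‖
      ≤ 16 * (4 * gaussConst n) ^ 3 * t ^ (-(1 / 2) : ℝ) := by
  have hm : StronglyMeasurable (fun p : ℝ × E n => symKernel (cubicSym i j k) p.1 p.2) :=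
    stronglyMeasurable_symKernel (measurable_cubicSym i j k)
  have hpow : IntegrableOn (fun s : ℝ => 8 * (4 * gaussConst n) ^ 3 * s ^ (-(3 / 2) : ℝ)) (Ioi t) :=
    (integrableOn_Ioi_rpow_of_lt (by norm_num) ht).const_mul _
  have hle : ∀ s ∈ Ioi t, ∫ x, ‖symKernel (cubicSym i j k) s x‖
      ≤ 8 * (4 * gaussConst n) ^ 3 * s ^ (-(3 / 2) : ℝ) := fun s hs =>
    (cubicSym_bound (ht.trans hs) i j k).2
  have hint : IntegrableOn (fun s => ∫ x, ‖symKernel (cubicSym i j k) s x‖) (Ioi t) := by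
    refine Integrable.mono' hpow ?_ ?_
    · exact (StronglyMeasurable.integral_prod_right
        (f := fun s x => ‖symKernel (cubicSym i j k) s x‖) hm.norm).aestronglyMeasurable
    · refine (ae_restrict_iff' measurableSet_Ioi).2 (Eventually.of_forall fun s hs => ?_)
      rw [Real.norm_of_nonneg (integral_nonneg fun x => norm_nonneg _)]
      exact hle s hs
  constructor
  · rw [integrable_prod_iff hm.aestronglyMeasurable]
    exact ⟨(ae_restrict_iff' measurableSet_Ioi).2 (Eventually.of_forall fun s hs =>
      (cubicSym_bound (ht.trans hs) i j k).1), hint⟩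
  · refine (setIntegral_mono_on hint hpow measurableSet_Ioi hle).trans (le_of_eq ?_)
    rw [integral_const_mul, integral_Ioi_rpow_of_lt (by norm_num) ht,
      show (-(3 / 2) : ℝ) + 1 = -(1 / 2) by norm_num]
    ring

/-- The constant in the `L¹` bounds of the kernels of order one. -/
def kernelConst (n : ℕ) : ℝ := 4 * gaussConst n + 16 * (4 * gaussConst n) ^ 3

theorem one_le_kernelConst (n : ℕ) : 1 ≤ kernelConst n := by
  unfold kernelConst
  have := one_le_gaussConst n
  have : 0 ≤ (4 * gaussConst n) ^ 3 := by positivity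
  linarith

theorem integral_abs_gradKernel_le_kernelConst {t : ℝ} (ht : 0 < t) (k : Fin n) :
    ∫ x : E n, |gradKernel t k x| ≤ kernelConst n * t ^ (-(1 / 2) : ℝ) := by
  refine (integral_abs_gradKernel_le ht k).trans ?_
  unfold kernelConst
  have := one_le_gaussConst n
  gcongr
  have : 0 ≤ 16 * (4 * gaussConst n) ^ 3 := by positivity
  linarith

theorem symKernel_projSym {t : ℝ} (ht : 0 < t) (i j k : Fin n) (x : E n) :
    symKernel (projSym i j k) t x = (if i = j then 1 else 0) * (gradKernel t k x : ℂ)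
      + ∫ s in Ioi t, symKernel (cubicSym i j k) s x := by
  rw [← symKernel_pressureSym ht, ← symKernel_grad ht]
  unfold symKernel
  simp only [Real.fourierInv_eq', smul_eq_mul]
  have hb : ∀ m : E n → ℂ, Integrable m → Integrable fun ξ =>
      Complex.exp (((2 * Real.pi * inner ℝ ξ x : ℝ) : ℂ) * Complex.I) * m ξ := by
    intro m hm
    refine hm.mono ?_ (Eventually.of_forall fun p => ?_)
    · exact ((by fun_prop : Continuous fun ξ : E n =>
        Complex.exp (((2 * Real.pi * inner ℝ ξ x : ℝ) : ℂ) * Complex.I)).aestronglyMeasurable).mul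
          hm.aestronglyMeasurable
    · simp only [norm_mul, Complex.norm_exp_ofReal_mul_I, one_mul, le_refl]
  rw [← integral_const_mul, ← integral_add ((hb _ (integrable_heatSym_mul_grad ht k)).const_mul _)
    (hb _ (integrable_heatSym_mul_pressureSym ht i j k))]
  congr 1; funext ξ
  rw [projSym_eq]; ring

theorem symKernel_projSym_bound {t : ℝ} (ht : 0 < t) (i j k : Fin n) :
    Integrable (symKernel (projSym i j k) t) ∧
      ∫ x, ‖symKernel (projSym i j k) t x‖ ≤ kernelConst n * t ^ (-(1 / 2) : ℝ) := by
  obtain ⟨h1, h2⟩ := integrable_symKernel_cubicSym_prod ht i j k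
  have hg : Integrable fun x : E n => (if i = j then 1 else 0) * (gradKernel t k x : ℂ) :=
    (show Integrable fun x : E n => (gradKernel t k x : ℂ) from
      (integrable_gradKernel ht k).ofReal).const_mul _
  have he : symKernel (projSym i j k) t = fun x => (if i = j then 1 else 0) * (gradKernel t k x : ℂ)
      + ∫ s in Ioi t, symKernel (cubicSym i j k) s x := funext (symKernel_projSym ht i j k)
  have hr : Integrable fun x => ∫ s in Ioi t, symKernel (cubicSym i j k) s x :=
    h1.integral_prod_right
  rw [he]
  refine ⟨hg.add hr, ?_⟩
  calc _ ≤ ∫ x, (|gradKernel t k x| + ∫ s in Ioi t, ‖symKernel (cubicSym i j k) s x‖) := by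
        refine integral_mono (hg.add hr).norm ((integrable_gradKernel ht k).abs.add
          h1.norm.integral_prod_right) fun x => ?_
        refine (norm_add_le _ _).trans (add_le_add ?_ (norm_integral_le_integral_norm _))
        rw [norm_mul, Complex.norm_real, Real.norm_eq_abs]
        have := abs_nonneg (gradKernel t k x)
        split_ifs <;> simp
    _ = (∫ x, |gradKernel t k x|) + ∫ x, ∫ s in Ioi t, ‖symKernel (cubicSym i j k) s x‖ :=
        integral_add (integrable_gradKernel ht k).abs h1.norm.integral_prod_right
    _ = (∫ x, |gradKernel t k x|) + ∫ s in Ioi t, ∫ x, ‖symKernel (cubicSym i j k) s x‖ := by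
        rw [integral_integral_swap (f := fun x s => ‖symKernel (cubicSym i j k) s x‖)]
        exact h1.norm.swap
    _ ≤ _ := by
        unfold kernelConst
        rw [add_mul]
        exact add_le_add (integral_abs_gradKernel_le ht k) h2

theorem measurable_projKernel (i j k : Fin n) :
    Measurable (Function.uncurry fun t (x : E n) => projKernel t i j k x) := by
  simp_rw [projKernel_eq]
  exact Complex.measurable_re.comp
    (stronglyMeasurable_symKernel (measurable_projSym i j k)).measurable

theorem integrable_projKernel {t : ℝ} (ht : 0 < t) (i j k : Fin n) :
    Integrable fun x : E n => projKernel t i j k x := by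
  simp_rw [projKernel_eq]
  exact (symKernel_projSym_bound ht i j k).1.re

theorem integral_abs_projKernel_le {t : ℝ} (ht : 0 < t) (i j k : Fin n) :
    ∫ x : E n, |projKernel t i j k x| ≤ kernelConst n * t ^ (-(1 / 2) : ℝ) := by
  refine le_trans (integral_mono (integrable_projKernel ht i j k).abs
    (symKernel_projSym_bound ht i j k).1.norm fun x => ?_) (symKernel_projSym_bound ht i j k).2
  simp only [projKernel_eq]
  exact Complex.abs_re_le_norm _

theorem integral_heatKernel_mul_re_symKernel {m : E n → ℂ} {a t : ℝ} (ha : 0 < a)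
    (hm : Integrable fun ξ => heatSym t ξ * m ξ)
    (hi : Integrable (symKernel m t)) (x : E n) :
    ∫ y, heatKernel a (x - y) * (symKernel m t y).re = (symKernel m (t + a) x).re := by
  rw [← integral_heatKernel_mul_symKernel ha hm]
  have hI : Integrable fun y => (heatKernel a (x - y) : ℂ) * symKernel m t y := by
    refine hi.bdd_mul (c := (4 * Real.pi * a) ^ (-(n : ℝ) / 2)) ?_
      (Eventually.of_forall fun y => ?_)
    · have := continuous_heatKernel (n := n) a
      exact (by fun_prop : Continuous _).aestronglyMeasurable
    · rw [Complex.norm_real, Real.norm_of_nonneg (heatKernel_nonneg ha _)]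
      unfold heatKernel
      refine mul_le_of_le_one_right (by positivity) (Real.exp_le_one_iff.2 ?_)
      rw [neg_div]
      exact neg_nonpos.2 (by positivity)
  have := integral_re (𝕜 := ℂ) hI
  simp only [RCLike.re_to_complex, Complex.re_ofReal_mul] at this
  exact this

theorem heatKernel_conv_projKernel {a t : ℝ} (ha : 0 < a) (ht : 0 < t) (i j k : Fin n) (x : E n) :
    ∫ y, heatKernel a (x - y) * projKernel t i j k y = projKernel (t + a) i j k x := by
  simp_rw [projKernel_eq]
  exact integral_heatKernel_mul_re_symKernel ha (integrable_heatSym_mul_projSym ht i j k)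
    (symKernel_projSym_bound ht i j k).1 x

theorem heatKernel_conv_gradKernel {a t : ℝ} (ha : 0 < a) (ht : 0 < t) (k : Fin n) (x : E n) :
    ∫ y, heatKernel a (x - y) * gradKernel t k y = gradKernel (t + a) k x := by
  have h : ∀ {s : ℝ}, 0 < s → ∀ y : E n, gradKernel s k y
      = (symKernel (fun ξ => 2 * Real.pi * Complex.I * (ξ k : ℂ)) s y).re := fun hs y => by
    rw [symKernel_grad hs, Complex.ofReal_re]
  simp_rw [h ht, h (add_pos ht ha)]
  refine integral_heatKernel_mul_re_symKernel ha (integrable_heatSym_mul_grad ht k) ?_ x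
  rw [show symKernel (fun ξ => 2 * Real.pi * Complex.I * (ξ k : ℂ)) t
    = fun x : E n => (gradKernel t k x : ℂ) from funext (symKernel_grad ht k)]
  exact (integrable_gradKernel ht k).ofReal

theorem heatKernel_conv_heatKernel {a t : ℝ} (ha : 0 < a) (ht : 0 < t) (x : E n) :
    ∫ y, heatKernel a (x - y) * heatKernel t y = heatKernel (t + a) x := by
  have h : ∀ {s : ℝ}, 0 < s → ∀ y : E n, heatKernel s y = (symKernel (fun _ => 1) s y).re :=
    fun hs y => by rw [symKernel_one hs, Complex.ofReal_re]
  simp_rw [h ht, h (add_pos ht ha)]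
  refine (integral_heatKernel_mul_re_symKernel ha (m := fun _ => 1) ?_ ?_ x)
  · exact integrable_heatSym_mul ht (k := 0) (by norm_num) measurable_const (c := 1) (by simp)
  · rw [show symKernel (fun _ => 1) t = fun x : E n => (heatKernel t x : ℂ) from
      funext (symKernel_one ht)]
    exact (integrable_heatKernel ht).ofReal

end ProjKernel

/-! ### Convolution of integrable kernels with bounded functions -/

section Conv

variable {n : ℕ} {V W : Type*} [NormedAddCommGroup V] [NormedSpace ℝ V]
  [NormedAddCommGroup W] [NormedSpace ℝ W]

/-- The convolution of a scalar kernel with a vector valued function. -/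
def conv (k : E n → ℝ) (f : E n → V) (x : E n) : V := ∫ y, k (x - y) • f y

theorem heat_of_pos {t : ℝ} (ht : 0 < t) (f : E n → V) : heat t f = conv (heatKernel t) f := by
  ext x; simp [heat, conv, ht.ne']

theorem heat_zero (f : E n → V) : heat 0 f = f := by
  ext x; simp [heat]

theorem integrable_conv {k : E n → ℝ} (hk : Integrable k) {f : E n → V}
    (hf : AEStronglyMeasurable f volume) {M : ℝ} (hM : ∀ᵐ y, ‖f y‖ ≤ M) (x : E n) :
    Integrable fun y => k (x - y) • f y := by
  have := (hk.comp_sub_left x).smul_bdd M hf hM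
  exact this

theorem norm_conv_le {k : E n → ℝ} (hk : Integrable k) {f : E n → V} {M : ℝ}
    (hM : ∀ᵐ y, ‖f y‖ ≤ M) (x : E n) : ‖conv k f x‖ ≤ (∫ y, |k y|) * M := by
  have h1 : ∫ y, |k (x - y)| * M = (∫ y, |k y|) * M := by
    rw [integral_mul_const, integral_sub_left_eq_self (fun y => |k y|)]
  rw [← h1]
  refine norm_integral_le_of_norm_le ((hk.comp_sub_left x).abs.mul_const M) ?_
  filter_upwards [hM] with y hy
  rw [norm_smul, Real.norm_eq_abs]
  gcongr

theorem conv_eq_integral_sub (k : E n → ℝ) (f : E n → V) (x : E n) :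
    conv k f x = ∫ z, k z • f (x - z) := by
  unfold conv
  rw [← integral_sub_left_eq_self (fun z => k z • f (x - z)) volume x]
  simp

theorem conv_add_right (k : E n → ℝ) (f : E n → V) (x h : E n) :
    conv k f (x + h) = conv k (fun y => f (y + h)) x := by
  rw [conv_eq_integral_sub, conv_eq_integral_sub]
  congr 1; ext z; congr 2; abel

theorem conv_congr_ae {k : E n → ℝ} {f g : E n → V} (h : f =ᵐ[volume] g) (x : E n) :
    conv k f x = conv k g x :=
  integral_congr_ae (h.mono fun y hy => by simp only [hy])

theorem conv_sub {k : E n → ℝ} (hk : Integrable k) {f g : E n → V}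
    (hf : AEStronglyMeasurable f volume) (hg : AEStronglyMeasurable g volume) {M M' : ℝ}
    (hM : ∀ᵐ y, ‖f y‖ ≤ M) (hM' : ∀ᵐ y, ‖g y‖ ≤ M') (x : E n) :
    conv k f x - conv k g x = conv k (fun y => f y - g y) x := by
  unfold conv
  rw [← integral_sub (integrable_conv hk hf hM x) (integrable_conv hk hg hM' x)]
  simp_rw [smul_sub]

theorem clm_conv [CompleteSpace V] [CompleteSpace W] (L : V →L[ℝ] W) {k : E n → ℝ}
    (hk : Integrable k) {f : E n → V} (hf : AEStronglyMeasurable f volume) {M : ℝ}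
    (hM : ∀ᵐ y, ‖f y‖ ≤ M) (x : E n) : L (conv k f x) = conv k (fun y => L (f y)) x := by
  unfold conv
  rw [← L.integral_comp_comm (integrable_conv hk hf hM x)]
  simp_rw [map_smul]

theorem stronglyMeasurable_conv (k : E n → ℝ) {f : E n → V} (hk : Measurable k)
    (hf : StronglyMeasurable f) : StronglyMeasurable (conv k f) := by
  refine StronglyMeasurable.integral_prod_right (f := fun x y => k (x - y) • f y) ?_
  exact ((hk.comp (measurable_fst.sub measurable_snd)).stronglyMeasurable).smul
    (hf.comp_measurable measurable_snd)

theorem conv_conv [CompleteSpace V] {g k : E n → ℝ} (hg : Integrable g) (hk : Integrable k) {f : E n → V}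
    (hf : AEStronglyMeasurable f volume) {M : ℝ} (hM : ∀ᵐ y, ‖f y‖ ≤ M) (x : E n) :
    conv g (conv k f) x = conv (fun z => ∫ y, g (z - y) * k y) f x := by
  have hI : Integrable (Function.uncurry fun y z => g (x - y) • k (y - z) • f z)
      (volume.prod volume) := by
    have h1 : Integrable (fun p : E n × E n => g (x - p.1) * k (p.1 - p.2))
        (volume.prod volume) := by
      have := (Integrable.convolution_integrand (ContinuousLinearMap.mul ℝ ℝ)
        (hg.comp_sub_left x) (hk.comp_neg)).swap
      refine this.congr (Eventually.of_forall fun p => ?_)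
      simp [Function.comp]
    have h2 := h1.smul_bdd M (hf.comp_snd (μ := volume)) (by
      exact Measure.quasiMeasurePreserving_snd.ae hM)
    refine h2.congr (Eventually.of_forall fun p => ?_)
    simp only [Function.uncurry, smul_smul, Pi.smul_apply']
  calc conv g (conv k f) x = ∫ y, ∫ z, g (x - y) • k (y - z) • f z := by
        unfold conv; simp_rw [integral_smul]
    _ = ∫ z, ∫ y, g (x - y) • k (y - z) • f z := integral_integral_swap hI
    _ = _ := by
        unfold conv
        congr 1; ext z
        simp_rw [smul_smul]
        rw [integral_smul_const,
          ← integral_add_right_eq_self (fun y => g (x - y) * k (y - z)) z]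
        simp [sub_sub, add_comm]

theorem norm_heat_le {t : ℝ} (ht : 0 ≤ t) {f : E n → V} {M : ℝ} (hM : ∀ y, ‖f y‖ ≤ M) (x : E n) :
    ‖heat t f x‖ ≤ M := by
  rcases ht.eq_or_lt with rfl | ht
  · rw [heat_zero]; exact hM x
  · rw [heat_of_pos ht]
    refine (norm_conv_le (integrable_heatKernel ht) (Eventually.of_forall hM) x).trans (le_of_eq ?_)
    simp_rw [abs_of_nonneg (heatKernel_nonneg ht _)]
    rw [integral_heatKernel ht, one_mul]

theorem heat_heat [CompleteSpace V] {s t : ℝ} (hs : 0 ≤ s) (ht : 0 ≤ t) {f : E n → V}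
    (hf : AEStronglyMeasurable f volume) {M : ℝ} (hM : ∀ᵐ y, ‖f y‖ ≤ M) (x : E n) :
    heat s (heat t f) x = heat (t + s) f x := by
  rcases hs.eq_or_lt with rfl | hs
  · rw [heat_zero, add_zero]
  rcases ht.eq_or_lt with rfl | ht
  · rw [heat_zero, zero_add]
  rw [heat_of_pos hs, heat_of_pos ht, heat_of_pos (add_pos ht hs),
    conv_conv (integrable_heatKernel hs) (integrable_heatKernel ht) hf hM]
  congr 1; ext z
  exact heatKernel_conv_heatKernel hs ht z

end Conv

/-! ### Singular time integrals -/

section TimeIntegrals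

theorem intervalIntegrable_sub_rpow (a t : ℝ) :
    IntervalIntegrable (fun s => (t - s) ^ (-(1 / 2) : ℝ)) volume a t := by
  have h := (intervalIntegral.intervalIntegrable_rpow' (a := 0) (b := t - a)
    (r := -(1 / 2)) (by norm_num)).comp_sub_left t
  simp only [sub_zero, sub_sub_cancel] at h
  exact h.symm

theorem intervalIntegrable_rpow_sub (a t : ℝ) :
    IntervalIntegrable (fun s => (s - a) ^ (-(1 / 2) : ℝ)) volume a t := by
  have h := (intervalIntegral.intervalIntegrable_rpow' (a := 0) (b := t - a)
    (r := -(1 / 2)) (by norm_num)).comp_sub_right a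
  simpa using h

theorem integral_rpow_neg_half (r : ℝ) :
    ∫ s in (0 : ℝ)..r, s ^ (-(1 / 2) : ℝ) = 2 * √r := by
  rw [integral_rpow (Or.inl (by norm_num)), show (-(1 / 2) : ℝ) + 1 = 1 / 2 by norm_num,
    Real.zero_rpow (by norm_num), ← Real.sqrt_eq_rpow]
  ring

theorem integral_sub_rpow (a t : ℝ) :
    ∫ s in a..t, (t - s) ^ (-(1 / 2) : ℝ) = 2 * √(t - a) := by
  rw [intervalIntegral.integral_comp_sub_left (fun s => s ^ (-(1 / 2) : ℝ)), sub_self,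
    integral_rpow_neg_half]

theorem integral_rpow_sub (a t : ℝ) :
    ∫ s in a..t, (s - a) ^ (-(1 / 2) : ℝ) = 2 * √(t - a) := by
  rw [intervalIntegral.integral_comp_sub_right (fun s => s ^ (-(1 / 2) : ℝ)), sub_self,
    integral_rpow_neg_half]

/-- At every s one of the two distances is at least half of t - a, so the corresponding factor is at
most √(2/(t - a)). This splits the Beta integrand into two one-sided singularities. -/
theorem rpow_mul_rpow_le {a s t : ℝ} (has : a < s) (hst : s < t) :
    (t - s) ^ (-(1 / 2) : ℝ) * (s - a) ^ (-(1 / 2) : ℝ)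
      ≤ √(2 / (t - a)) * ((t - s) ^ (-(1 / 2) : ℝ) + (s - a) ^ (-(1 / 2) : ℝ)) := by
  have h1 : 0 < t - s := sub_pos.2 hst
  have h2 : 0 < s - a := sub_pos.2 has
  have h3 : 0 < t - a := by linarith
  have key : ∀ r : ℝ, (t - a) / 2 ≤ r → r ^ (-(1 / 2) : ℝ) ≤ √(2 / (t - a)) := by
    intro r hr
    have hr0 : 0 < (t - a) / 2 := by positivity
    calc r ^ (-(1 / 2) : ℝ) ≤ ((t - a) / 2) ^ (-(1 / 2) : ℝ) :=
          Real.rpow_le_rpow_of_nonpos hr0 hr (by norm_num)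
      _ = √(2 / (t - a)) := by
          rw [Real.rpow_neg hr0.le, ← Real.sqrt_eq_rpow, ← Real.sqrt_inv, inv_div]
  have p1 : 0 < (t - s) ^ (-(1 / 2) : ℝ) := by positivity
  have p2 : 0 < (s - a) ^ (-(1 / 2) : ℝ) := by positivity
  have p3 : 0 ≤ √(2 / (t - a)) := Real.sqrt_nonneg _
  rcases le_total (t - s) (s - a) with h | h
  · have := key (s - a) (by linarith)
    nlinarith
  · have := key (t - s) (by linarith)
    nlinarith

theorem intervalIntegrable_beta {a t : ℝ} (hat : a < t) :
    IntervalIntegrable (fun s => (t - s) ^ (-(1 / 2) : ℝ) * (s - a) ^ (-(1 / 2) : ℝ))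
      volume a t := by
  have hg := ((intervalIntegrable_sub_rpow a t).add (intervalIntegrable_rpow_sub a t)).const_mul
    √(2 / (t - a))
  rw [intervalIntegrable_iff_integrableOn_Ioo_of_le hat.le] at hg ⊢
  refine Integrable.mono' hg ?_ ?_
  · exact (((measurable_const.sub measurable_id).pow_const _).mul
      ((measurable_id.sub measurable_const).pow_const _)).aestronglyMeasurable
  · refine (ae_restrict_iff' measurableSet_Ioo).2 (Eventually.of_forall fun s hs => ?_)
    have h1 : 0 < t - s := sub_pos.2 hs.2
    have h2 : 0 < s - a := sub_pos.2 hs.1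
    rw [Real.norm_of_nonneg (by positivity)]
    exact rpow_mul_rpow_le hs.1 hs.2

theorem integral_beta_le {a t : ℝ} (hat : a < t) :
    ∫ s in a..t, (t - s) ^ (-(1 / 2) : ℝ) * (s - a) ^ (-(1 / 2) : ℝ) ≤ 6 := by
  have hg := ((intervalIntegrable_sub_rpow a t).add (intervalIntegrable_rpow_sub a t)).const_mul
    √(2 / (t - a))
  have h0 : 0 < t - a := sub_pos.2 hat
  refine (intervalIntegral.integral_mono_on_of_le_Ioo hat.le (intervalIntegrable_beta hat) hg
    fun s hs => rpow_mul_rpow_le hs.1 hs.2).trans ?_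
  rw [intervalIntegral.integral_const_mul, intervalIntegral.integral_add
    (intervalIntegrable_sub_rpow a t) (intervalIntegrable_rpow_sub a t), integral_sub_rpow,
    integral_rpow_sub]
  -- The two one-sided integrals contribute 4√(t - a), so the total is 4√2 ≤ 6, independently of the
  -- length of the interval.
  have h1 : √(2 / (t - a)) * √(t - a) = √2 := by
    rw [← Real.sqrt_mul (by positivity)]; congr 1; field_simp
  have h2 : √2 ≤ 1.5 := by rw [Real.sqrt_le_left (by norm_num)]; norm_num
  nlinarith

end TimeIntegrals

/-! ### Bounded jointly measurable functions -/

section BddMeas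

variable {n : ℕ} {V : Type*} [NormedAddCommGroup V]

/-- A jointly measurable function of time and space, bounded by `M`. -/
structure BddMeas (M : ℝ) (f : ℝ → E n → V) : Prop where
  measurable : StronglyMeasurable (Function.uncurry f)
  bound : ∀ t x, ‖f t x‖ ≤ M

theorem BddMeas.slice {M : ℝ} {f : ℝ → E n → V} (hf : BddMeas M f) (t : ℝ) :
    StronglyMeasurable (f t) := hf.measurable.comp_measurable measurable_prodMk_left

end BddMeas

/-! ### The Duhamel operator of a family of kernels -/

section Duhamel

variable {n : ℕ} {ι : Type} [Fintype ι] {V W : Type*} [NormedAddCommGroup V] [NormedSpace ℝ V]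
  [NormedAddCommGroup W] [NormedSpace ℝ W]

/-- A finite family of convolution kernels of order at most one on the time interval `(0, T]`,
compatible with the heat semigroup. -/
structure KernelFamily (K : ι → ℝ → E n → ℝ) (b T : ℝ) : Prop where
  nonneg : 0 ≤ b
  measurable : ∀ α, Measurable (Function.uncurry (K α))
  integrable : ∀ α t, 0 < t → Integrable (K α t)
  bound : ∀ α t, 0 < t → t ≤ T → ∫ x, |K α t x| ≤ b * t ^ (-(1 / 2) : ℝ)
  conv_heat : ∀ α a t x, 0 < a → 0 < t → ∫ y, heatKernel a (x - y) * K α t y = K α (t + a) x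

/-- The sum over the kernels of `∫ₐᵗ K(t - s) * F(s) ds`. -/
def duhamel (K : ι → ℝ → E n → ℝ) (F : ι → ℝ → E n → V) (a t : ℝ) (x : E n) : V :=
  ∫ s in a..t, ∑ α, conv (K α (t - s)) (F α s) x

theorem stronglyMeasurable_conv_param {K : ℝ → E n → ℝ} (hK : Measurable (Function.uncurry K))
    {f : ℝ → E n → V} (hf : StronglyMeasurable (Function.uncurry f)) :
    StronglyMeasurable fun q : (ℝ × E n) × ℝ => conv (K (q.1.1 - q.2)) (f q.2) q.1.2 := by
  refine StronglyMeasurable.integral_prod_right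
    (f := fun (q : (ℝ × E n) × ℝ) (y : E n) => K (q.1.1 - q.2) (q.1.2 - y) • f q.2 y) ?_
  refine StronglyMeasurable.smul ?_ ?_
  · have hg : Measurable fun p : ((ℝ × E n) × ℝ) × E n => (p.1.1.1 - p.1.2, p.1.1.2 - p.2) := by
      fun_prop
    exact (hK.comp hg).stronglyMeasurable
  · exact hf.comp_measurable (g := fun p : ((ℝ × E n) × ℝ) × E n => (p.1.2, p.2)) (by fun_prop)

theorem stronglyMeasurable_sum_conv {K : ι → ℝ → E n → ℝ}
    (hK : ∀ α, Measurable (Function.uncurry (K α)))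
    {F : ι → ℝ → E n → V} (hF : ∀ α, StronglyMeasurable (Function.uncurry (F α))) :
    StronglyMeasurable fun q : (ℝ × E n) × ℝ =>
      ∑ α, conv (K α (q.1.1 - q.2)) (F α q.2) q.1.2 :=
  Finset.stronglyMeasurable_fun_sum _ fun α _ => stronglyMeasurable_conv_param (hK α) (hF α)

/-- Joint measurability in (t, x) with a moving endpoint: the endpoint is put into an indicator,
which agrees with the oriented integral only for a ≤ t. -/
theorem exists_stronglyMeasurable_duhamel {K : ι → ℝ → E n → ℝ}
    (hK : ∀ α, Measurable (Function.uncurry (K α)))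
    {F : ι → ℝ → E n → V} (hF : ∀ α, StronglyMeasurable (Function.uncurry (F α))) (a : ℝ) :
    ∃ g : ℝ × E n → V, StronglyMeasurable g ∧
      ∀ t x, a ≤ t → g (t, x) = duhamel K F a t x := by
  refine ⟨fun p => ∫ s, (Ioc a p.1).indicator
    (fun s => ∑ α, conv (K α (p.1 - s)) (F α s) p.2) s, ?_, ?_⟩
  · refine StronglyMeasurable.integral_prod_right (f := fun (p : ℝ × E n) (s : ℝ) =>
      (Ioc a p.1).indicator (fun s => ∑ α, conv (K α (p.1 - s)) (F α s) p.2) s) ?_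
    have hs : MeasurableSet {q : (ℝ × E n) × ℝ | a < q.2 ∧ q.2 ≤ q.1.1} :=
      (measurableSet_lt measurable_const measurable_snd).inter
        (measurableSet_le measurable_snd (measurable_fst.comp measurable_fst))
    have := (stronglyMeasurable_sum_conv hK hF).indicator hs
    exact this
  · intro t x hat
    simp only
    rw [integral_indicator measurableSet_Ioc, duhamel, intervalIntegral.integral_of_le hat]

variable {K : ι → ℝ → E n → ℝ} {b T : ℝ}

omit [Fintype ι] in
theorem KernelFamily.norm_conv_le (hK : KernelFamily K b T) (α : ι) {s t M : ℝ} (hst : s < t)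
    (hT : t - s ≤ T) {f : E n → V} (hM : ∀ᵐ y, ‖f y‖ ≤ M) (x : E n) :
    ‖conv (K α (t - s)) f x‖ ≤ b * (t - s) ^ (-(1 / 2) : ℝ) * M := by
  have h0 : 0 ≤ M := by
    obtain ⟨y, hy⟩ := hM.exists
    exact (norm_nonneg _).trans hy
  refine (LiquidCrystal.norm_conv_le (hK.integrable α _ (sub_pos.2 hst)) hM x).trans ?_
  gcongr
  exact hK.bound α _ (sub_pos.2 hst) hT

theorem KernelFamily.norm_sum_conv_le (hK : KernelFamily K b T) {s t M : ℝ} (hst : s < t)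
    (hT : t - s ≤ T) {f : ι → E n → V} (hM : ∀ α, ∀ᵐ y, ‖f α y‖ ≤ M) (x : E n) :
    ‖∑ α, conv (K α (t - s)) (f α) x‖ ≤ Fintype.card ι * b * ((t - s) ^ (-(1 / 2) : ℝ) * M) := by
  refine (norm_sum_le_of_le _ fun α _ => hK.norm_conv_le α hst hT (hM α) x).trans (le_of_eq ?_)
  simp only [Finset.sum_const, Finset.card_univ, nsmul_eq_mul]
  ring

theorem KernelFamily.intervalIntegrable (hK : KernelFamily K b T) {F : ι → ℝ → E n → V}
    {M : ℝ} (hF : ∀ α, BddMeas M (F α)) {a t : ℝ} (hat : a ≤ t) (hT : t - a ≤ T) (x : E n) :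
    IntervalIntegrable (fun s => ∑ α, conv (K α (t - s)) (F α s) x) volume a t := by
  have hg := ((intervalIntegrable_sub_rpow a t).mul_const M).const_mul (Fintype.card ι * b)
  rw [intervalIntegrable_iff_integrableOn_Ioo_of_le hat] at hg ⊢
  refine Integrable.mono' hg ?_ ?_
  · have := (stronglyMeasurable_sum_conv hK.measurable fun α => (hF α).measurable).comp_measurable
      (g := fun s : ℝ => ((t, x), s)) (by fun_prop)
    exact this.aestronglyMeasurable
  · refine (ae_restrict_iff' measurableSet_Ioo).2 (Eventually.of_forall fun s hs => ?_)
    exact hK.norm_sum_conv_le hs.2 (by linarith [hs.1])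
      (fun α => Eventually.of_forall ((hF α).bound s)) x

theorem KernelFamily.norm_duhamel_le_of_le (hK : KernelFamily K b T) {F : ι → ℝ → E n → V}
    {g : ℝ → ℝ} {a t : ℝ} (hat : a ≤ t) (hT : t - a ≤ T)
    (hg : IntervalIntegrable (fun s => (t - s) ^ (-(1 / 2) : ℝ) * g s) volume a t)
    (hF : ∀ α, ∀ s ∈ Ioo a t, ∀ᵐ y, ‖F α s y‖ ≤ g s) (x : E n) :
    ‖duhamel K F a t x‖ ≤ Fintype.card ι * b * ∫ s in a..t, (t - s) ^ (-(1 / 2) : ℝ) * g s := by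
  rw [← intervalIntegral.integral_const_mul]
  refine intervalIntegral.norm_integral_le_of_norm_le hat ?_ (hg.const_mul _)
  have h : ∀ᵐ s : ℝ, s ≠ t := by simp [ae_iff, measure_singleton]
  filter_upwards [h] with s hs hs'
  exact hK.norm_sum_conv_le (lt_of_le_of_ne hs'.2 hs) (by linarith [hs'.1])
    (fun α => hF α s ⟨hs'.1, lt_of_le_of_ne hs'.2 hs⟩) x

theorem KernelFamily.norm_duhamel_le (hK : KernelFamily K b T) {F : ι → ℝ → E n → V}
    {M : ℝ} {a t : ℝ} (hat : a ≤ t) (hT : t - a ≤ T)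
    (hF : ∀ α, ∀ s ∈ Ioo a t, ∀ᵐ y, ‖F α s y‖ ≤ M) (x : E n) :
    ‖duhamel K F a t x‖ ≤ Fintype.card ι * b * (2 * √(t - a) * M) := by
  have h := hK.norm_duhamel_le_of_le (g := fun _ => M) hat hT
    ((intervalIntegrable_sub_rpow a t).mul_const M) hF x
  rwa [intervalIntegral.integral_mul_const, integral_sub_rpow] at h

theorem duhamel_congr {F G : ι → ℝ → E n → V} {a t : ℝ} (hat : a ≤ t)
    (h : ∀ α, ∀ᵐ s, s ∈ Ioo a t → F α s =ᵐ[volume] G α s) (x : E n) :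
    duhamel K F a t x = duhamel K G a t x := by
  refine intervalIntegral.integral_congr_ae ?_
  have h' : ∀ᵐ s : ℝ, s ≠ t := by simp [ae_iff, measure_singleton]
  filter_upwards [h', ae_all_iff.2 h] with s hs hs2 hs'
  rw [uIoc_of_le hat] at hs'
  exact Finset.sum_congr rfl fun α _ =>
    conv_congr_ae (hs2 α ⟨hs'.1, lt_of_le_of_ne hs'.2 hs⟩) x

theorem KernelFamily.duhamel_sub (hK : KernelFamily K b T) {F G : ι → ℝ → E n → V}
    {M M' : ℝ} (hF : ∀ α, BddMeas M (F α)) (hG : ∀ α, BddMeas M' (G α)) {a t : ℝ} (hat : a ≤ t)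
    (hT : t - a ≤ T) (x : E n) :
    duhamel K F a t x - duhamel K G a t x
      = duhamel K (fun α s y => F α s y - G α s y) a t x := by
  unfold duhamel
  rw [← intervalIntegral.integral_sub (hK.intervalIntegrable hF hat hT x)
    (hK.intervalIntegrable hG hat hT x)]
  refine intervalIntegral.integral_congr_ae ?_
  have h' : ∀ᵐ s : ℝ, s ≠ t := by simp [ae_iff, measure_singleton]
  filter_upwards [h'] with s hs hs'
  rw [uIoc_of_le hat] at hs'
  rw [← Finset.sum_sub_distrib]
  exact Finset.sum_congr rfl fun α _ => conv_sub
    (hK.integrable α _ (sub_pos.2 (lt_of_le_of_ne hs'.2 hs)))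
    ((hF α).slice s).aestronglyMeasurable ((hG α).slice s).aestronglyMeasurable
    (Eventually.of_forall ((hF α).bound s)) (Eventually.of_forall ((hG α).bound s)) x

theorem duhamel_add_right (F : ι → ℝ → E n → V) (a t : ℝ) (x h : E n) :
    duhamel K F a t (x + h) = duhamel K (fun α s y => F α s (y + h)) a t x := by
  unfold duhamel
  simp_rw [conv_add_right]

theorem KernelFamily.clm_duhamel [CompleteSpace V] [CompleteSpace W] (hK : KernelFamily K b T)
    (L : V →L[ℝ] W) {F : ι → ℝ → E n → V} {M : ℝ} (hF : ∀ α, BddMeas M (F α)) {a t : ℝ}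
    (hat : a ≤ t) (hT : t - a ≤ T) (x : E n) :
    L (duhamel K F a t x) = duhamel K (fun α s y => L (F α s y)) a t x := by
  unfold duhamel
  rw [← L.intervalIntegral_comp_comm (hK.intervalIntegrable hF hat hT x)]
  refine intervalIntegral.integral_congr_ae ?_
  have h' : ∀ᵐ s : ℝ, s ≠ t := by simp [ae_iff, measure_singleton]
  filter_upwards [h'] with s hs hs'
  rw [uIoc_of_le hat] at hs'
  rw [map_sum]
  exact Finset.sum_congr rfl fun α _ => clm_conv L
    (hK.integrable α _ (sub_pos.2 (lt_of_le_of_ne hs'.2 hs)))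
    ((hF α).slice s).aestronglyMeasurable (Eventually.of_forall ((hF α).bound s)) x

theorem KernelFamily.conv_duhamel (hK : KernelFamily K b T) {g : E n → ℝ} (hg : Integrable g)
    {F : ι → ℝ → E n → V} {M : ℝ} (hF : ∀ α, BddMeas M (F α)) {a t : ℝ}
    (hat : a ≤ t) (hT : t - a ≤ T) (x : E n) :
    conv g (duhamel K F a t) x
      = ∫ s in a..t, ∑ α, conv g (conv (K α (t - s)) (F α s)) x := by
  unfold duhamel
  have hmeas : StronglyMeasurable fun p : E n × ℝ => ∑ α, conv (K α (t - p.2)) (F α p.2) p.1 :=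
    (stronglyMeasurable_sum_conv hK.measurable fun α => (hF α).measurable).comp_measurable
      (g := fun p : E n × ℝ => ((t, p.1), p.2)) (by fun_prop)
  have hI : Integrable (Function.uncurry fun y s => g (x - y) • ∑ α, conv (K α (t - s)) (F α s) y)
      (volume.prod (volume.restrict (Ioc a t))) := by
    have hg1 := ((intervalIntegrable_sub_rpow a t).mul_const M).const_mul (Fintype.card ι * b)
    rw [intervalIntegrable_iff_integrableOn_Ioc_of_le hat] at hg1
    refine Integrable.mono' ((hg.comp_sub_left x).norm.mul_prod hg1) ?_ ?_
    · have h1 : AEStronglyMeasurable (fun p : E n × ℝ => g (x - p.1))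
          (volume.prod (volume.restrict (Ioc a t))) :=
        (hg.comp_sub_left x).aestronglyMeasurable.comp_fst
      exact h1.smul hmeas.aestronglyMeasurable
    · have h' : ∀ᵐ s ∂volume.restrict (Ioc a t), s ∈ Ioo a t := by
        refine (ae_restrict_iff' measurableSet_Ioc).2 ?_
        have h' : ∀ᵐ s : ℝ, s ≠ t := by simp [ae_iff, measure_singleton]
        filter_upwards [h'] with s hs hs'
        exact ⟨hs'.1, lt_of_le_of_ne hs'.2 hs⟩
      have h'' : ∀ᵐ p : E n × ℝ ∂(volume.prod (volume.restrict (Ioc a t))), p.2 ∈ Ioo a t :=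
        Measure.quasiMeasurePreserving_snd.ae h'
      filter_upwards [h''] with p hp
      rw [Function.uncurry, norm_smul]
      gcongr
      exact hK.norm_sum_conv_le hp.2 (by linarith [hp.1])
        (fun α => Eventually.of_forall ((hF α).bound p.2)) p.1
  calc conv g (fun y => ∫ s in a..t, ∑ α, conv (K α (t - s)) (F α s) y) x
      = ∫ y, ∫ s in Ioc a t, g (x - y) • ∑ α, conv (K α (t - s)) (F α s) y := by
        unfold conv
        simp_rw [intervalIntegral.integral_of_le hat, integral_smul]
    _ = ∫ s in Ioc a t, ∫ y, g (x - y) • ∑ α, conv (K α (t - s)) (F α s) y :=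
        integral_integral_swap hI
    _ = ∫ s in a..t, ∫ y, g (x - y) • ∑ α, conv (K α (t - s)) (F α s) y := by
        rw [intervalIntegral.integral_of_le hat]
    _ = _ := by
        refine intervalIntegral.integral_congr_ae ?_
        have h' : ∀ᵐ s : ℝ, s ≠ t := by simp [ae_iff, measure_singleton]
        filter_upwards [h'] with s hs hs'
        rw [uIoc_of_le hat] at hs'
        have hst : s < t := lt_of_le_of_ne hs'.2 hs
        simp_rw [Finset.smul_sum]
        rw [integral_finsetSum]
        · rfl
        · intro α _
          refine integrable_conv hg (stronglyMeasurable_conv _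
            ((hK.measurable α).comp measurable_prodMk_left)
            ((hF α).slice s)).aestronglyMeasurable (Eventually.of_forall fun y =>
            hK.norm_conv_le α hst (by linarith [hs'.1])
              (Eventually.of_forall ((hF α).bound s)) y) x

/-- By Fubini and the field `conv_heat`, the heat flow over time t - c turns K(c - s) into K(t - s).
The part of the Duhamel integral before c, propagated to t, is thus the contribution of [a, c]. -/
theorem KernelFamily.heat_duhamel [CompleteSpace V] (hK : KernelFamily K b T) {F : ι → ℝ → E n → V} {M : ℝ}
    (hF : ∀ α, BddMeas M (F α)) {a c t : ℝ} (hac : a ≤ c) (hct : c < t) (hT : t - a ≤ T) (x : E n) :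
    heat (t - c) (duhamel K F a c) x + duhamel K F c t x = duhamel K F a t x := by
  have hI := hK.intervalIntegrable hF (hac.trans hct.le) hT x
  have hadd := intervalIntegral.integral_add_adjacent_intervals
    (hI.mono_set (by rw [uIcc_of_le hac, uIcc_of_le (hac.trans hct.le)]
                     exact Icc_subset_Icc_right hct.le))
    (hI.mono_set (by rw [uIcc_of_le hct.le, uIcc_of_le (hac.trans hct.le)]
                     exact Icc_subset_Icc_left hac))
  rw [duhamel.eq_def K F a t, ← hadd, ← duhamel.eq_def K F c t, heat_of_pos (sub_pos.2 hct),
    hK.conv_duhamel (integrable_heatKernel (sub_pos.2 hct)) hF hac (by linarith) x]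
  congr 1
  refine intervalIntegral.integral_congr_ae ?_
  have h' : ∀ᵐ s : ℝ, s ≠ c := by simp [ae_iff, measure_singleton]
  filter_upwards [h'] with s hs hs'
  rw [uIoc_of_le hac] at hs'
  have hsc : s < c := lt_of_le_of_ne hs'.2 hs
  refine Finset.sum_congr rfl fun α _ => ?_
  rw [conv_conv (integrable_heatKernel (sub_pos.2 hct)) (hK.integrable α _ (sub_pos.2 hsc))
    ((hF α).slice s).aestronglyMeasurable (Eventually.of_forall ((hF α).bound s))]
  congr 1; ext z
  rw [hK.conv_heat α _ _ z (sub_pos.2 hct) (sub_pos.2 hsc)]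
  congr 1; ring

end Duhamel

/-! ### Semilinear systems driven by a kernel family -/

section System

variable {n : ℕ} {ι : Type} [Fintype ι] {V : Type} [NormedAddCommGroup V] [NormedSpace ℝ V]

/-- `w` is a bounded mild solution on `[a, T]` of the semilinear system with kernels `K` and
nonlinearities `N`, the integral equation being satisfied at every point. -/
structure IsSol (K : ι → ℝ → E n → ℝ) (N : ι → V → V) (a T : ℝ) (w : ℝ → E n → V) : Prop where
  bddMeas : ∃ M, BddMeas M w
  eq : ∀ t ∈ Ioc a T, ∀ x,
    w t x = heat (t - a) (w a) x + duhamel K (fun α s y => N α (w s y)) a t x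

theorem heat_add {t : ℝ} (ht : 0 ≤ t) {f g : E n → V} (hf : AEStronglyMeasurable f volume)
    (hg : AEStronglyMeasurable g volume) {M M' : ℝ} (hM : ∀ᵐ y, ‖f y‖ ≤ M)
    (hM' : ∀ᵐ y, ‖g y‖ ≤ M') (x : E n) :
    heat t (fun y => f y + g y) x = heat t f x + heat t g x := by
  rcases ht.eq_or_lt with rfl | ht
  · simp only [heat_zero]
  simp only [heat_of_pos ht]
  unfold conv
  rw [← integral_add (integrable_conv (integrable_heatKernel ht) hf hM x)
    (integrable_conv (integrable_heatKernel ht) hg hM' x)]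
  simp_rw [smul_add]

theorem heat_sub {t : ℝ} (ht : 0 ≤ t) {f g : E n → V} (hf : AEStronglyMeasurable f volume)
    (hg : AEStronglyMeasurable g volume) {M M' : ℝ} (hM : ∀ᵐ y, ‖f y‖ ≤ M)
    (hM' : ∀ᵐ y, ‖g y‖ ≤ M') (x : E n) :
    heat t (fun y => f y - g y) x = heat t f x - heat t g x := by
  rcases ht.eq_or_lt with rfl | ht
  · simp only [heat_zero]
  simp only [heat_of_pos ht]
  exact (conv_sub (integrable_heatKernel ht) hf hg hM hM' x).symm

theorem stronglyMeasurable_heat {t : ℝ} (ht : 0 ≤ t) {f : E n → V} (hf : StronglyMeasurable f) :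
    StronglyMeasurable (heat t f) := by
  rcases ht.eq_or_lt with rfl | ht
  · rwa [heat_zero]
  · rw [heat_of_pos ht]
    exact stronglyMeasurable_conv _ (continuous_heatKernel t).measurable hf

theorem BddMeas.comp [FiniteDimensional ℝ V] {M : ℝ} {w : ℝ → E n → V} (hw : BddMeas M w)
    {W : Type} [NormedAddCommGroup W] {N : ι → V → W} (hN : ∀ α, Continuous (N α)) :
    ∃ B, ∀ α, BddMeas B fun s y => N α (w s y) := by
  have h : ∀ α, ∃ B, ∀ v : V, ‖v‖ ≤ M → ‖N α v‖ ≤ B := by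
    intro α
    obtain ⟨B, hB⟩ := (isCompact_closedBall (0 : V) M).exists_bound_of_continuousOn
      (hN α).continuousOn
    exact ⟨B, fun v hv => hB v (by simpa using hv)⟩
  choose B hB using h
  refine ⟨∑ α, |B α|, fun α => ⟨(hN α).comp_stronglyMeasurable hw.measurable, fun t x => ?_⟩⟩
  exact (hB α _ (hw.bound t x)).trans ((le_abs_self _).trans
    (Finset.single_le_sum (f := fun α => |B α|) (fun _ _ => abs_nonneg _) (Finset.mem_univ α)))

theorem exists_lipschitz_of_contDiff [FiniteDimensional ℝ V] {W : Type} [NormedAddCommGroup W]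
    [NormedSpace ℝ W] {N : ι → V → W} (hN : ∀ α, ContDiff ℝ (⊤ : ℕ∞) (N α)) (M : ℝ) :
    ∃ L, 0 ≤ L ∧ ∀ α x y, ‖x‖ ≤ M → ‖y‖ ≤ M → ‖N α x - N α y‖ ≤ L * ‖x - y‖ := by
  have h : ∀ α, ∃ L, ∀ v : V, ‖v‖ ≤ M → ‖fderiv ℝ (N α) v‖ ≤ L := by
    intro α
    obtain ⟨B, hB⟩ := (isCompact_closedBall (0 : V) M).exists_bound_of_continuousOn
      ((hN α).continuous_fderiv (by simp)).continuousOn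
    exact ⟨B, fun v hv => hB v (by simpa using hv)⟩
  choose L hL using h
  refine ⟨∑ α, |L α|, Finset.sum_nonneg fun _ _ => abs_nonneg _, fun α x y hx hy => ?_⟩
  refine (Convex.norm_image_sub_le_of_norm_fderiv_le (𝕜 := ℝ) (f := N α) (C := L α)
    (s := Metric.closedBall 0 M) (fun v _ => ((hN α).differentiable (by simp)).differentiableAt)
    (fun v hv => hL α v (by simpa using hv)) (convex_closedBall _ _) (by simpa using hy)
    (by simpa using hx)).trans ?_
  gcongr
  exact (le_abs_self _).trans
    (Finset.single_le_sum (f := fun α => |L α|) (fun _ _ => abs_nonneg _) (Finset.mem_univ α))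

theorem exists_stronglyMeasurable_heat {f : E n → V} (hf : StronglyMeasurable f) :
    ∃ g : ℝ × E n → V, StronglyMeasurable g ∧ ∀ t x, 0 < t → g (t, x) = heat t f x := by
  refine ⟨fun p => conv (heatKernel (p.1 - 0)) f p.2, ?_, fun t x ht => ?_⟩
  · exact (stronglyMeasurable_conv_param (f := fun _ => f) measurable_heatKernel
      (hf.comp_measurable measurable_snd)).comp_measurable
      (g := fun p : ℝ × E n => ((p.1, p.2), (0 : ℝ))) (by fun_prop)
  · rw [heat_of_pos ht]; simp

variable [FiniteDimensional ℝ V] {K : ι → ℝ → E n → ℝ} {b T₀ : ℝ} {N : ι → V → V} {a T : ℝ}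
  {w w' : ℝ → E n → V}

/-- The semigroup property of the integral equation. It allows every estimate to be made on a short
window starting at any later time, with constants that depend only on a bound for w. -/
theorem IsSol.restart (hK : KernelFamily K b T₀) (hN : ∀ α, Continuous (N α))
    (hw : IsSol K N a T w) (hT : T - a ≤ T₀) {c : ℝ} (hac : a ≤ c) : IsSol K N c T w := by
  have := FiniteDimensional.complete ℝ V
  refine ⟨hw.bddMeas, fun t ht x => ?_⟩
  rcases hac.eq_or_lt with rfl | hac'
  · exact hw.eq t ht x
  obtain ⟨M, hM⟩ := hw.bddMeas
  obtain ⟨B, hB⟩ := hM.comp hN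
  have hcT : c ≤ T := ht.1.le.trans ht.2
  have hwc : w c = fun y => heat (c - a) (w a) y + duhamel K (fun α s y => N α (w s y)) a c y :=
    funext fun y => hw.eq c ⟨hac', hcT⟩ y
  obtain ⟨g, hg, hg'⟩ := exists_stronglyMeasurable_duhamel hK.measurable
    (fun α => (hB α).measurable) a
  have hd : StronglyMeasurable (duhamel K (fun α s y => N α (w s y)) a c) := by
    have : duhamel K (fun α s y => N α (w s y)) a c = fun x => g (c, x) :=
      funext fun x => (hg' c x hac).symm
    rw [this]
    exact hg.comp_measurable measurable_prodMk_left
  have hdb := hK.norm_duhamel_le (F := fun α s y => N α (w s y)) hac (by linarith)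
    (fun α s _ => Eventually.of_forall ((hB α).bound s))
  rw [hw.eq t ⟨hac'.trans ht.1, ht.2⟩ x, ← hK.heat_duhamel hB hac ht.1 (by linarith [ht.2]) x, hwc,
    heat_add (sub_nonneg.2 ht.1.le)
      (stronglyMeasurable_heat (sub_nonneg.2 hac) (hM.slice a)).aestronglyMeasurable
      hd.aestronglyMeasurable
      (Eventually.of_forall fun y => norm_heat_le (sub_nonneg.2 hac) (hM.bound a) y)
      (Eventually.of_forall hdb),
    heat_heat (sub_nonneg.2 ht.1.le) (sub_nonneg.2 hac) (hM.slice a).aestronglyMeasurable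
      (Eventually.of_forall (hM.bound a)), ← add_assoc]
  congr 3
  ring

/-- Inserting a bound for the difference into the equation halves it. Starting from the trivial
bound 2M, the difference is at most 2M·2^{-k} for every k. -/
theorem IsSol.eq_of_short (hK : KernelFamily K b T₀) (hN : ∀ α, Continuous (N α)) {M L : ℝ}
    (hL : 0 ≤ L) (hLip : ∀ α x y, ‖x‖ ≤ M → ‖y‖ ≤ M → ‖N α x - N α y‖ ≤ L * ‖x - y‖)
    (hw : IsSol K N a T w) (hw' : IsSol K N a T w') (hM : BddMeas M w) (hM' : BddMeas M w')
    (h0 : w a = w' a) (hT : T - a ≤ T₀)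
    (hsmall : Fintype.card ι * b * (2 * √(T - a) * L) ≤ 1 / 2) :
    ∀ t ∈ Icc a T, w t = w' t := by
  intro t ht
  obtain ⟨B, hB⟩ := hM.comp hN
  obtain ⟨B', hB'⟩ := hM'.comp hN
  have hM0 : 0 ≤ M := (norm_nonneg _).trans (hM.bound 0 0)
  have hb := hK.nonneg
  have key : ∀ k : ℕ, ∀ s ∈ Icc a T, ∀ x, ‖w s x - w' s x‖ ≤ 2 * M * (1 / 2) ^ k := by
    intro k
    induction k with
    | zero =>
      intro s _ x
      rw [pow_zero, mul_one, two_mul]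
      exact (norm_sub_le _ _).trans (add_le_add (hM.bound s x) (hM'.bound s x))
    | succ k ih =>
      intro s hs x
      rcases hs.1.eq_or_lt with rfl | has
      · rw [h0]; simpa using by positivity
      have hsT : s - a ≤ T₀ := by linarith [hs.2]
      rw [hw.eq s ⟨has, hs.2⟩, hw'.eq s ⟨has, hs.2⟩, h0, add_sub_add_left_eq_sub,
        hK.duhamel_sub hB hB' has.le hsT]
      refine (hK.norm_duhamel_le (M := L * (2 * M * (1 / 2) ^ k)) has.le hsT
        (fun α r hr => Eventually.of_forall fun y => ?_) x).trans ?_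
      · refine (hLip α _ _ (hM.bound r y) (hM'.bound r y)).trans ?_
        gcongr
        exact ih r ⟨hr.1.le, hr.2.le.trans hs.2⟩ y
      · have hsq : √(s - a) ≤ √(T - a) := Real.sqrt_le_sqrt (by linarith [hs.2])
        calc Fintype.card ι * b * (2 * √(s - a) * (L * (2 * M * (1 / 2) ^ k)))
            = (Fintype.card ι * b * (2 * √(s - a) * L)) * (2 * M * (1 / 2) ^ k) := by ring
          _ ≤ (Fintype.card ι * b * (2 * √(T - a) * L)) * (2 * M * (1 / 2) ^ k) := by gcongr
          _ ≤ 1 / 2 * (2 * M * (1 / 2) ^ k) := by gcongr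
          _ = _ := by ring
  funext x
  have hlim : Tendsto (fun k : ℕ => 2 * M * (1 / 2 : ℝ) ^ k) atTop (𝓝 (2 * M * 0)) :=
    (tendsto_pow_atTop_nhds_zero_of_lt_one (by norm_num) (by norm_num)).const_mul _
  rw [mul_zero] at hlim
  have := ge_of_tendsto' hlim fun k => key k t ht x
  exact sub_eq_zero.1 (norm_le_zero_iff.1 this)

theorem exists_pos_sqrt_mul_le (c : ℝ) {ε : ℝ} (hε : 0 < ε) :
    ∃ τ, 0 < τ ∧ ∀ r ≤ τ, c * √r ≤ ε := by
  refine ⟨(ε / (|c| + 1)) ^ 2, by positivity, fun r hr => ?_⟩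
  have h1 : √r ≤ ε / (|c| + 1) := by
    rw [← Real.sqrt_sq (show 0 ≤ ε / (|c| + 1) by positivity)]
    exact Real.sqrt_le_sqrt hr
  calc c * √r ≤ |c| * √r := by gcongr; exact le_abs_self c
    _ ≤ (|c| + 1) * (ε / (|c| + 1)) := by gcongr; linarith
    _ = ε := by field_simp

/-- The admissible window length τ depends only on a common bound of the two solutions, so finitely
many restarts cover [a, T] and no smallness of T is needed. -/
theorem IsSol.unique (hK : KernelFamily K b T₀) (hN : ∀ α, ContDiff ℝ (⊤ : ℕ∞) (N α))
    (hw : IsSol K N a T w) (hw' : IsSol K N a T w') (h0 : w a = w' a) (hT : T - a ≤ T₀) :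
    ∀ t ∈ Icc a T, w t = w' t := by
  have hNc : ∀ α, Continuous (N α) := fun α => (hN α).continuous
  obtain ⟨M₁, hM₁⟩ := hw.bddMeas
  obtain ⟨M₂, hM₂⟩ := hw'.bddMeas
  have hM : BddMeas (max M₁ M₂) w := ⟨hM₁.measurable, fun t x => le_max_of_le_left (hM₁.bound t x)⟩
  have hM' : BddMeas (max M₁ M₂) w' :=
    ⟨hM₂.measurable, fun t x => le_max_of_le_right (hM₂.bound t x)⟩
  obtain ⟨L, hL, hLip⟩ := exists_lipschitz_of_contDiff hN (max M₁ M₂)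
  obtain ⟨τ, hτ, hτ'⟩ := exists_pos_sqrt_mul_le (Fintype.card ι * b * (2 * L))
    (show (0 : ℝ) < 1 / 2 by norm_num)
  have key : ∀ k : ℕ, ∀ t ∈ Icc a T, t ≤ a + k * τ → w t = w' t := by
    intro k
    induction k with
    | zero =>
      intro t ht h
      have : t = a := le_antisymm (by simpa using h) ht.1
      rw [this, h0]
    | succ k ih =>
      intro t ht h
      rcases le_total t (a + k * τ) with h1 | h1
      · exact ih t ht h1
      set c := a + k * τ with hc
      have hac : a ≤ c := by rw [hc]; have : 0 ≤ k * τ := by positivity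
                             linarith
      have hct : t ≤ c + τ := by rw [hc]; push_cast at h; linarith
      have mono : ∀ {v : ℝ → E n → V}, IsSol K N c T v → IsSol K N c t v := fun hv =>
        ⟨hv.bddMeas, fun s hs x => hv.eq s ⟨hs.1, hs.2.trans ht.2⟩ x⟩
      refine IsSol.eq_of_short hK hNc hL hLip (mono (hw.restart hK hNc hT hac))
        (mono (hw'.restart hK hNc hT hac)) hM hM' (ih c ⟨hac, h1.trans ht.2⟩ le_rfl)
        (by linarith [ht.2]) ?_ t ⟨h1, le_rfl⟩
      have := hτ' (t - c) (by linarith)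
      linarith
  intro t ht
  obtain ⟨k, hk⟩ := exists_nat_ge ((t - a) / τ)
  refine key k t ht ?_
  rw [div_le_iff₀ hτ] at hk
  linarith

/-- The Picard map of the system on `[0, T]` with initial value `w₀`. -/
def picard (K : ι → ℝ → E n → ℝ) (N : ι → V → V) (T : ℝ) (w₀ : E n → V) (w : ℝ → E n → V)
    (t : ℝ) (x : E n) : V :=
  if t ≤ 0 then w₀ x else if t ≤ T then
    heat t w₀ x + duhamel K (fun α s y => N α (w s y)) 0 t x else 0

omit [FiniteDimensional ℝ V] in
theorem stronglyMeasurable_picard (hK : KernelFamily K b T₀) (hN : ∀ α, Continuous (N α))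
    {w₀ : E n → V} (hw₀ : StronglyMeasurable w₀)
    (hw : StronglyMeasurable (Function.uncurry w)) :
    StronglyMeasurable (Function.uncurry (picard K N T w₀ w)) := by
  obtain ⟨g, hg, hg'⟩ := exists_stronglyMeasurable_duhamel hK.measurable
    (F := fun α s y => N α (w s y)) (fun α => (hN α).comp_stronglyMeasurable hw) 0
  obtain ⟨f, hf, hf'⟩ := exists_stronglyMeasurable_heat hw₀
  have : Function.uncurry (picard K N T w₀ w) = fun p =>
      if p.1 ≤ 0 then w₀ p.2 else if p.1 ≤ T then f p + g p else 0 := by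
    ext p
    obtain ⟨t, x⟩ := p
    simp only [Function.uncurry, picard]
    split_ifs with h1 h2
    · rfl
    · rw [hf' t x (not_le.1 h1), hg' t x (not_le.1 h1).le]
    · rfl
  rw [this]
  refine StronglyMeasurable.ite (measurableSet_le measurable_fst measurable_const)
    (hw₀.comp_measurable measurable_snd) (StronglyMeasurable.ite
      (measurableSet_le measurable_fst measurable_const) (hf.add hg) stronglyMeasurable_const)

omit [FiniteDimensional ℝ V] in
-- The heat flow keeps the datum below one. Since the nonlinearities vanish at 0, the Lipschitz
-- bound makes the Duhamel term at most half of the radius two, that is, one.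
theorem picard_bddMeas (hK : KernelFamily K b T) (hN : ∀ α, Continuous (N α)) {L : ℝ} (hL : 0 ≤ L)
    (hLip : ∀ α x y, ‖x‖ ≤ 2 → ‖y‖ ≤ 2 → ‖N α x - N α y‖ ≤ L * ‖x - y‖)
    (hN0 : ∀ α, N α 0 = 0) (hsmall : Fintype.card ι * b * (2 * √T * L) ≤ 1 / 2)
    {w₀ : E n → V} (hw₀ : StronglyMeasurable w₀) (hw₀b : ∀ x, ‖w₀ x‖ ≤ 1) (hw : BddMeas 2 w) :
    BddMeas 2 (picard K N T w₀ w) := by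
  have hb := hK.nonneg
  constructor
  · exact stronglyMeasurable_picard hK hN hw₀ hw.measurable
  · intro t x
    unfold picard
    split_ifs with h1 h2
    · exact (hw₀b x).trans (by norm_num)
    · have h1' := (not_le.1 h1).le
      have hd := hK.norm_duhamel_le (F := fun α s y => N α (w s y)) (M := L * 2) h1'
        (by simpa using h2) (fun α s _ => Eventually.of_forall fun y => by
          have := hLip α (w s y) 0 (hw.bound s y) (by simp)
          rw [hN0, sub_zero, sub_zero] at this
          exact this.trans (by gcongr; exact hw.bound s y)) x
      rw [sub_zero] at hd
      have hsq : √t ≤ √T := Real.sqrt_le_sqrt h2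
      have : Fintype.card ι * b * (2 * √t * (L * 2)) ≤ 1 := by
        calc Fintype.card ι * b * (2 * √t * (L * 2))
            = (Fintype.card ι * b * (2 * √t * L)) * 2 := by ring
          _ ≤ (Fintype.card ι * b * (2 * √T * L)) * 2 := by gcongr
          _ ≤ 1 / 2 * 2 := by gcongr
          _ = 1 := by norm_num
      have h3 := norm_add_le (heat t w₀ x) (duhamel K (fun α s y => N α (w s y)) 0 t x)
      have h4 := norm_heat_le h1' hw₀b x
      linarith
    · simp

/-- Here the size of w is arbitrary. This version serves uniqueness, where a competing solution need
not lie in the ball of radius two. -/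
theorem exists_bddMeas_picard (hK : KernelFamily K b T) (hN : ∀ α, Continuous (N α))
    {w₀ : E n → V} (hw₀ : StronglyMeasurable w₀) {M₀ : ℝ} (hw₀b : ∀ x, ‖w₀ x‖ ≤ M₀) {M : ℝ}
    (hw : BddMeas M w) : ∃ B, BddMeas B (picard K N T w₀ w) := by
  obtain ⟨B, hB⟩ := hw.comp hN
  have hb := hK.nonneg
  have hM₀ : 0 ≤ M₀ := (norm_nonneg _).trans (hw₀b 0)
  refine ⟨M₀ + Fintype.card ι * b * (2 * √T * |B|),
    stronglyMeasurable_picard hK hN hw₀ hw.measurable, fun t x => ?_⟩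
  have h0 : 0 ≤ Fintype.card ι * b * (2 * √T * |B|) := by positivity
  unfold picard
  split_ifs with h1 h2
  · linarith [hw₀b x]
  · have h1' := (not_le.1 h1).le
    have hd := hK.norm_duhamel_le (F := fun α s y => N α (w s y)) (M := |B|) h1'
      (by simpa using h2) (fun α s _ => Eventually.of_forall fun y =>
        ((hB α).bound s y).trans (le_abs_self B)) x
    rw [sub_zero] at hd
    have h3 : Fintype.card ι * b * (2 * √t * |B|) ≤ Fintype.card ι * b * (2 * √T * |B|) := by
      gcongr
    exact (norm_add_le _ _).trans (add_le_add (norm_heat_le h1' hw₀b x) (hd.trans h3))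
  · rw [norm_zero]; linarith

theorem picard_contracting (hK : KernelFamily K b T) (hN : ∀ α, Continuous (N α)) {L : ℝ}
    (hL : 0 ≤ L) (hLip : ∀ α x y, ‖x‖ ≤ 2 → ‖y‖ ≤ 2 → ‖N α x - N α y‖ ≤ L * ‖x - y‖)
    (hsmall : Fintype.card ι * b * (2 * √T * L) ≤ 1 / 2)
    {w₀ : E n → V} (hw : BddMeas 2 w) (hw' : BddMeas 2 w') {ε : ℝ}
    (hε : ∀ t x, ‖w t x - w' t x‖ ≤ ε) (t : ℝ) (x : E n) :
    ‖picard K N T w₀ w t x - picard K N T w₀ w' t x‖ ≤ ε / 2 := by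
  obtain ⟨B, hB⟩ := hw.comp hN
  obtain ⟨B', hB'⟩ := hw'.comp hN
  have hb := hK.nonneg
  have hε0 : 0 ≤ ε := (norm_nonneg _).trans (hε 0 0)
  unfold picard
  split_ifs with h1 h2
  · rw [sub_self, norm_zero]; positivity
  · have h1' := (not_le.1 h1).le
    rw [add_sub_add_left_eq_sub, hK.duhamel_sub hB hB' h1' (by simpa using h2)]
    refine (hK.norm_duhamel_le (M := L * ε) h1' (by simpa using h2)
      (fun α s _ => Eventually.of_forall fun y => ?_) x).trans ?_
    · exact (hLip α _ _ (hw.bound s y) (hw'.bound s y)).trans (by gcongr; exact hε s y)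
    · rw [sub_zero]
      have hsq : √t ≤ √T := Real.sqrt_le_sqrt h2
      calc Fintype.card ι * b * (2 * √t * (L * ε))
          = (Fintype.card ι * b * (2 * √t * L)) * ε := by ring
        _ ≤ (Fintype.card ι * b * (2 * √T * L)) * ε := by gcongr
        _ ≤ 1 / 2 * ε := by gcongr
        _ = ε / 2 := by ring
  · rw [sub_self, norm_zero]; positivity

/-- The Banach fixed point argument is carried out with functions instead of classes modulo null
sets, so the limit satisfies the equation at every point and is jointly measurable. -/
theorem exists_isSol (hK : KernelFamily K b T) (hN : ∀ α, Continuous (N α)) {L : ℝ} (hL : 0 ≤ L)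
    (hLip : ∀ α x y, ‖x‖ ≤ 2 → ‖y‖ ≤ 2 → ‖N α x - N α y‖ ≤ L * ‖x - y‖)
    (hN0 : ∀ α, N α 0 = 0) (hsmall : Fintype.card ι * b * (2 * √T * L) ≤ 1 / 2)
    {w₀ : E n → V} (hw₀ : StronglyMeasurable w₀) (hw₀b : ∀ x, ‖w₀ x‖ ≤ 1) :
    ∃ w, IsSol K N 0 T w ∧ w 0 = w₀ ∧ BddMeas 2 w := by
  have := FiniteDimensional.complete ℝ V
  let W : ℕ → ℝ → E n → V := fun k => (picard K N T w₀)^[k] fun _ _ => 0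
  have hWs : ∀ k, W (k + 1) = picard K N T w₀ (W k) := fun k =>
    Function.iterate_succ_apply' _ _ _
  have hWb : ∀ k, BddMeas 2 (W k) := by
    intro k
    induction k with
    | zero => exact ⟨stronglyMeasurable_const, fun t x => by simp [W]⟩
    | succ k ih => rw [hWs]; exact picard_bddMeas hK hN hL hLip hN0 hsmall hw₀ hw₀b ih
  -- The constant 4 is the diameter of the ball of radius two that contains all iterates.
  have hWd : ∀ k t x, dist (W k t x) (W (k + 1) t x) ≤ 4 * (1 / 2 : ℝ) ^ k := by
    intro k
    induction k with
    | zero =>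
      intro t x
      rw [dist_eq_norm]
      have h1 := (hWb 0).bound t x
      have h2 := (hWb (0 + 1)).bound t x
      have := norm_sub_le (W 0 t x) (W (0 + 1) t x)
      linarith
    | succ k ih =>
      intro t x
      rw [dist_eq_norm, hWs (k + 1)]
      nth_rewrite 1 [hWs k]
      have := picard_contracting (w₀ := w₀) hK hN hL hLip hsmall (hWb k) (hWb (k + 1))
        (fun t x => by rw [← dist_eq_norm]; exact ih t x) t x
      refine this.trans (le_of_eq ?_)
      ring
  have hcauchy : ∀ t x, ∃ v, Tendsto (fun k => W k t x) atTop (𝓝 v) := fun t x =>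
    cauchySeq_tendsto_of_complete
      (cauchySeq_of_le_geometric (1 / 2) 4 (by norm_num) fun k => hWd k t x)
  choose w hw using hcauchy
  have hdist : ∀ k t x, ‖W k t x - w t x‖ ≤ 8 * (1 / 2 : ℝ) ^ k := by
    intro k t x
    rw [← dist_eq_norm]
    refine (dist_le_of_le_geometric_of_tendsto (1 / 2) 4 (by norm_num) (fun k => hWd k t x)
      (hw t x) k).trans (le_of_eq ?_)
    ring
  have hwb : BddMeas 2 w := by
    refine ⟨stronglyMeasurable_of_tendsto atTop (f := fun k => Function.uncurry (W k))
      (fun k => (hWb k).measurable) ?_, fun t x =>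
      le_of_tendsto (hw t x).norm (Eventually.of_forall fun k => (hWb k).bound t x)⟩
    rw [tendsto_pi_nhds]
    rintro ⟨t, x⟩
    exact hw t x
  have hfix : picard K N T w₀ w = w := by
    ext t x
    have hlim : Tendsto (fun k : ℕ => 8 * (1 / 2 : ℝ) ^ k / 2) atTop (𝓝 (8 * 0 / 2)) :=
      ((tendsto_pow_atTop_nhds_zero_of_lt_one (by norm_num) (by norm_num)).const_mul _).div_const _
    rw [mul_zero, zero_div] at hlim
    have h1 : Tendsto (fun k => W (k + 1) t x) atTop (𝓝 (picard K N T w₀ w t x)) := by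
      rw [tendsto_iff_norm_sub_tendsto_zero]
      refine squeeze_zero (fun _ => norm_nonneg _) (fun k => ?_) hlim
      rw [hWs]
      exact picard_contracting hK hN hL hLip hsmall (hWb k) hwb (hdist k) t x
    exact tendsto_nhds_unique h1 ((tendsto_add_atTop_iff_nat 1).2 (hw t x))
  have h0 : w 0 = w₀ := by
    rw [← hfix]; funext x; simp [picard]
  refine ⟨w, ⟨⟨2, hwb⟩, fun t ht x => ?_⟩, h0, hwb⟩
  rw [h0, sub_zero]
  conv_lhs => rw [← hfix]
  simp [picard, not_le.2 ht.1, ht.2]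

end System

/-! ### Smoothing estimates for the heat semigroup -/

section HeatEstimates

variable {n : ℕ} {V : Type*} [NormedAddCommGroup V] [NormedSpace ℝ V]

theorem integral_norm_fderiv_heatKernel_le {t : ℝ} (ht : 0 < t) :
    Integrable (fun x : E n => ‖fderiv ℝ (heatKernel (n := n) t) x‖) ∧
    ∫ x : E n, ‖fderiv ℝ (heatKernel (n := n) t) x‖ ≤ 4 * gaussConst n * t ^ (-(1 / 2) : ℝ) := by
  have h0 := (integrable_norm_pow_mul_heatKernel (n := n) ht (k := 1) (by norm_num)).const_mul
    (1 / (2 * t))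
  have hi : Integrable (fun x : E n => ‖fderiv ℝ (heatKernel (n := n) t) x‖) :=
    Integrable.mono' h0 (continuous_fderiv_heatKernel t).norm.aestronglyMeasurable
      (Eventually.of_forall fun x => by rw [norm_norm]; exact norm_fderiv_heatKernel_le ht x)
  refine ⟨hi, ?_⟩
  have h1 := integral_mono hi h0 (fun x => norm_fderiv_heatKernel_le ht x)
  rw [integral_const_mul] at h1
  have h2 := integral_norm_pow_mul_heatKernel_le (n := n) ht (k := 1) (by norm_num)
  have h3 : 1 / (2 * t) * ∫ x : E n, ‖x‖ ^ 1 * heatKernel t x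
      ≤ 1 / (2 * t) * (2 * gaussConst n * √(8 * t) ^ 1) := by gcongr
  refine h1.trans (h3.trans ?_)
  rw [← sqrt_div_self_eq ht, Real.sqrt_mul (by norm_num), pow_one]
  have h8 : √8 ≤ 4 := by rw [Real.sqrt_le_left (by norm_num)]; norm_num
  have hg := one_le_gaussConst n
  calc 1 / (2 * t) * (2 * gaussConst n * (√8 * √t)) = √8 * gaussConst n * (√t / t) := by
        field_simp
    _ ≤ _ := by gcongr

/-- The increment is the integral of the derivative along the segment from x to x + h; Fubini and
translation invariance reduce it to the L¹ norm of the gradient. -/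
theorem integral_abs_heatKernel_translate_sub_le {t : ℝ} (ht : 0 < t) (h : E n) :
    ∫ x : E n, |heatKernel t (x + h) - heatKernel t x|
      ≤ 4 * gaussConst n * t ^ (-(1 / 2) : ℝ) * ‖h‖ := by
  obtain ⟨hi, hb⟩ := integral_norm_fderiv_heatKernel_le (n := n) ht
  have hcont := continuous_fderiv_heatKernel (n := n) t
  have hpt : ∀ x : E n, |heatKernel t (x + h) - heatKernel t x|
      ≤ ∫ θ in Ioc (0 : ℝ) 1, ‖fderiv ℝ (heatKernel (n := n) t) (x + θ • h)‖ * ‖h‖ := by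
    intro x
    have hd : ∀ θ ∈ uIcc (0 : ℝ) 1, HasDerivAt (fun θ : ℝ => heatKernel t (x + θ • h))
        (fderiv ℝ (heatKernel (n := n) t) (x + θ • h) h) θ := by
      intro θ _
      have h1 : HasDerivAt (fun θ : ℝ => x + θ • h) h θ := by
        simpa using ((hasDerivAt_id θ).smul_const h).const_add x
      exact (hasFDerivAt_heatKernel (t := t) (x + θ • h)).differentiableAt.hasFDerivAt.comp_hasDerivAt
        θ h1
    have hc : Continuous fun θ : ℝ => fderiv ℝ (heatKernel (n := n) t) (x + θ • h) h := by fun_prop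
    have hftc := intervalIntegral.integral_eq_sub_of_hasDerivAt hd (hc.intervalIntegrable 0 1)
    simp only [one_smul, zero_smul, add_zero] at hftc
    rw [← hftc, intervalIntegral.integral_of_le zero_le_one, ← Real.norm_eq_abs]
    refine norm_integral_le_of_norm_le ?_ (Eventually.of_forall fun θ =>
      ContinuousLinearMap.le_opNorm _ _)
    have hc' : Continuous fun θ : ℝ => ‖fderiv ℝ (heatKernel (n := n) t) (x + θ • h)‖ * ‖h‖ := by
      fun_prop
    exact (hc'.integrableOn_Icc (a := 0) (b := 1)).mono_set Ioc_subset_Icc_self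
  have hI : Integrable (Function.uncurry fun (x : E n) (θ : ℝ) =>
      ‖fderiv ℝ (heatKernel (n := n) t) (x + θ • h)‖ * ‖h‖)
      (volume.prod (volume.restrict (Ioc (0 : ℝ) 1))) := by
    have hm : AEStronglyMeasurable (Function.uncurry fun (x : E n) (θ : ℝ) =>
      ‖fderiv ℝ (heatKernel (n := n) t) (x + θ • h)‖ * ‖h‖)
      (volume.prod (volume.restrict (Ioc (0 : ℝ) 1))) :=
      (by fun_prop : Continuous fun p : E n × ℝ =>
        ‖fderiv ℝ (heatKernel (n := n) t) (p.1 + p.2 • h)‖ * ‖h‖).aestronglyMeasurable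
    rw [integrable_prod_iff' hm]
    refine ⟨Eventually.of_forall fun θ => (hi.comp_add_right (θ • h)).mul_const _, ?_⟩
    have : (fun θ : ℝ => ∫ x : E n, ‖‖fderiv ℝ (heatKernel (n := n) t) (x + θ • h)‖ * ‖h‖‖)
        = fun _ => ∫ x : E n, ‖‖fderiv ℝ (heatKernel (n := n) t) x‖ * ‖h‖‖ := by
      ext θ
      exact integral_add_right_eq_self
        (fun x => ‖‖fderiv ℝ (heatKernel (n := n) t) x‖ * ‖h‖‖) (θ • h)
    simp only [Function.uncurry]
    rw [this]
    exact integrable_const _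
  have hGi : Integrable fun x : E n => |heatKernel t (x + h) - heatKernel t x| :=
    (((integrable_heatKernel ht).comp_add_right h).sub (integrable_heatKernel ht)).abs
  calc _ ≤ ∫ x : E n, ∫ θ in Ioc (0 : ℝ) 1,
          ‖fderiv ℝ (heatKernel (n := n) t) (x + θ • h)‖ * ‖h‖ :=
        integral_mono hGi hI.integral_prod_left hpt
    _ = ∫ θ in Ioc (0 : ℝ) 1, ∫ x : E n,
          ‖fderiv ℝ (heatKernel (n := n) t) (x + θ • h)‖ * ‖h‖ := integral_integral_swap hI
    _ = ∫ θ in Ioc (0 : ℝ) 1, (∫ x : E n, ‖fderiv ℝ (heatKernel (n := n) t) x‖) * ‖h‖ := by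
        congr 1; ext θ
        rw [integral_mul_const, integral_add_right_eq_self
          (fun x => ‖fderiv ℝ (heatKernel (n := n) t) x‖) (θ • h)]
    _ = (∫ x : E n, ‖fderiv ℝ (heatKernel (n := n) t) x‖) * ‖h‖ := by simp
    _ ≤ _ := by gcongr

theorem norm_heat_translate_sub_le {t : ℝ} (ht : 0 < t) {f : E n → V}
    (hf : AEStronglyMeasurable f volume) {M : ℝ} (hM : ∀ᵐ y, ‖f y‖ ≤ M) (x h : E n) :
    ‖heat t f (x + h) - heat t f x‖
      ≤ 4 * gaussConst n * t ^ (-(1 / 2) : ℝ) * ‖h‖ * M := by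
  have h0 : 0 ≤ M := by
    obtain ⟨y, hy⟩ := hM.exists
    exact (norm_nonneg _).trans hy
  have hG := integrable_heatKernel (n := n) ht
  have he : heat t f (x + h) - heat t f x
      = conv (fun z => heatKernel t (z + h) - heatKernel t z) f x := by
    rw [heat_of_pos ht]
    unfold conv
    rw [← integral_sub (integrable_conv hG hf hM _) (integrable_conv hG hf hM _)]
    congr 1; ext y
    rw [← sub_smul]
    congr 3; abel
  rw [he]
  refine (norm_conv_le ((hG.comp_add_right h).sub hG) hM x).trans ?_
  gcongr
  exact integral_abs_heatKernel_translate_sub_le ht h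

/-- The heat kernel is a probability density, so the difference is the average of f(x - z) - v. The
coefficients c₀, c₁, c₂ stand for a uniform, a Lipschitz and a second order deviation, and are paid
for by the moments of order 0, 1 and 2. -/
theorem norm_heat_sub_const_le [CompleteSpace V] {h : ℝ} (hh : 0 < h) {f : E n → V}
    (hf : AEStronglyMeasurable f volume) {M : ℝ} (hM : ∀ᵐ y, ‖f y‖ ≤ M) (x : E n) (v : V)
    {c₀ c₁ c₂ : ℝ} (h₁ : 0 ≤ c₁) (h₂ : 0 ≤ c₂)
    (hle : ∀ᵐ z, ‖f (x - z) - v‖ ≤ c₀ + c₁ * ‖z‖ + c₂ * ‖z‖ ^ 2) :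
    ‖heat h f x - v‖ ≤ c₀ + c₁ * (6 * gaussConst n * √h) + c₂ * (16 * gaussConst n * h) := by
  have hG := integrable_heatKernel (n := n) hh
  have hI : Integrable fun z => heatKernel h z • f (x - z) := by
    have := (integrable_conv hG hf hM x).comp_sub_left x
    simpa using this
  have he : heat h f x - v = ∫ z, heatKernel h z • (f (x - z) - v) := by
    have h1 : ∫ z : E n, heatKernel h z • v = v := by
      rw [integral_smul_const, integral_heatKernel hh, one_smul]
    rw [heat_of_pos hh, conv_eq_integral_sub]
    conv_lhs => rw [← h1]
    rw [← integral_sub hI (hG.smul_const v)]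
    simp_rw [smul_sub]
  have i1 := integrable_norm_pow_mul_heatKernel (n := n) hh (k := 1) (by norm_num)
  have i2 := integrable_norm_pow_mul_heatKernel (n := n) hh (k := 2) (by norm_num)
  have i01 : Integrable fun z : E n => c₀ * heatKernel h z + c₁ * (‖z‖ ^ 1 * heatKernel h z) :=
    (hG.const_mul c₀).add (i1.const_mul c₁)
  have hbI : Integrable fun z : E n => c₀ * heatKernel h z + c₁ * (‖z‖ ^ 1 * heatKernel h z)
      + c₂ * (‖z‖ ^ 2 * heatKernel h z) := i01.add (i2.const_mul c₂)
  rw [he]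
  refine (norm_integral_le_of_norm_le hbI ?_).trans ?_
  · filter_upwards [hle] with z hz
    rw [norm_smul, Real.norm_of_nonneg (heatKernel_nonneg hh z)]
    have := mul_le_mul_of_nonneg_left hz (heatKernel_nonneg hh z)
    refine this.trans (le_of_eq ?_)
    ring
  · have e1 : ∫ z : E n, (c₀ * heatKernel h z + c₁ * (‖z‖ ^ 1 * heatKernel h z))
        + c₂ * (‖z‖ ^ 2 * heatKernel h z)
        = c₀ + c₁ * (∫ z : E n, ‖z‖ ^ 1 * heatKernel h z)
          + c₂ * ∫ z : E n, ‖z‖ ^ 2 * heatKernel h z := by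
      rw [integral_add i01 (i2.const_mul c₂),
        integral_add (hG.const_mul c₀) (i1.const_mul c₁), integral_const_mul, integral_const_mul,
        integral_const_mul, integral_heatKernel hh, mul_one]
    rw [e1]
    have b1 := integral_norm_pow_mul_heatKernel_le (n := n) hh (k := 1) (by norm_num)
    have b2 := integral_norm_pow_mul_heatKernel_le (n := n) hh (k := 2) (by norm_num)
    have hg := one_le_gaussConst n
    have hs8 : √(8 * h) ≤ 3 * √h := by
      rw [show 3 * √h = √(9 * h) by
        rw [Real.sqrt_mul (by norm_num), show (9 : ℝ) = 3 ^ 2 by norm_num,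
          Real.sqrt_sq (by norm_num)]]
      exact Real.sqrt_le_sqrt (by linarith)
    have b1' : ∫ z : E n, ‖z‖ ^ 1 * heatKernel h z ≤ 6 * gaussConst n * √h := by
      refine b1.trans ?_
      rw [pow_one]
      nlinarith
    have b2' : ∫ z : E n, ‖z‖ ^ 2 * heatKernel h z ≤ 16 * gaussConst n * h := by
      refine b2.trans (le_of_eq ?_)
      rw [Real.sq_sqrt (by positivity)]; ring
    gcongr

theorem norm_heat_sub_self_le [CompleteSpace V] {h : ℝ} (hh : 0 ≤ h) {f : E n → V}
    (hf : AEStronglyMeasurable f volume) {M : ℝ} (hM : ∀ᵐ y, ‖f y‖ ≤ M) {Λ : ℝ} (hΛ : 0 ≤ Λ)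
    {x : E n} (hlip : ∀ᵐ y, ‖f y - f x‖ ≤ Λ * ‖y - x‖) :
    ‖heat h f x - f x‖ ≤ Λ * (6 * gaussConst n * √h) := by
  rcases hh.eq_or_lt with rfl | hh
  · simp [heat_zero]
  have h1 : ∀ᵐ z, ‖f (x - z) - f x‖ ≤ 0 + Λ * ‖z‖ + 0 * ‖z‖ ^ 2 := by
    have := (quasiMeasurePreserving_sub_left_of_right_invariant volume x).ae hlip
    filter_upwards [this] with z hz
    simpa using hz
  have := norm_heat_sub_const_le hh hf hM x (f x) hΛ le_rfl h1
  simpa using this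

end HeatEstimates

/-! ### Regularity of solutions: Lipschitz in space, Hölder in time -/

section Regularity

variable {n : ℕ} {ι : Type} [Fintype ι] {V : Type} [NormedAddCommGroup V] [NormedSpace ℝ V]
  [FiniteDimensional ℝ V] {K : ι → ℝ → E n → ℝ} {b T₀ : ℝ} {N : ι → V → V} {a T : ℝ}
  {w : ℝ → E n → V}

theorem sqrt_mul_rpow_neg_half {r : ℝ} (hr : 0 < r) : √r * r ^ (-(1 / 2) : ℝ) = 1 := by
  rw [Real.rpow_neg hr.le, ← Real.sqrt_eq_rpow, mul_inv_cancel₀ (Real.sqrt_pos.2 hr).ne']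

/-- The spatial increments are measured with the weight (s - c)^{-1/2}, where c = t - σ. The heat
part produces exactly this weight, and the Duhamel part reproduces it with factor 1/2 on a short
window, since the Beta integral stays bounded. The window moves with t but its length σ does not,
which makes the constant uniform. -/
theorem IsSol.lipschitz (hK : KernelFamily K b T₀) (hN : ∀ α, ContDiff ℝ (⊤ : ℕ∞) (N α))
    (hw : IsSol K N a T w) (hT : T - a ≤ T₀) {δ : ℝ} (haδ : a < δ) :
    ∃ Λ, 0 ≤ Λ ∧ ∀ t ∈ Icc δ T, ∀ x y, ‖w t x - w t y‖ ≤ Λ * ‖x - y‖ := by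
  have hNc : ∀ α, Continuous (N α) := fun α => (hN α).continuous
  obtain ⟨M, hM⟩ := hw.bddMeas
  obtain ⟨L, hL, hLip⟩ := exists_lipschitz_of_contDiff hN M
  obtain ⟨B, hB⟩ := hM.comp hNc
  have hb := hK.nonneg
  have hM0 : 0 ≤ M := (norm_nonneg _).trans (hM.bound 0 0)
  -- The 6 is the bound of the Beta integral in `integral_beta_le`.
  obtain ⟨τ, hτ, hτ'⟩ := exists_pos_sqrt_mul_le (Fintype.card ι * b * (6 * L))
    (show (0 : ℝ) < 1 / 2 by norm_num)
  set σ := min (δ - a) τ with hσd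
  have hσ : 0 < σ := lt_min (sub_pos.2 haδ) hτ
  have hg := one_le_gaussConst n
  set A := 4 * gaussConst n * M with hA
  have hA0 : 0 ≤ A := by positivity
  refine ⟨2 * A * σ ^ (-(1 / 2) : ℝ), by positivity, fun t ht x y => ?_⟩
  set c := t - σ with hc
  have hac : a ≤ c := by
    have : σ ≤ δ - a := min_le_left _ _
    linarith [ht.1]
  have hwc := hw.restart hK hNc hT hac
  set h := x - y with hh
  have hσ0 := hσ.le
  -- The recursion for the weighted increment is B ↦ A‖h‖ + B/2, whose fixed point is 2A‖h‖; the
  -- excess over it halves at each step.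
  have key : ∀ k : ℕ, ∀ s ∈ Ioc c t, ∀ z, ‖w s (z + h) - w s z‖
      ≤ (2 * A * ‖h‖ + 2 * M * √σ * (1 / 2) ^ k) * (s - c) ^ (-(1 / 2) : ℝ) := by
    intro k
    induction k with
    | zero =>
      intro s hs z
      have hsc : 0 < s - c := sub_pos.2 hs.1
      have h1 : ‖w s (z + h) - w s z‖ ≤ 2 * M := by
        have := norm_sub_le (w s (z + h)) (w s z)
        linarith [hM.bound s (z + h), hM.bound s z]
      -- On the window s - c ≤ σ, so the constant bound 2M is dominated by a multiple of the
      -- singular weight.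
      have h2 : 1 ≤ √σ * (s - c) ^ (-(1 / 2) : ℝ) := by
        calc 1 = √(s - c) * (s - c) ^ (-(1 / 2) : ℝ) := (sqrt_mul_rpow_neg_half hsc).symm
          _ ≤ _ := by gcongr; linarith [hs.2]
      have h3 : 0 ≤ 2 * A * ‖h‖ * (s - c) ^ (-(1 / 2) : ℝ) := by positivity
      nlinarith
    | succ k ih =>
      intro s hs z
      have hsc : 0 < s - c := sub_pos.2 hs.1
      set Bk := 2 * A * ‖h‖ + 2 * M * √σ * (1 / 2) ^ k with hBk
      have hBk0 : 0 ≤ Bk := by positivity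
      have hsT : s ≤ T := hs.2.trans ht.2
      have hsT' : s - c ≤ T₀ := by linarith
      have hB' : ∀ α, BddMeas B fun s y => N α (w s (y + h)) := fun α =>
        ⟨(hB α).measurable.comp_measurable (g := fun p : ℝ × E n => (p.1, p.2 + h)) (by fun_prop),
          fun t x => (hB α).bound t (x + h)⟩
      rw [hwc.eq s ⟨hs.1, hsT⟩, hwc.eq s ⟨hs.1, hsT⟩, add_sub_add_comm, duhamel_add_right,
        hK.duhamel_sub hB' hB hs.1.le hsT']
      have e1 := norm_heat_translate_sub_le hsc (hM.slice c).aestronglyMeasurable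
        (Eventually.of_forall (hM.bound c)) z h
      have e2 := hK.norm_duhamel_le_of_le
        (F := fun α r y => N α (w r (y + h)) - N α (w r y))
        (g := fun r => L * (Bk * (r - c) ^ (-(1 / 2) : ℝ))) hs.1.le hsT'
        (((intervalIntegrable_beta hs.1).const_mul (L * Bk)).congr
          fun r _ => by ring)
        (fun α r hr => Eventually.of_forall fun y => (hLip α _ _ (hM.bound _ _)
          (hM.bound _ _)).trans (by gcongr; exact ih r ⟨hr.1, hr.2.le.trans hs.2⟩ y)) z
      have e3 : ∫ r in c..s, (s - r) ^ (-(1 / 2) : ℝ) * (L * (Bk * (r - c) ^ (-(1 / 2) : ℝ)))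
          ≤ L * Bk * 6 := by
        have : ∀ r, (s - r) ^ (-(1 / 2) : ℝ) * (L * (Bk * (r - c) ^ (-(1 / 2) : ℝ)))
            = L * Bk * ((s - r) ^ (-(1 / 2) : ℝ) * (r - c) ^ (-(1 / 2) : ℝ)) := fun r => by ring
        simp_rw [this]
        rw [intervalIntegral.integral_const_mul]
        gcongr
        exact integral_beta_le hs.1
      have e4 : Fintype.card ι * b * (L * Bk * 6) ≤ Bk / 2 * (s - c) ^ (-(1 / 2) : ℝ) := by
        have h1 := hτ' (s - c) (by
          have : σ ≤ τ := min_le_right _ _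
          linarith [hs.2])
        calc Fintype.card ι * b * (L * Bk * 6)
            = (Fintype.card ι * b * (6 * L) * √(s - c)) * Bk * (s - c) ^ (-(1 / 2) : ℝ) := by
              rw [show (Fintype.card ι * b * (6 * L) * √(s - c)) * Bk * (s - c) ^ (-(1 / 2) : ℝ)
                = Fintype.card ι * b * (L * Bk * 6) * (√(s - c) * (s - c) ^ (-(1 / 2) : ℝ)) by ring,
                sqrt_mul_rpow_neg_half hsc, mul_one]
          _ ≤ 1 / 2 * Bk * (s - c) ^ (-(1 / 2) : ℝ) := by gcongr
          _ = _ := by ring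
      have e5 : Fintype.card ι * b * ∫ r in c..s, (s - r) ^ (-(1 / 2) : ℝ)
          * (L * (Bk * (r - c) ^ (-(1 / 2) : ℝ))) ≤ Fintype.card ι * b * (L * Bk * 6) := by gcongr
      calc _ ≤ _ := norm_add_le _ _
        _ ≤ 4 * gaussConst n * (s - c) ^ (-(1 / 2) : ℝ) * ‖h‖ * M
            + Bk / 2 * (s - c) ^ (-(1 / 2) : ℝ) := add_le_add e1 (e2.trans (e5.trans e4))
        _ = _ := by rw [hBk, hA]; ring
  have hlim : Tendsto (fun k : ℕ => (2 * A * ‖h‖ + 2 * M * √σ * (1 / 2 : ℝ) ^ k)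
      * (t - c) ^ (-(1 / 2) : ℝ)) atTop
      (𝓝 ((2 * A * ‖h‖ + 2 * M * √σ * 0) * (t - c) ^ (-(1 / 2) : ℝ))) :=
    (((tendsto_pow_atTop_nhds_zero_of_lt_one (by norm_num) (by norm_num)).const_mul _).const_add
      _).mul_const _
  have hfin := ge_of_tendsto' hlim fun k => key k t ⟨by linarith, le_rfl⟩ y
  rw [show y + h = x by rw [hh]; abel] at hfin
  refine hfin.trans (le_of_eq ?_)
  rw [show t - c = σ by rw [hc]; ring]
  ring

/-- After a restart at the earlier time s, the heat flow moves a Lipschitz function by O(√(t - s)),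
and the integrated kernel singularity makes the Duhamel term of the same order. -/
theorem IsSol.norm_sub_le_sqrt (hK : KernelFamily K b T₀) (hN : ∀ α, Continuous (N α))
    (hw : IsSol K N a T w) (hT : T - a ≤ T₀) {δ Λ : ℝ} (haδ : a ≤ δ) (hΛ : 0 ≤ Λ)
    (hlip : ∀ t ∈ Icc δ T, ∀ x y, ‖w t x - w t y‖ ≤ Λ * ‖x - y‖) :
    ∃ H, 0 ≤ H ∧ ∀ s ∈ Icc δ T, ∀ t ∈ Icc δ T, ∀ x, ‖w t x - w s x‖ ≤ H * √|t - s| := by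
  have := FiniteDimensional.complete ℝ V
  obtain ⟨M, hM⟩ := hw.bddMeas
  obtain ⟨B, hB⟩ := hM.comp hN
  have hb := hK.nonneg
  have hg := one_le_gaussConst n
  rcases isEmpty_or_nonempty ι with hι | ⟨⟨α₀⟩⟩
  all_goals
    have hB0 : 0 ≤ |B| := abs_nonneg _
    have main : ∀ s ∈ Icc δ T, ∀ t ∈ Icc δ T, s ≤ t → ∀ x, ‖w t x - w s x‖
        ≤ (Λ * (6 * gaussConst n) + Fintype.card ι * b * (2 * |B|)) * √|t - s| := by
      intro s hs t ht hst x
      rcases hst.eq_or_lt with rfl | hst'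
      · simp
      rw [(hw.restart hK hN hT (haδ.trans hs.1)).eq t ⟨hst', ht.2⟩ x, add_sub_right_comm,
        abs_of_nonneg (sub_nonneg.2 hst)]
      have h1 := norm_heat_sub_self_le (sub_nonneg.2 hst) (hM.slice s).aestronglyMeasurable
        (Eventually.of_forall (hM.bound s)) hΛ (x := x)
        (Eventually.of_forall fun y => hlip s hs y x)
      have h2 := hK.norm_duhamel_le (F := fun α s y => N α (w s y)) (M := |B|) hst
        (by linarith [ht.2, hs.1])
        (fun α r _ => Eventually.of_forall fun y => ((hB α).bound r y).trans (le_abs_self B)) x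
      refine (norm_add_le _ _).trans ((add_le_add h1 h2).trans (le_of_eq ?_))
      ring
    refine ⟨Λ * (6 * gaussConst n) + Fintype.card ι * b * (2 * |B|), by positivity,
      fun s hs t ht x => ?_⟩
    rcases le_total s t with h | h
    · exact main s hs t ht h x
    · rw [norm_sub_rev, abs_sub_comm]
      exact main t ht s hs h x

end Regularity

/-! ### The system satisfied by a solution and its spatial derivative -/

section Limits

variable {n : ℕ} {ι : Type} [Fintype ι] {V : Type*} [NormedAddCommGroup V] [NormedSpace ℝ V]
  {K : ι → ℝ → E n → ℝ} {b T₀ : ℝ} {β : Type*} {l : Filter β} [l.IsCountablyGenerated]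

theorem tendsto_conv {k : E n → ℝ} (hk : Integrable k) {f : β → E n → V} {g : E n → V} {M : ℝ}
    (hf : ∀ r, AEStronglyMeasurable (f r) volume) (hM : ∀ r y, ‖f r y‖ ≤ M)
    (hlim : ∀ᵐ y, Tendsto (fun r => f r y) l (𝓝 (g y))) (x : E n) :
    Tendsto (fun r => conv k (f r) x) l (𝓝 (conv k g x)) := by
  refine tendsto_integral_filter_of_dominated_convergence (fun y => |k (x - y)| * M)
    (Eventually.of_forall fun r =>
      (integrable_conv hk (hf r) (Eventually.of_forall (hM r)) x).aestronglyMeasurable)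
    (Eventually.of_forall fun r => Eventually.of_forall fun y => ?_)
    ((hk.comp_sub_left x).abs.mul_const M) ?_
  · rw [norm_smul, Real.norm_eq_abs]
    gcongr
    exact hM r y
  · filter_upwards [hlim] with y hy
    exact hy.const_smul _

theorem KernelFamily.tendsto_duhamel (hK : KernelFamily K b T₀) {F : β → ι → ℝ → E n → V}
    {G : ι → ℝ → E n → V} {M : ℝ} (hF : ∀ r α, BddMeas M (F r α)) {a t : ℝ} (hat : a ≤ t)
    (hT : t - a ≤ T₀)
    (hlim : ∀ α, ∀ s ∈ Ioo a t, ∀ᵐ y, Tendsto (fun r => F r α s y) l (𝓝 (G α s y))) (x : E n) :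
    Tendsto (fun r => duhamel K (F r) a t x) l (𝓝 (duhamel K G a t x)) := by
  have h' : ∀ᵐ s : ℝ, s ≠ t := by simp [ae_iff, measure_singleton]
  refine intervalIntegral.tendsto_integral_filter_of_dominated_convergence
    (fun s => Fintype.card ι * b * ((t - s) ^ (-(1 / 2) : ℝ) * M))
    (Eventually.of_forall fun r => ?_) (Eventually.of_forall fun r => ?_)
    (((intervalIntegrable_sub_rpow a t).mul_const M).const_mul _) ?_
  · have := (hK.intervalIntegrable (hF r) hat hT x).aestronglyMeasurable
    rwa [uIoc_of_le hat]
  · filter_upwards [h'] with s hs hs'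
    rw [uIoc_of_le hat] at hs'
    exact hK.norm_sum_conv_le (lt_of_le_of_ne hs'.2 hs) (by linarith [hs'.1])
      (fun α => Eventually.of_forall ((hF r α).bound s)) x
  · filter_upwards [h'] with s hs hs'
    rw [uIoc_of_le hat] at hs'
    have hst := lt_of_le_of_ne hs'.2 hs
    exact tendsto_finsetSum _ fun α _ => tendsto_conv (hK.integrable α _ (sub_pos.2 hst))
      (fun r => ((hF r α).slice s).aestronglyMeasurable) (fun r => (hF r α).bound s)
      (hlim α s ⟨hs'.1, hst⟩) x

end Limits

/-! ### Differentiation of the integral equation in space -/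

section Derivative

variable {n : ℕ} {ι : Type} [Fintype ι] {V : Type} [NormedAddCommGroup V] [NormedSpace ℝ V]

/-- The nonlinearity of the system satisfied by a solution and its spatial derivative. -/
def derivNonlin (N : ι → V → V) (α : ι) (p : V × (E n →L[ℝ] V)) : V × (E n →L[ℝ] V) :=
  (N α p.1, (fderiv ℝ (N α) p.1).comp p.2)

/-- The projection of the time `t` to `[δ, T]`. -/
def clampTime (δ T t : ℝ) : ℝ := max δ (min t T)

theorem clampTime_of_mem {δ T t : ℝ} (ht : t ∈ Icc δ T) : clampTime δ T t = t := by
  unfold clampTime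
  rw [min_eq_left ht.2, max_eq_right ht.1]

theorem clampTime_mem {δ T : ℝ} (h : δ ≤ T) (t : ℝ) : clampTime δ T t ∈ Icc δ T :=
  ⟨le_max_left _ _, max_le h (min_le_right _ _)⟩

/-- A solution on `[δ, T]`, extended by constants in time, and its spatial derivative. -/
def derivSol (δ T : ℝ) (w : ℝ → E n → V) (t : ℝ) (x : E n) : V × (E n →L[ℝ] V) :=
  (w (clampTime δ T t) x, fderiv ℝ (w (clampTime δ T t)) x)

theorem derivSol_of_mem {δ T t : ℝ} (ht : t ∈ Icc δ T) (w : ℝ → E n → V) (x : E n) :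
    derivSol δ T w t x = (w t x, fderiv ℝ (w t) x) := by
  rw [derivSol, clampTime_of_mem ht]

omit [Fintype ι] in
theorem contDiff_derivNonlin {N : ι → V → V} (hN : ∀ α, ContDiff ℝ (⊤ : ℕ∞) (N α)) (α : ι) :
    ContDiff ℝ (⊤ : ℕ∞) (derivNonlin (n := n) N α) := by
  have h1 : ContDiff ℝ (⊤ : ℕ∞) fun p : V × (E n →L[ℝ] V) => N α p.1 := (hN α).comp contDiff_fst
  have h2 : ContDiff ℝ (⊤ : ℕ∞) fun p : V × (E n →L[ℝ] V) => fderiv ℝ (N α) p.1 :=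
    ((hN α).fderiv_right (m := (⊤ : ℕ∞)) (by simp)).comp contDiff_fst
  exact h1.prodMk (h2.clm_comp contDiff_snd)

omit [NormedSpace ℝ V] in
theorem lipschitzWith_of_norm_sub_le {f : E n → V} {Λ : ℝ} (hΛ : 0 ≤ Λ)
    (h : ∀ x y, ‖f x - f y‖ ≤ Λ * ‖x - y‖) : LipschitzWith Λ.toNNReal f :=
  LipschitzWith.of_dist_le_mul fun x y => by
    rw [dist_eq_norm, dist_eq_norm, Real.coe_toNNReal _ hΛ]; exact h x y

theorem norm_inv_smul_sub_le {f : E n → V} {Λ : ℝ} (hΛ : 0 ≤ Λ)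
    (h : ∀ x y, ‖f x - f y‖ ≤ Λ * ‖x - y‖) (r : ℝ) (y v : E n) :
    ‖r⁻¹ • (f (y + r • v) - f y)‖ ≤ Λ * ‖v‖ := by
  rcases eq_or_ne r 0 with rfl | hr
  · simp; positivity
  rw [norm_smul]
  calc ‖r⁻¹‖ * ‖f (y + r • v) - f y‖ ≤ ‖r⁻¹‖ * (Λ * ‖y + r • v - y‖) := by
        gcongr; exact h _ _
    _ = Λ * ‖v‖ := by
        rw [add_sub_cancel_left, norm_smul, norm_inv]
        have : ‖r‖ ≠ 0 := norm_ne_zero_iff.2 hr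
        field_simp

theorem conv_smul (k : E n → ℝ) (c : ℝ) (f : E n → V) (x : E n) :
    conv k (fun y => c • f y) x = c • conv k f x := by
  unfold conv
  rw [← integral_smul]
  simp_rw [smul_comm c]

theorem duhamel_smul (K : ι → ℝ → E n → ℝ) (c : ℝ) (F : ι → ℝ → E n → V) (a t : ℝ) (x : E n) :
    duhamel K (fun α s y => c • F α s y) a t x = c • duhamel K F a t x := by
  unfold duhamel
  simp_rw [conv_smul, ← Finset.smul_sum]
  rw [intervalIntegral.integral_smul]

variable [FiniteDimensional ℝ V] {K : ι → ℝ → E n → ℝ} {b T₀ : ℝ} {N : ι → V → V} {a T : ℝ}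
  {w : ℝ → E n → V}

/-- Clamping the time makes w jointly continuous on all of ℝ × ℝⁿ, by the Lipschitz bound in space
and the Hölder bound in time. Continuity is what yields the joint measurability of the spatial
derivative. -/
theorem IsSol.derivSol_bddMeas (hK : KernelFamily K b T₀) (hN : ∀ α, ContDiff ℝ (⊤ : ℕ∞) (N α))
    (hw : IsSol K N a T w) (hT : T - a ≤ T₀) {δ : ℝ} (haδ : a < δ) (hδT : δ ≤ T) :
    ∃ M, BddMeas M (derivSol δ T w) := by
  obtain ⟨M, hM⟩ := hw.bddMeas
  obtain ⟨Λ, hΛ, hlip⟩ := hw.lipschitz hK hN hT haδ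
  obtain ⟨H, hH, hhol⟩ := hw.norm_sub_le_sqrt hK (fun α => (hN α).continuous) hT haδ.le hΛ hlip
  have hcl : Continuous (clampTime δ T) := by unfold clampTime; fun_prop
  have hcont : Continuous (Function.uncurry fun t x => w (clampTime δ T t) x) := by
    rw [continuous_iff_continuousAt]
    rintro ⟨t, x⟩
    unfold ContinuousAt
    rw [tendsto_iff_norm_sub_tendsto_zero]
    have hb : Continuous fun p : ℝ × E n => Λ * ‖p.2 - x‖
        + H * √|clampTime δ T p.1 - clampTime δ T t| := by fun_prop
    have hb' := hb.tendsto (t, x)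
    simp only [sub_self, norm_zero, abs_zero, Real.sqrt_zero, mul_zero, add_zero] at hb'
    refine squeeze_zero (fun _ => norm_nonneg _) (fun p => ?_) hb'
    simp only [Function.uncurry]
    refine (norm_sub_le_norm_sub_add_norm_sub _ (w (clampTime δ T p.1) x) _).trans
      (add_le_add (hlip _ (clampTime_mem hδT _) _ _)
      (hhol _ (clampTime_mem hδT _) _ (clampTime_mem hδT _) _))
  borelize V
  refine ⟨max M Λ, ?_, fun t x => ?_⟩
  · have hm : Measurable fun p : ℝ × E n => fderiv ℝ (w (clampTime δ T p.1)) p.2 :=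
      measurable_fderiv_with_param ℝ hcont
    have := FiniteDimensional.complete ℝ V
    exact hcont.stronglyMeasurable.prodMk hm.stronglyMeasurable
  · refine max_le_max (hM.bound _ _) ?_
    have := norm_fderiv_le_of_lipschitz ℝ (x₀ := x)
      (lipschitzWith_of_norm_sub_le hΛ (hlip _ (clampTime_mem hδT t)))
    rwa [Real.coe_toNNReal _ hΛ] at this

/-- Difference quotients of w are bounded by the Lipschitz constant and converge almost everywhere
by Rademacher's theorem. Dominated convergence in the integral equation then gives every directional
derivative at every point of later times. They come from one linear map, which for a Lipschitz
function means Fréchet differentiability. -/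
theorem IsSol.hasFDerivAt (hK : KernelFamily K b T₀) (hN : ∀ α, ContDiff ℝ (⊤ : ℕ∞) (N α))
    (hw : IsSol K N a T w) (hT : T - a ≤ T₀) {δ : ℝ} (haδ : a < δ) {t : ℝ}
    (ht : t ∈ Ioc δ T) (x : E n) :
    HasFDerivAt (w t) (heat (t - δ) (fderiv ℝ (w δ)) x + duhamel K
      (fun α s y => (derivNonlin N α (derivSol δ T w s y)).2) δ t x) x := by
  have := FiniteDimensional.complete ℝ V
  have hNc : ∀ α, Continuous (N α) := fun α => (hN α).continuous
  have hδT : δ ≤ T := ht.1.le.trans ht.2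
  have htδ : 0 < t - δ := sub_pos.2 ht.1
  have htT : t - δ ≤ T₀ := by linarith [ht.2]
  obtain ⟨M, hM⟩ := hw.bddMeas
  obtain ⟨Λ, hΛ, hlip⟩ := hw.lipschitz hK hN hT haδ
  obtain ⟨M', hM'⟩ := hw.derivSol_bddMeas hK hN hT haδ hδT
  obtain ⟨B', hB'⟩ := hM'.comp (fun α => (contDiff_derivNonlin (n := n) hN α).continuous)
  have hB2 : ∀ α, BddMeas B' fun s y => (derivNonlin N α (derivSol δ T w s y)).2 := fun α =>
    ⟨(hB' α).measurable.snd, fun t x => (norm_snd_le _).trans ((hB' α).bound t x)⟩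
  obtain ⟨L, hL, hLip⟩ := exists_lipschitz_of_contDiff hN M
  obtain ⟨B, hB⟩ := hM.comp hNc
  have hδ : ∀ y, fderiv ℝ (w δ) y = (derivSol δ T w δ y).2 := fun y => by
    rw [derivSol_of_mem ⟨le_rfl, hδT⟩]
  have hfm : StronglyMeasurable (fderiv ℝ (w δ)) := by
    have : fderiv ℝ (w δ) = fun y => (derivSol δ T w δ y).2 := funext hδ
    rw [this]; exact (hM'.slice δ).snd
  have hfb : ∀ y, ‖fderiv ℝ (w δ) y‖ ≤ M' := fun y => by
    rw [hδ]; exact (norm_snd_le _).trans (hM'.bound δ y)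
  have hdiff : ∀ s ∈ Icc δ T, ∀ᵐ y, HasFDerivAt (w s) (fderiv ℝ (w s) y) y := fun s hs =>
    (lipschitzWith_of_norm_sub_le hΛ (hlip s hs)).ae_differentiableAt.mono
      fun y hy => hy.hasFDerivAt
  refine LipschitzWith.hasFDerivAt_of_hasLineDerivAt_of_closure
    (lipschitzWith_of_norm_sub_le hΛ (hlip t ⟨ht.1.le, ht.2⟩)) (s := univ) (by simp) fun v _ => ?_
  rw [hasLineDerivAt_iff_tendsto_slope_zero]
  have hwδ := hw.restart hK hNc hT haδ.le
  have hkh := integrable_heatKernel (n := n) htδ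
  have e1 : (heat (t - δ) (fderiv ℝ (w δ)) x + duhamel K
      (fun α s y => (derivNonlin N α (derivSol δ T w s y)).2) δ t x) v
      = conv (heatKernel (t - δ)) (fun y => fderiv ℝ (w δ) y v) x + duhamel K
      (fun α s y => (derivNonlin N α (derivSol δ T w s y)).2 v) δ t x := by
    rw [add_apply, heat_of_pos htδ]
    congr 1
    · exact clm_conv (ContinuousLinearMap.apply ℝ V v) hkh hfm.aestronglyMeasurable
        (Eventually.of_forall hfb) x
    · exact hK.clm_duhamel (ContinuousLinearMap.apply ℝ V v) hB2 ht.1.le htT x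
  have hshift : ∀ h : E n, ∀ α, BddMeas B fun s y => N α (w s (y + h)) := fun h α =>
    ⟨(hB α).measurable.comp_measurable (g := fun p : ℝ × E n => (p.1, p.2 + h)) (by fun_prop),
      fun t x => (hB α).bound t (x + h)⟩
  have e2 : ∀ r : ℝ, r⁻¹ • (w t (x + r • v) - w t x)
      = conv (heatKernel (t - δ)) (fun y => r⁻¹ • (w δ (y + r • v) - w δ y)) x
        + duhamel K (fun α s y => r⁻¹ • (N α (w s (y + r • v)) - N α (w s y))) δ t x := by
    intro r
    have hm : AEStronglyMeasurable (fun y => w δ (y + r • v)) volume :=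
      ((hM.slice δ).comp_measurable (g := fun y => y + r • v) (by fun_prop)).aestronglyMeasurable
    rw [hwδ.eq t ht, hwδ.eq t ht, heat_of_pos htδ, conv_add_right, duhamel_add_right,
      add_sub_add_comm, hK.duhamel_sub (hshift _) hB ht.1.le htT,
      conv_sub hkh hm (hM.slice δ).aestronglyMeasurable
        (Eventually.of_forall fun y => hM.bound δ _) (Eventually.of_forall (hM.bound δ)),
      smul_add, conv_smul, duhamel_smul]
  rw [e1]
  simp_rw [e2]
  refine Tendsto.add ?_ ?_
  · refine tendsto_conv hkh (M := Λ * ‖v‖) (fun r => ?_)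
      (fun r y => norm_inv_smul_sub_le hΛ (hlip δ ⟨le_rfl, hδT⟩) r y v) ?_ x
    · exact ((((hM.slice δ).comp_measurable (g := fun y => y + r • v)
        (by fun_prop)).sub (hM.slice δ)).const_smul _).aestronglyMeasurable
    · filter_upwards [hdiff δ ⟨le_rfl, hδT⟩] with y hy
      exact hasLineDerivAt_iff_tendsto_slope_zero.1 (hy.hasLineDerivAt v)
  · have hNlip : ∀ α, ∀ s ∈ Icc δ T, ∀ x y, ‖N α (w s x) - N α (w s y)‖ ≤ L * Λ * ‖x - y‖ := by
      intro α s hs x y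
      rw [mul_assoc]
      exact (hLip α _ _ (hM.bound s x) (hM.bound s y)).trans (by gcongr; exact hlip s hs x y)
    -- The bound on the quotients holds only for times in [δ, T]. Clamping makes it global without
    -- changing the integral.
    have hcongr : ∀ r : ℝ, duhamel K
          (fun α s y => r⁻¹ • (N α (w s (y + r • v)) - N α (w s y))) δ t x
        = duhamel K (fun α s y => r⁻¹ • (N α (w (clampTime δ T s) (y + r • v))
          - N α (w (clampTime δ T s) y))) δ t x := fun r =>
      duhamel_congr ht.1.le (fun α => Eventually.of_forall fun s hs => by
        rw [clampTime_of_mem ⟨hs.1.le, hs.2.le.trans ht.2⟩]) x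
    simp_rw [hcongr]
    have hclm : ∀ h : E n, ∀ α, StronglyMeasurable (Function.uncurry
        fun s y => N α (w (clampTime δ T s) (y + h))) := fun h α => by
      have hcl : Continuous (clampTime δ T) := by unfold clampTime; fun_prop
      exact (hB α).measurable.comp_measurable
        (g := fun p : ℝ × E n => (clampTime δ T p.1, p.2 + h)) (by fun_prop)
    have hF : ∀ (r : ℝ) α, BddMeas (L * Λ * ‖v‖) fun s y =>
        r⁻¹ • (N α (w (clampTime δ T s) (y + r • v)) - N α (w (clampTime δ T s) y)) := by
      intro r α
      have h0 := hclm 0 α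
      simp only [add_zero] at h0
      have h1 := ((hclm (r • v) α).sub h0).const_smul r⁻¹
      exact ⟨h1, fun s y => norm_inv_smul_sub_le (mul_nonneg hL hΛ)
        (hNlip α _ (clampTime_mem hδT s)) r y v⟩
    refine hK.tendsto_duhamel hF ht.1.le htT (fun α s hs => ?_) x
    · have hsI : s ∈ Icc δ T := ⟨hs.1.le, hs.2.le.trans ht.2⟩
      filter_upwards [hdiff s hsI] with y hy
      rw [clampTime_of_mem hsI, derivSol_of_mem hsI]
      have hc : HasFDerivAt (fun y => N α (w s y))
          ((fderiv ℝ (N α) (w s y)).comp (fderiv ℝ (w s) y)) y :=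
        (((hN α).differentiable (by simp)).differentiableAt.hasFDerivAt).comp y hy
      have hlim := hasLineDerivAt_iff_tendsto_slope_zero.1 (hc.hasLineDerivAt v)
      exact hlim

/-- The kernels are unchanged and the new nonlinearities are again smooth, so every result about
`IsSol` applies to the derivative. This is the induction step of all higher regularity. -/
theorem IsSol.isSol_derivSol (hK : KernelFamily K b T₀) (hN : ∀ α, ContDiff ℝ (⊤ : ℕ∞) (N α))
    (hw : IsSol K N a T w) (hT : T - a ≤ T₀) {δ : ℝ} (haδ : a < δ) (hδT : δ ≤ T) :
    IsSol K (derivNonlin N) δ T (derivSol δ T w) := by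
  have := FiniteDimensional.complete ℝ V
  obtain ⟨M', hM'⟩ := hw.derivSol_bddMeas hK hN hT haδ hδT
  obtain ⟨B', hB'⟩ := hM'.comp (fun α => (contDiff_derivNonlin (n := n) hN α).continuous)
  refine ⟨⟨M', hM'⟩, fun t ht x => ?_⟩
  have hNc : ∀ α, Continuous (N α) := fun α => (hN α).continuous
  have htδ : 0 < t - δ := sub_pos.2 ht.1
  have htT : t - δ ≤ T₀ := by linarith [ht.2]
  have hkh := integrable_heatKernel (n := n) htδ
  have hm := (hM'.slice δ).aestronglyMeasurable (μ := volume)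
  have hb := Eventually.of_forall (f := ae (volume : Measure (E n))) (hM'.bound δ)
  rw [derivSol_of_mem ⟨ht.1.le, ht.2⟩, (hw.hasFDerivAt hK hN hT haδ ht x).fderiv]
  refine Prod.ext ?_ ?_
  · rw [Prod.fst_add]
    simp only [heat_of_pos htδ]
    have h1 := clm_conv (ContinuousLinearMap.fst ℝ V (E n →L[ℝ] V)) hkh hm hb x
    have h2 := hK.clm_duhamel (ContinuousLinearMap.fst ℝ V (E n →L[ℝ] V)) hB' ht.1.le htT x
    simp only [ContinuousLinearMap.coe_fst'] at h1 h2
    rw [h1, h2]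
    rw [(hw.restart hK hNc hT haδ.le).eq t ht x, heat_of_pos htδ]
    congr 1
    · congr 1; funext y; rw [derivSol_of_mem ⟨le_rfl, hδT⟩]
    · refine duhamel_congr ht.1.le (fun α => Eventually.of_forall fun s hs => ?_) x
      refine Eventually.of_forall fun y => ?_
      simp only [derivNonlin]
      rw [derivSol_of_mem ⟨hs.1.le, hs.2.le.trans ht.2⟩]
  · rw [Prod.snd_add]
    simp only [heat_of_pos htδ]
    have h1 := clm_conv (ContinuousLinearMap.snd ℝ V (E n →L[ℝ] V)) hkh hm hb x
    have h2 := hK.clm_duhamel (ContinuousLinearMap.snd ℝ V (E n →L[ℝ] V)) hB' ht.1.le htT x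
    simp only [ContinuousLinearMap.coe_snd'] at h1 h2
    rw [h1, h2]
    congr 2
    funext y; rw [derivSol_of_mem ⟨le_rfl, hδT⟩]

end Derivative

/-! ### Weak derivatives -/

section WeakDerivatives

variable {n : ℕ} {V : Type*} [NormedAddCommGroup V] [NormedSpace ℝ V]

theorem IsTest.fderiv_apply {φ : E n → ℝ} (hφ : IsTest φ) (v : E n) :
    IsTest fun x => fderiv ℝ φ x v :=
  ⟨(hφ.1.fderiv_right (m := (⊤ : ℕ∞)) (by simp)).clm_apply contDiff_const,
    hφ.2.fderiv_apply (𝕜 := ℝ) v⟩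

theorem iteratedFDeriv_succ_apply_eq {φ : E n → ℝ} (hφ : ContDiff ℝ (⊤ : ℕ∞) φ) (l : ℕ)
    (m : Fin (l + 1) → E n) (x : E n) :
    iteratedFDeriv ℝ (l + 1) φ x m
      = fderiv ℝ (fun y => iteratedFDeriv ℝ l φ y (Fin.tail m)) x (m 0) := by
  rw [iteratedFDeriv_succ_apply_left]
  have hd : DifferentiableAt ℝ (iteratedFDeriv ℝ l φ) x :=
    (hφ.differentiable_iteratedFDeriv (m := l) (by exact_mod_cast WithTop.coe_lt_top _)) x
  have := (ContinuousMultilinearMap.apply ℝ (fun _ : Fin l => E n) ℝ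
    (Fin.tail m)).hasFDerivAt.comp x hd.hasFDerivAt
  have h2 := this.fderiv
  simp only [Function.comp_def, ContinuousMultilinearMap.apply_apply] at h2
  rw [h2]
  rfl

theorem IsTest.iteratedFDeriv_apply {φ : E n → ℝ} (hφ : IsTest φ) {l : ℕ} (m : Fin l → E n) :
    IsTest fun x => iteratedFDeriv ℝ l φ x m := by
  induction l with
  | zero => simpa using hφ
  | succ l ih =>
    have := (ih (Fin.tail m)).fderiv_apply (m 0)
    simpa only [iteratedFDeriv_succ_apply_eq hφ.1] using this

theorem HasWeakPartial.of_zero {f : E n → V} (hf : LocallyIntegrable f volume)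
    (α : Fin 0 → Fin n) : HasWeakPartial α f f :=
  ⟨hf, hf, fun φ _ => by simp⟩

theorem iteratedFDeriv_one_apply_e (φ : E n → ℝ) (i : Fin n) (x : E n) :
    iteratedFDeriv ℝ 1 φ x (fun _ => e i) = fderiv ℝ φ x (e i) := by
  simp [iteratedFDeriv_one_apply]

theorem hasWeakPartial_one_iff {i : Fin n} {f g : E n → V} :
    HasWeakPartial (fun _ : Fin 1 => i) f g ↔ LocallyIntegrable f volume ∧
      LocallyIntegrable g volume ∧ ∀ φ : E n → ℝ, IsTest φ →
        ∫ x, fderiv ℝ φ x (e i) • f x = -∫ x, φ x • g x := by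
  unfold HasWeakPartial
  simp_rw [iteratedFDeriv_one_apply_e]
  simp

theorem HasWeakPartial.cons {l : ℕ} {α : Fin (l + 1) → Fin n} {f g h : E n → V}
    (hfg : HasWeakPartial (fun _ : Fin 1 => α 0) f g)
    (hgh : HasWeakPartial (Fin.tail α) g h) : HasWeakPartial α f h := by
  rw [hasWeakPartial_one_iff] at hfg
  refine ⟨hfg.1, hgh.2.1, fun φ hφ => ?_⟩
  have h1 := hfg.2.2 _ (hφ.iteratedFDeriv_apply (fun j => e (Fin.tail α j)))
  have h2 := hgh.2.2 φ hφ
  simp_rw [iteratedFDeriv_succ_apply_eq hφ.1]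
  rw [h2] at h1
  rw [pow_succ, mul_neg_one, neg_smul, ← h1]
  rfl

theorem HasWeakPartial.unique [CompleteSpace V] {l : ℕ} {α : Fin l → Fin n} {f f' g g' : E n → V}
    (h : HasWeakPartial α f g) (h' : HasWeakPartial α f' g') (hff' : f =ᵐ[volume] f') :
    g =ᵐ[volume] g' := by
  have hz : ∀ᵐ x : E n, g x - g' x = 0 := by
    refine ae_eq_zero_of_integral_contDiff_smul_eq_zero (h.2.1.sub h'.2.1) fun φ hφ hc => ?_
    have hi : ∀ {g : E n → V}, LocallyIntegrable g volume → Integrable fun x => φ x • g x :=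
      fun hg => hg.integrable_smul_left_of_hasCompactSupport hφ.continuous hc
    have e1 := h.2.2 φ ⟨hφ, hc⟩
    have e2 := h'.2.2 φ ⟨hφ, hc⟩
    have e3 : ∫ x, (iteratedFDeriv ℝ l φ x fun j => e (α j)) • f x
        = ∫ x, (iteratedFDeriv ℝ l φ x fun j => e (α j)) • f' x :=
      integral_congr_ae (hff'.mono fun x hx => by simp only [hx])
    rw [e1, e2] at e3
    have e4 : ∫ x, φ x • g x = ∫ x, φ x • g' x :=
      smul_right_injective V (pow_ne_zero l (by norm_num : (-1 : ℝ) ≠ 0)) e3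
    simp only [smul_sub]
    rw [integral_sub (hi h.2.1) (hi h'.2.1), e4, sub_self]
  exact hz.mono fun x hx => sub_eq_zero.1 hx

theorem HasWeakPartial.congr {l : ℕ} {α : Fin l → Fin n} {f f' g g' : E n → V}
    (h : HasWeakPartial α f g) (hff' : f =ᵐ[volume] f') (hgg' : g =ᵐ[volume] g') :
    HasWeakPartial α f' g' := by
  have hl : ∀ {p q : E n → V}, p =ᵐ[volume] q → LocallyIntegrable p volume →
      LocallyIntegrable q volume := fun {p q} hpq hp x => by
    obtain ⟨s, hs, hi⟩ := hp x
    exact ⟨s, hs, hi.congr (ae_restrict_of_ae hpq)⟩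
  refine ⟨hl hff' h.1, hl hgg' h.2.1, fun φ hφ => ?_⟩
  have h1 : ∫ x, (iteratedFDeriv ℝ l φ x fun j => e (α j)) • f x
      = ∫ x, (iteratedFDeriv ℝ l φ x fun j => e (α j)) • f' x :=
    integral_congr_ae (hff'.mono fun x hx => by simp only [hx])
  have h2 : ∫ x, φ x • g x = ∫ x, φ x • g' x :=
    integral_congr_ae (hgg'.mono fun x hx => by simp only [hx])
  rw [← h1, h.2.2 φ hφ, h2]

omit [NormedSpace ℝ V] in
theorem locallyIntegrable_of_bound {f : E n → V} (hf : AEStronglyMeasurable f volume) {M : ℝ}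
    (hM : ∀ᵐ x, ‖f x‖ ≤ M) : LocallyIntegrable f volume :=
  (memLp_top_of_bound hf M hM).locallyIntegrable (by simp)

theorem integrable_test_smul {φ : E n → ℝ} (hφ : IsTest φ) {f : E n → V}
    (hf : LocallyIntegrable f volume) : Integrable fun x => φ x • f x :=
  hf.integrable_smul_left_of_hasCompactSupport hφ.1.continuous hφ.2

theorem hasWeakPartial_of_hasFDerivAt {f : E n → V} {f' : E n → E n →L[ℝ] V}
    (hf : LocallyIntegrable f volume) (hd : ∀ x, HasFDerivAt f (f' x) x) (i : Fin n)
    (hf' : LocallyIntegrable (fun x => f' x (e i)) volume) :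
    HasWeakPartial (fun _ : Fin 1 => i) f fun x => f' x (e i) := by
  rw [hasWeakPartial_one_iff]
  refine ⟨hf, hf', fun φ hφ => ?_⟩
  have := integral_bilinear_hasFDerivAt_right_eq_neg_left_of_integrable
    (μ := (volume : Measure (E n))) (B := ContinuousLinearMap.lsmul ℝ ℝ) (f := φ)
    (f' := fderiv ℝ φ) (g := f) (g' := f') (v := e i)
    (integrable_test_smul (hφ.fderiv_apply (e i)) hf) (integrable_test_smul hφ hf')
    (integrable_test_smul hφ hf)
    (fun x _ => ((hφ.1.differentiable (by simp)) x).hasFDerivAt) (fun x _ => hd x)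
  simp only [ContinuousLinearMap.lsmul_apply] at this
  rw [this, neg_neg]

/-- All weak partial derivatives of `f` of order at most `k` exist and are bounded by `M`. -/
def SobolevBound (k : ℕ) (f : E n → V) (M : ℝ≥0∞) : Prop :=
  ∀ l ≤ k, ∀ α : Fin l → Fin n, ∃ g, HasWeakPartial α f g ∧ eLpNorm g ⊤ volume ≤ M

theorem SobolevBound.sobolevNorm_le {k : ℕ} {f : E n → V} {M : ℝ≥0∞} (h : SobolevBound k f M) :
    sobolevNorm k f ≤ M := by
  refine iSup_le fun l => iSup_le fun hl => iSup_le fun α => ?_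
  obtain ⟨g, hg, hgM⟩ := h l hl α
  exact (iInf₂_le g hg).trans hgM

theorem SobolevBound.mono {k : ℕ} {f : E n → V} {M M' : ℝ≥0∞} (h : SobolevBound k f M)
    (hM : M ≤ M') : SobolevBound k f M' := fun l hl α =>
  let ⟨g, hg, hgM⟩ := h l hl α
  ⟨g, hg, hgM.trans hM⟩

theorem SobolevBound.imp_zero {k : ℕ} {f : E n → V} {M : ℝ≥0∞} (h : SobolevBound k f M) :
    SobolevBound 0 f M := fun l hl α => h l (hl.trans (Nat.zero_le k)) α

omit [NormedSpace ℝ V] in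
theorem eLpNorm_top_le_of_norm_le {f : E n → V} {M : ℝ} (hM : ∀ᵐ x, ‖f x‖ ≤ M) :
    eLpNorm f ⊤ volume ≤ ENNReal.ofReal M := by
  rw [eLpNorm_exponent_top]
  exact eLpNormEssSup_le_of_ae_bound hM

theorem sobolevBound_zero {f : E n → V} (hf : AEStronglyMeasurable f volume) {M : ℝ}
    (hM : ∀ᵐ x, ‖f x‖ ≤ M) : SobolevBound 0 f (ENNReal.ofReal M) := by
  intro l hl α
  obtain rfl : l = 0 := by omega
  exact ⟨f, .of_zero (locallyIntegrable_of_bound hf hM) α, eLpNorm_top_le_of_norm_le hM⟩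

theorem SobolevBound.succ {k : ℕ} {f : E n → V} {M : ℝ≥0∞} (h0 : SobolevBound 0 f M)
    (h : ∀ i : Fin n, ∃ g, HasWeakPartial (fun _ : Fin 1 => i) f g ∧ SobolevBound k g M) :
    SobolevBound (k + 1) f M := by
  intro l hl α
  rcases l with _ | l
  · exact h0 0 le_rfl α
  · obtain ⟨g, hg, hgk⟩ := h (α 0)
    obtain ⟨g', hg', hM⟩ := hgk l (by omega) (Fin.tail α)
    exact ⟨g', hg.cons hg', hM⟩

end WeakDerivatives

/-! ### Higher regularity of solutions -/

section HigherRegularity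

variable {n : ℕ} {ι : Type} [Fintype ι] {W : Type*} [NormedAddCommGroup W] [NormedSpace ℝ W]

/-- The component of the derivative system that is the `i`-th partial derivative of `π ∘ w`. -/
def partialProj {V : Type} [NormedAddCommGroup V] [NormedSpace ℝ V] (π : V →L[ℝ] W) (i : Fin n) :
    V × (E n →L[ℝ] V) →L[ℝ] W :=
  π ∘L (ContinuousLinearMap.apply ℝ V (e i)) ∘L ContinuousLinearMap.snd ℝ V (E n →L[ℝ] V)

theorem IsSol.hasFDerivAt' {V : Type} [NormedAddCommGroup V] [NormedSpace ℝ V]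
    [FiniteDimensional ℝ V] {K : ι → ℝ → E n → ℝ} {b T₀ : ℝ} {N : ι → V → V} {a T : ℝ}
    {w : ℝ → E n → V} (hK : KernelFamily K b T₀) (hN : ∀ α, ContDiff ℝ (⊤ : ℕ∞) (N α))
    (hw : IsSol K N a T w) (hT : T - a ≤ T₀) {δ : ℝ} (haδ : a < δ) {t : ℝ}
    (ht : t ∈ Ioc δ T) (x : E n) :
    HasFDerivAt (w t) (LiquidCrystal.derivSol δ T w t x).2 x := by
  rw [derivSol_of_mem ⟨ht.1.le, ht.2⟩]
  exact (hw.hasFDerivAt hK hN hT haδ ht x).differentiableAt.hasFDerivAt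

theorem IsSol.hasWeakPartial {V : Type} [NormedAddCommGroup V] [NormedSpace ℝ V]
    [FiniteDimensional ℝ V] {K : ι → ℝ → E n → ℝ} {b T₀ : ℝ} {N : ι → V → V} {a T : ℝ}
    {w : ℝ → E n → V} (hK : KernelFamily K b T₀) (hN : ∀ α, ContDiff ℝ (⊤ : ℕ∞) (N α))
    (hw : IsSol K N a T w) (hT : T - a ≤ T₀) {δ : ℝ} (haδ : a < δ) (π : V →L[ℝ] W) (i : Fin n) :
    (∀ t ∈ Ioc δ T, HasWeakPartial (fun _ : Fin 1 => i) (fun x => π (w t x))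
      fun x => partialProj π i (LiquidCrystal.derivSol δ T w t x)) ∧
    ∀ s ∈ Ioc δ T, ∀ t ∈ Ioc δ T, HasWeakPartial (fun _ : Fin 1 => i)
      (fun x => π (w t x) - π (w s x))
      fun x => partialProj π i (LiquidCrystal.derivSol δ T w t x)
        - partialProj π i (LiquidCrystal.derivSol δ T w s x) := by
  obtain ⟨M, hM⟩ := hw.bddMeas
  have hl : ∀ t, LocallyIntegrable (fun x => π (w t x)) volume := fun t =>
    locallyIntegrable_of_bound (π.continuous.comp_stronglyMeasurable (hM.slice t)).aestronglyMeasurable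
      (Eventually.of_forall fun x => (π.le_opNorm _).trans
        (mul_le_mul_of_nonneg_left (hM.bound t x) (norm_nonneg π)))
  rcases lt_or_ge T δ with h | hδT
  · exact ⟨fun t ht => absurd (ht.1.le.trans ht.2) (not_le.2 h),
      fun s hs => absurd (hs.1.le.trans hs.2) (not_le.2 h)⟩
  obtain ⟨M', hM'⟩ := hw.derivSol_bddMeas hK hN hT haδ hδT
  have hl' : ∀ t, LocallyIntegrable
      (fun x => partialProj π i (LiquidCrystal.derivSol δ T w t x)) volume := fun t =>
    locallyIntegrable_of_bound
      ((partialProj π i).continuous.comp_stronglyMeasurable (hM'.slice t)).aestronglyMeasurable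
      (Eventually.of_forall fun x => ((partialProj π i).le_opNorm _).trans
        (mul_le_mul_of_nonneg_left (hM'.bound t x) (norm_nonneg _)))
  have hd : ∀ t ∈ Ioc δ T, ∀ x, HasFDerivAt (fun x => π (w t x))
      (π ∘L (LiquidCrystal.derivSol δ T w t x).2) x := fun t ht x =>
    π.hasFDerivAt.comp x (hw.hasFDerivAt' hK hN hT haδ ht x)
  exact ⟨fun t ht => hasWeakPartial_of_hasFDerivAt (hl t) (hd t ht) i (hl' t),
    fun s hs t ht => hasWeakPartial_of_hasFDerivAt ((hl t).sub (hl s))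
      (fun x => (hd t ht x).sub (hd s hs x)) i ((hl' t).sub (hl' s))⟩

/-- The induction runs over all systems and all target projections at once: a derivative of w is a
component of the derivative system. Each step uses up part of the time between a and δ, through the
intermediate δ'. -/
theorem IsSol.sobolevBound_half (k : ℕ) : ∀ {V : Type} [NormedAddCommGroup V] [NormedSpace ℝ V]
    [FiniteDimensional ℝ V] {K : ι → ℝ → E n → ℝ} {b T₀ : ℝ} {N : ι → V → V} {a T : ℝ}
    {w : ℝ → E n → V} (_ : KernelFamily K b T₀) (_ : ∀ α, ContDiff ℝ (⊤ : ℕ∞) (N α))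
    (_ : IsSol K N a T w) (_ : T - a ≤ T₀) {δ : ℝ} (_ : a < δ) (π : V →L[ℝ] W),
    ∃ M : ℝ≥0, (∀ t ∈ Icc δ T, SobolevBound k (fun x => π (w t x)) M) ∧
      ∀ s ∈ Icc δ T, ∀ t ∈ Icc δ T, SobolevBound k (fun x => π (w t x) - π (w s x))
        (M * ENNReal.ofReal (|t - s| ^ (1 / 2 : ℝ))) := by
  induction k with
  | zero =>
    intro V _ _ _ K b T₀ N a T w hK hN hw hT δ haδ π
    obtain ⟨M, hM⟩ := hw.bddMeas
    have hM0 : 0 ≤ M := (norm_nonneg _).trans (hM.bound 0 0)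
    obtain ⟨Λ, hΛ, hlip⟩ := hw.lipschitz hK hN hT haδ
    obtain ⟨H, hH, hhol⟩ := hw.norm_sub_le_sqrt hK (fun α => (hN α).continuous) hT haδ.le hΛ hlip
    have hm : ∀ t, StronglyMeasurable fun x => π (w t x) := fun t =>
      π.continuous.comp_stronglyMeasurable (hM.slice t)
    refine ⟨Real.toNNReal (‖π‖ * M + ‖π‖ * H), fun t ht => ?_, fun s hs t ht => ?_⟩
    · refine sobolevBound_zero (hm t).aestronglyMeasurable (Eventually.of_forall fun x => ?_)
      refine (π.le_opNorm _).trans ?_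
      have := mul_le_mul_of_nonneg_left (hM.bound t x) (norm_nonneg π)
      have : 0 ≤ ‖π‖ * H := by positivity
      linarith
    · refine (sobolevBound_zero ((hm t).sub (hm s)).aestronglyMeasurable
        (M := (‖π‖ * M + ‖π‖ * H) * |t - s| ^ (1 / 2 : ℝ))
        (Eventually.of_forall fun x => ?_)).mono (le_of_eq ?_)
      · rw [Pi.sub_apply, ← map_sub]
        refine (π.le_opNorm _).trans ?_
        have h1 := mul_le_mul_of_nonneg_left (hhol s hs t ht x) (norm_nonneg π)
        rw [Real.sqrt_eq_rpow] at h1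
        have : 0 ≤ ‖π‖ * M * |t - s| ^ (1 / 2 : ℝ) := by positivity
        linarith
      · rw [ENNReal.ofReal_mul (by positivity)]; rfl
  | succ k ih =>
    intro V _ _ _ K b T₀ N a T w hK hN hw hT δ haδ π
    rcases lt_or_ge T δ with h | hδT
    · exact ⟨0, fun t ht => absurd (ht.1.trans ht.2) (not_le.2 h),
        fun s hs => absurd (hs.1.trans hs.2) (not_le.2 h)⟩
    obtain ⟨δ', haδ', hδ'⟩ := exists_between haδ
    obtain ⟨M₀, hM₀, hM₀'⟩ := ih hK hN hw hT haδ π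
    have hw' := hw.isSol_derivSol hK hN hT haδ' (hδ'.le.trans hδT)
    have hT' : T - δ' ≤ T₀ := by linarith
    have := fun i : Fin n => ih hK (contDiff_derivNonlin (n := n) hN) hw' hT' hδ' (partialProj π i)
    choose M hM hM' using this
    have hle0 : (M₀ : ℝ≥0∞) ≤ (M₀ + ∑ i, M i : ℝ≥0) := by exact_mod_cast le_self_add
    have hle : ∀ i, (M i : ℝ≥0∞) ≤ (M₀ + ∑ i, M i : ℝ≥0) := fun i => by
      have := (Finset.single_le_sum (f := M) (fun _ _ => zero_le) (Finset.mem_univ i)).trans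
        (le_add_self (b := M₀))
      exact_mod_cast this
    refine ⟨M₀ + ∑ i, M i, fun t ht => SobolevBound.succ
      (((hM₀ t ht).mono hle0).imp_zero) fun i => ?_, fun s hs t ht => SobolevBound.succ
      (((hM₀' s hs t ht).mono (mul_le_mul_left hle0 _)).imp_zero) fun i => ?_⟩
    · exact ⟨_, (hw.hasWeakPartial hK hN hT haδ' π i).1 t ⟨hδ'.trans_le ht.1, ht.2⟩,
        (hM i t ht).mono (hle i)⟩
    · exact ⟨_, (hw.hasWeakPartial hK hN hT haδ' π i).2 s ⟨hδ'.trans_le hs.1, hs.2⟩ t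
        ⟨hδ'.trans_le ht.1, ht.2⟩, (hM' i s hs t ht).mono (mul_le_mul_left (hle i) _)⟩

end HigherRegularity

/-! ### Components driven by the heat kernel only -/

section SecondOrder

variable {n : ℕ} {V : Type} [NormedAddCommGroup V] [NormedSpace ℝ V] [CompleteSpace V]

omit [CompleteSpace V] in
theorem heat_reflect (h : ℝ) (f : E n → V) (x : E n) :
    heat h (fun y => f (x + x - y)) x = heat h f x := by
  rcases eq_or_ne h 0 with rfl | hh
  · simp [heat_zero]
  unfold heat
  rw [if_neg hh, if_neg hh,
    ← integral_sub_left_eq_self (fun y => heatKernel h (x - y) • f y) volume (x + x)]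
  congr 1; ext y
  rw [show x - (x + x - y) = -(x - y) by abel, heatKernel_neg]

omit [NormedSpace ℝ V] [CompleteSpace V] in
theorem aestronglyMeasurable_comp_sub_left {f : E n → V} (hf : AEStronglyMeasurable f volume)
    (x : E n) : AEStronglyMeasurable (fun y => f (x - y)) volume :=
  hf.comp_quasiMeasurePreserving (quasiMeasurePreserving_sub_left_of_right_invariant volume x)

/-- The heat kernel is even, so f may be replaced by its symmetrisation about x. The linear Taylor
term cancels and the second moment leaves O(h) instead of O(√h). -/
theorem norm_heat_sub_self_le_of_taylor {h : ℝ} (hh : 0 ≤ h) {f : E n → V}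
    (hf : AEStronglyMeasurable f volume) {M : ℝ} (hM : ∀ y, ‖f y‖ ≤ M) {Λ : ℝ} (hΛ : 0 ≤ Λ)
    {x : E n} {L : E n →L[ℝ] V} (htaylor : ∀ z, ‖f (x + z) - f x - L z‖ ≤ Λ * ‖z‖ ^ 2) :
    ‖heat h f x - f x‖ ≤ Λ * (16 * gaussConst n * h) := by
  rcases hh.eq_or_lt with rfl | hh
  · simp [heat_zero]
  have hf' := aestronglyMeasurable_comp_sub_left hf (x + x)
  have hMae := Eventually.of_forall (f := ae (volume : Measure (E n))) hM
  have hMae' : ∀ᵐ y, ‖f (x + x - y)‖ ≤ M := Eventually.of_forall fun y => hM _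
  have h1 : heat h f x = heat h (fun y => (1 / 2 : ℝ) • (f y + f (x + x - y))) x := by
    have h2 : heat h (fun y => (1 / 2 : ℝ) • (f y + f (x + x - y))) x
        = (1 / 2 : ℝ) • heat h (fun y => f y + f (x + x - y)) x := by
      simp only [heat_of_pos hh]
      exact conv_smul _ _ _ _
    rw [h2, heat_add hh.le hf hf' hMae hMae', heat_reflect, ← two_smul ℝ, smul_smul]
    norm_num
  rw [h1]
  have := norm_heat_sub_const_le hh ((hf.add hf').const_smul (1 / 2 : ℝ)) (M := M)
    (Eventually.of_forall fun y => ?_) x (f x) (c₀ := 0) (c₁ := 0) (c₂ := Λ) le_rfl hΛ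
    (Eventually.of_forall fun z => ?_)
  · exact this.trans (le_of_eq (by ring))
  · simp only [Pi.smul_apply, Pi.add_apply]
    rw [norm_smul, Real.norm_of_nonneg (by norm_num)]
    have := norm_add_le (f y) (f (x + x - y))
    linarith [hM y, hM (x + x - y)]
  · simp only [Pi.smul_apply, Pi.add_apply]
    have e : (1 / 2 : ℝ) • (f (x - z) + f (x + x - (x - z))) - f x
        = (1 / 2 : ℝ) • ((f (x + -z) - f x - L (-z)) + (f (x + z) - f x - L z)) := by
      rw [show x + x - (x - z) = x + z by abel, ← sub_eq_add_neg, map_neg]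
      have : f x = (1 / 2 : ℝ) • (f x + f x) := by
        rw [← two_smul ℝ, smul_smul]; norm_num
      conv_lhs => rw [this]
      rw [← smul_sub]
      congr 1
      abel
    rw [e, norm_smul, Real.norm_of_nonneg (by norm_num)]
    have := norm_add_le (f (x + -z) - f x - L (-z)) (f (x + z) - f x - L z)
    have h3 := htaylor (-z)
    have h4 := htaylor z
    rw [norm_neg] at h3
    linarith

/-- The flow commutes with the translation by hv. The increment f(y + hv) - f(y) is h f'(y)v up to
O(h²), and averaging f' over the heat kernel moves it by O(√h), in total O(h^{3/2}). -/
theorem norm_heat_shift_sub_le {h : ℝ} (hh : 0 < h) (h1 : h ≤ 1) {f : E n → V}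
    (hf : AEStronglyMeasurable f volume) {M : ℝ} (hM : ∀ y, ‖f y‖ ≤ M) {Λ : ℝ} (hΛ : 0 ≤ Λ)
    {f' : E n → E n →L[ℝ] V} (htaylor : ∀ x z, ‖f (x + z) - f x - f' x z‖ ≤ Λ * ‖z‖ ^ 2)
    (hf' : ∀ x y, ‖f' x - f' y‖ ≤ Λ * ‖x - y‖) (x v : E n) :
    ‖heat h f (x + h • v) - (heat h f x + h • f' x v)‖
      ≤ Λ * (‖v‖ + ‖v‖ ^ 2) * (6 * gaussConst n) * (h * √h) := by
  have hg := one_le_gaussConst n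
  have hfs : AEStronglyMeasurable (fun y => f (y + h • v)) volume :=
    hf.comp_quasiMeasurePreserving (quasiMeasurePreserving_add_right volume (h • v))
  have he : heat h f (x + h • v) - (heat h f x + h • f' x v)
      = heat h (fun y => f (y + h • v) - f y) x - h • f' x v := by
    rw [heat_sub hh.le hfs hf (M := M) (M' := M) (Eventually.of_forall fun y => hM _)
      (Eventually.of_forall hM)]
    simp only [heat_of_pos hh, conv_add_right]
    abel
  rw [he]
  refine (norm_heat_sub_const_le hh (hfs.sub hf) (M := M + M) (Eventually.of_forall fun y =>
    (norm_sub_le _ _).trans (add_le_add (hM _) (hM _))) x (h • f' x v)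
    (c₀ := Λ * h ^ 2 * ‖v‖ ^ 2) (c₁ := Λ * h * ‖v‖) (c₂ := 0) (by positivity) le_rfl
    (Eventually.of_forall fun z => ?_)).trans ?_
  · have e : f (x - z + h • v) - f (x - z) - h • f' x v
        = (f (x - z + h • v) - f (x - z) - f' (x - z) (h • v)) + h • ((f' (x - z) - f' x) v) := by
      rw [map_smul, sub_apply, smul_sub]; abel
    rw [Pi.sub_apply, e]
    have h2 := htaylor (x - z) (h • v)
    have h3 : ‖h • ((f' (x - z) - f' x) v)‖ ≤ h * (Λ * ‖z‖ * ‖v‖) := by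
      rw [norm_smul, Real.norm_of_nonneg hh.le]
      gcongr
      refine (ContinuousLinearMap.le_opNorm _ _).trans ?_
      gcongr
      have := hf' (x - z) x
      rwa [sub_sub_cancel_left, norm_neg] at this
    rw [norm_smul, Real.norm_of_nonneg hh.le] at h2
    refine (norm_add_le _ _).trans ((add_le_add h2 h3).trans (le_of_eq ?_))
    ring
  · have hs : h ≤ √h := by
      rw [Real.le_sqrt hh.le hh.le]
      nlinarith
    have hs0 := Real.sqrt_nonneg h
    have h4 : Λ * h ^ 2 * ‖v‖ ^ 2 ≤ Λ * ‖v‖ ^ 2 * (6 * gaussConst n) * (h * √h) := by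
      have : h ^ 2 ≤ (6 * gaussConst n) * (h * √h) := by
        have : h ^ 2 ≤ h * √h := by nlinarith
        have : 0 ≤ h * √h := by positivity
        nlinarith
      calc Λ * h ^ 2 * ‖v‖ ^ 2 = Λ * ‖v‖ ^ 2 * h ^ 2 := by ring
        _ ≤ Λ * ‖v‖ ^ 2 * ((6 * gaussConst n) * (h * √h)) := by gcongr
        _ = _ := by ring
    rw [zero_mul, add_zero]
    refine (add_le_add h4 le_rfl).trans (le_of_eq ?_)
    ring

omit [CompleteSpace V] in
theorem norm_taylor_le {f : E n → V} {f' : E n → E n →L[ℝ] V} (hd : ∀ x, HasFDerivAt f (f' x) x)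
    {Λ : ℝ} (hΛ : 0 ≤ Λ) (hf' : ∀ x y, ‖f' x - f' y‖ ≤ Λ * ‖x - y‖) (x z : E n) :
    ‖f (x + z) - f x - f' x z‖ ≤ Λ * ‖z‖ ^ 2 := by
  have := (convex_closedBall x ‖z‖).norm_image_sub_le_of_norm_hasFDerivWithin_le' (φ := f' x)
    (C := Λ * ‖z‖) (f := f) (f' := f') (fun y _ => (hd y).hasFDerivWithinAt)
    (fun y hy => (hf' y x).trans (by
      gcongr
      rwa [← dist_eq_norm]))
    (x := x) (y := x + z) (by simp) (by simp)
  rw [add_sub_cancel_left] at this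
  refine this.trans (le_of_eq (by ring))

end SecondOrder

/-! ### Time regularity of the component driven by the heat kernel -/

section HeatDriven

variable {n : ℕ} {ι : Type} [Fintype ι] {V : Type} [NormedAddCommGroup V] [NormedSpace ℝ V]
  {W : Type} [NormedAddCommGroup W] [NormedSpace ℝ W]

/-- The equation for the component `π w` of a solution `w` only involves the kernel with index
`α₀`, and this is a multiple of the heat kernel. -/
structure HeatDriven (K : ι → ℝ → E n → ℝ) (N : ι → V → V) (α₀ : ι) (c : ℝ) (π : V →L[ℝ] W) :
    Prop where
  kernel : ∀ t x, K α₀ t x = c * heatKernel t x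
  proj : ∀ α, α ≠ α₀ → ∀ v, π (N α v) = 0

variable {K : ι → ℝ → E n → ℝ} {N : ι → V → V} {α₀ : ι} {c : ℝ} {π : V →L[ℝ] W}

omit [Fintype ι] in
-- If π ∘ N_α vanishes identically, so does its derivative. The structure therefore passes to the
-- derivative system and supports induction on the order.
theorem HeatDriven.partialProj (h : HeatDriven K N α₀ c π)
    (hN : ∀ α, ContDiff ℝ (⊤ : ℕ∞) (N α)) (i : Fin n) :
    HeatDriven K (derivNonlin (n := n) N) α₀ c (partialProj π i) := by
  refine ⟨h.kernel, fun α hα v => ?_⟩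
  have h1 : (fun v => π (N α v)) = fun _ => 0 := funext fun v => h.proj α hα v
  have h2 : HasFDerivAt (fun v => π (N α v)) (π ∘L fderiv ℝ (N α) v.1) v.1 :=
    π.hasFDerivAt.comp v.1 ((hN α).differentiable (by simp)).differentiableAt.hasFDerivAt
  rw [h1] at h2
  have h3 := h2.unique (hasFDerivAt_const (0 : W) v.1)
  have h4 := DFunLike.congr_fun h3 (v.2 (e i))
  simpa [LiquidCrystal.partialProj, derivNonlin] using h4

variable [FiniteDimensional ℝ V] [CompleteSpace W] {b T₀ a T : ℝ} {w : ℝ → E n → V}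

theorem HeatDriven.proj_sum_conv (h : HeatDriven K N α₀ c π) (hK : KernelFamily K b T₀) {M : ℝ}
    {F : E n → V} (hB : ∀ α, BddMeas M fun (_ : ℝ) y => N α (F y)) {r : ℝ} (hr : 0 < r) (x : E n) :
    π (∑ α, conv (K α r) (fun y => N α (F y)) x) = c • heat r (fun y => π (N α₀ (F y))) x := by
  have := FiniteDimensional.complete ℝ V
  rw [map_sum, Finset.sum_eq_single α₀]
  · rw [clm_conv π (hK.integrable α₀ r hr) ((hB α₀).slice 0).aestronglyMeasurable
      (Eventually.of_forall ((hB α₀).bound 0)), heat_of_pos hr]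
    unfold conv
    rw [← integral_smul]
    simp_rw [h.kernel, smul_smul]
  · intro α _ hα
    rw [clm_conv π (hK.integrable α r hr) ((hB α).slice 0).aestronglyMeasurable
      (Eventually.of_forall ((hB α).bound 0))]
    simp_rw [h.proj α hα]
    simp [conv]
  · simp

theorem IsSol.proj_eq (hw : IsSol K N a T w) (hK : KernelFamily K b T₀)
    (hN : ∀ α, Continuous (N α)) (h : HeatDriven K N α₀ c π) (hT : T - a ≤ T₀) {t : ℝ}
    (ht : t ∈ Ioc a T) (x : E n) :
    IntervalIntegrable (fun s => c • heat (t - s) (fun y => π (N α₀ (w s y))) x) volume a t ∧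
    π (w t x) = heat (t - a) (fun y => π (w a y)) x
      + ∫ s in a..t, c • heat (t - s) (fun y => π (N α₀ (w s y))) x := by
  have := FiniteDimensional.complete ℝ V
  obtain ⟨M, hM⟩ := hw.bddMeas
  obtain ⟨B, hB⟩ := hM.comp hN
  have hI := hK.intervalIntegrable hB ht.1.le (by linarith [ht.2]) x
  have heq : ∀ᵐ s : ℝ, s ∈ uIoc a t →
      π (∑ α, conv (K α (t - s)) (fun y => N α (w s y)) x)
        = c • heat (t - s) (fun y => π (N α₀ (w s y))) x := by
    have h' : ∀ᵐ s : ℝ, s ≠ t := by simp [ae_iff, measure_singleton]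
    filter_upwards [h'] with s hs hs'
    rw [uIoc_of_le ht.1.le] at hs'
    exact h.proj_sum_conv hK (M := B) (fun α => ⟨((hB α).slice s).comp_measurable measurable_snd,
      fun _ y => (hB α).bound s y⟩) (sub_pos.2 (lt_of_le_of_ne hs'.2 hs)) x
  constructor
  · have h1 : IntervalIntegrable (fun s => π (∑ α, conv (K α (t - s)) (fun y => N α (w s y)) x))
        volume a t := ⟨π.integrable_comp hI.1, π.integrable_comp hI.2⟩
    refine h1.congr_ae ?_
    rw [Filter.EventuallyEq, ae_restrict_iff' measurableSet_uIoc]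
    exact heq
  · rw [hw.eq t ht x, map_add]
    congr 1
    · simp only [heat_of_pos (sub_pos.2 ht.1)]
      exact clm_conv π (integrable_heatKernel (sub_pos.2 ht.1)) (hM.slice a).aestronglyMeasurable
        (Eventually.of_forall (hM.bound a)) x
    · unfold duhamel
      rw [← π.intervalIntegral_comp_comm hI]
      exact intervalIntegral.integral_congr_ae heq

/-- Uniform second order regularity in space of a solution away from the initial time. -/
theorem IsSol.exists_fderiv_lipschitz (hK : KernelFamily K b T₀)
    (hN : ∀ α, ContDiff ℝ (⊤ : ℕ∞) (N α)) (hw : IsSol K N a T w) (hT : T - a ≤ T₀) {δ : ℝ}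
    (haδ : a < δ) :
    ∃ Λ, 0 ≤ Λ ∧ ∀ t ∈ Icc δ T, (∀ x, HasFDerivAt (w t) (fderiv ℝ (w t) x) x) ∧
      (∀ x y, ‖fderiv ℝ (w t) x - fderiv ℝ (w t) y‖ ≤ Λ * ‖x - y‖) ∧
      (∀ x, ‖fderiv ℝ (w t) x‖ ≤ Λ) := by
  rcases lt_or_ge T δ with hTδ | hδT
  · exact ⟨0, le_rfl, fun t ht => absurd (ht.1.trans ht.2) (not_le.2 hTδ)⟩
  obtain ⟨δ', haδ', hδ'⟩ := exists_between haδ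
  have hδ'T := hδ'.le.trans hδT
  have hw' := hw.isSol_derivSol hK hN hT haδ' hδ'T
  obtain ⟨Λ, hΛ, hlip⟩ := hw'.lipschitz hK (contDiff_derivNonlin (n := n) hN) (by linarith) hδ'
  obtain ⟨M, hM⟩ := hw'.bddMeas
  refine ⟨max Λ M, le_max_of_le_left hΛ, fun t ht => ⟨fun x => ?_, fun x y => ?_, fun x => ?_⟩⟩
  · have := hw.hasFDerivAt' hK hN hT haδ' (t := t) ⟨hδ'.trans_le ht.1, ht.2⟩ x
    exact this.differentiableAt.hasFDerivAt
  · have := hlip t ht x y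
    rw [derivSol_of_mem ⟨hδ'.le.trans ht.1, ht.2⟩, derivSol_of_mem ⟨hδ'.le.trans ht.1, ht.2⟩] at this
    refine (norm_snd_le (_ - _)).trans (this.trans ?_)
    gcongr
    exact le_max_left _ _
  · have := hM.bound t x
    rw [derivSol_of_mem ⟨hδ'.le.trans ht.1, ht.2⟩] at this
    exact (norm_snd_le _).trans (this.trans (le_max_right _ _))

/-- The heat kernel has mass one at all times, so the Duhamel term is O(|t - s|) without a
singularity. Two bounded spatial derivatives make the motion by the heat flow O(|t - s|) as well. -/
theorem IsSol.norm_proj_sub_le (hK : KernelFamily K b T₀) (hN : ∀ α, ContDiff ℝ (⊤ : ℕ∞) (N α))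
    (hw : IsSol K N a T w) (h : HeatDriven K N α₀ c π) (hT : T - a ≤ T₀) {δ : ℝ} (haδ : a < δ) :
    ∃ Γ, 0 ≤ Γ ∧ ∀ s ∈ Icc δ T, ∀ t ∈ Icc δ T, ∀ x, ‖π (w t x) - π (w s x)‖ ≤ Γ * |t - s| := by
  have hNc : ∀ α, Continuous (N α) := fun α => (hN α).continuous
  obtain ⟨M, hM⟩ := hw.bddMeas
  obtain ⟨B, hB⟩ := hM.comp hNc
  obtain ⟨Λ, hΛ, hΛ'⟩ := hw.exists_fderiv_lipschitz hK hN hT haδ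
  have hg := one_le_gaussConst n
  have hB0 : 0 ≤ B := (norm_nonneg _).trans ((hB α₀).bound 0 0)
  have main : ∀ s ∈ Icc δ T, ∀ t ∈ Icc δ T, s ≤ t → ∀ x, ‖π (w t x) - π (w s x)‖
      ≤ (‖π‖ * Λ * (16 * gaussConst n) + |c| * (‖π‖ * B)) * |t - s| := by
    intro s hs t ht hst x
    rcases hst.eq_or_lt with rfl | hst'
    · simp
    have hws := hw.restart hK hNc hT (haδ.le.trans hs.1)
    rw [(hws.proj_eq hK hNc h (by linarith [hs.1]) ⟨hst', ht.2⟩ x).2, add_sub_right_comm,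
      abs_of_nonneg (sub_nonneg.2 hst)]
    have h1 := norm_heat_sub_self_le_of_taylor (sub_nonneg.2 hst)
      (f := fun y => π (w s y)) (π.continuous.comp_aestronglyMeasurable
        (hM.slice s).aestronglyMeasurable) (M := ‖π‖ * M) (fun y => (π.le_opNorm _).trans
        (by gcongr; exact hM.bound s y)) (Λ := ‖π‖ * Λ) (by positivity) (x := x)
      (L := π ∘L fderiv ℝ (w s) x) (fun z => by
        have h2 := norm_taylor_le (hΛ' s hs).1 hΛ (hΛ' s hs).2.1 x z
        rw [ContinuousLinearMap.comp_apply, ← map_sub, ← map_sub]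
        refine (π.le_opNorm _).trans ?_
        rw [mul_assoc]
        gcongr)
    have h2 : ‖∫ r in s..t, c • heat (t - r) (fun y => π (N α₀ (w r y))) x‖
        ≤ |c| * (‖π‖ * B) * |t - s| := by
      refine intervalIntegral.norm_integral_le_of_norm_le_const fun r hr => ?_
      rw [uIoc_of_le hst] at hr
      rw [norm_smul, Real.norm_eq_abs]
      gcongr
      exact norm_heat_le (sub_nonneg.2 hr.2) (fun y => (π.le_opNorm _).trans
        (by gcongr; exact (hB α₀).bound r y)) x
    rw [abs_of_nonneg (sub_nonneg.2 hst)] at h2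
    refine (norm_add_le _ _).trans ((add_le_add h1 h2).trans (le_of_eq ?_))
    ring
  refine ⟨‖π‖ * Λ * (16 * gaussConst n) + |c| * (‖π‖ * B), by positivity,
    fun s hs t ht x => ?_⟩
  rcases le_total s t with h | h
  · exact main s hs t ht h x
  · rw [norm_sub_rev, abs_sub_comm]
    exact main t ht s hs h x

end HeatDriven

/-! ### Lipschitz continuity in time for all spatial derivatives -/

section LipschitzInTime

variable {n : ℕ} {ι : Type} [Fintype ι] {W : Type} [NormedAddCommGroup W] [NormedSpace ℝ W]
  [CompleteSpace W]

/-- The induction is that of `IsSol.sobolevBound_half`, with `IsSol.norm_proj_sub_le` as the base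
case and `HeatDriven.partialProj` carrying the hypothesis along. -/
theorem IsSol.sobolevBound_lip (k : ℕ) : ∀ {V : Type} [NormedAddCommGroup V] [NormedSpace ℝ V]
    [FiniteDimensional ℝ V] {K : ι → ℝ → E n → ℝ} {b T₀ : ℝ} {N : ι → V → V} {a T : ℝ}
    {w : ℝ → E n → V} {α₀ : ι} {c : ℝ} {π : V →L[ℝ] W} (_ : KernelFamily K b T₀)
    (_ : ∀ α, ContDiff ℝ (⊤ : ℕ∞) (N α)) (_ : IsSol K N a T w) (_ : HeatDriven K N α₀ c π)
    (_ : T - a ≤ T₀) {δ : ℝ} (_ : a < δ),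
    ∃ M : ℝ≥0, (∀ t ∈ Icc δ T, SobolevBound k (fun x => π (w t x)) M) ∧
      ∀ s ∈ Icc δ T, ∀ t ∈ Icc δ T, SobolevBound k (fun x => π (w t x) - π (w s x))
        (M * ENNReal.ofReal (|t - s| ^ (1 : ℝ))) := by
  induction k with
  | zero =>
    intro V _ _ _ K b T₀ N a T w α₀ c π hK hN hw hh hT δ haδ
    obtain ⟨M, hM⟩ := hw.bddMeas
    have hM0 : 0 ≤ M := (norm_nonneg _).trans (hM.bound 0 0)
    obtain ⟨Γ, hΓ, hlip⟩ := hw.norm_proj_sub_le hK hN hh hT haδ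
    have hm : ∀ t, StronglyMeasurable fun x => π (w t x) := fun t =>
      π.continuous.comp_stronglyMeasurable (hM.slice t)
    refine ⟨Real.toNNReal (‖π‖ * M + Γ), fun t ht => ?_, fun s hs t ht => ?_⟩
    · refine sobolevBound_zero (hm t).aestronglyMeasurable (Eventually.of_forall fun x => ?_)
      refine (π.le_opNorm _).trans ?_
      have := mul_le_mul_of_nonneg_left (hM.bound t x) (norm_nonneg π)
      linarith
    · refine (sobolevBound_zero ((hm t).sub (hm s)).aestronglyMeasurable
        (M := (‖π‖ * M + Γ) * |t - s| ^ (1 : ℝ))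
        (Eventually.of_forall fun x => ?_)).mono (le_of_eq ?_)
      · rw [Pi.sub_apply, Real.rpow_one]
        have h1 := hlip s hs t ht x
        have : 0 ≤ ‖π‖ * M * |t - s| := by positivity
        linarith
      · rw [ENNReal.ofReal_mul (by positivity)]; rfl
  | succ k ih =>
    intro V _ _ _ K b T₀ N a T w α₀ c π hK hN hw hh hT δ haδ
    rcases lt_or_ge T δ with h | hδT
    · exact ⟨0, fun t ht => absurd (ht.1.trans ht.2) (not_le.2 h),
        fun s hs => absurd (hs.1.trans hs.2) (not_le.2 h)⟩
    obtain ⟨δ', haδ', hδ'⟩ := exists_between haδ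
    obtain ⟨M₀, hM₀, hM₀'⟩ := ih hK hN hw hh hT haδ
    have hw' := hw.isSol_derivSol hK hN hT haδ' (hδ'.le.trans hδT)
    have hT' : T - δ' ≤ T₀ := by linarith
    have := fun i : Fin n => ih hK (contDiff_derivNonlin (n := n) hN) hw'
      (hh.partialProj hN i) hT' hδ'
    choose M hM hM' using this
    have hle0 : (M₀ : ℝ≥0∞) ≤ (M₀ + ∑ i, M i : ℝ≥0) := by exact_mod_cast le_self_add
    have hle : ∀ i, (M i : ℝ≥0∞) ≤ (M₀ + ∑ i, M i : ℝ≥0) := fun i => by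
      have := (Finset.single_le_sum (f := M) (fun _ _ => zero_le) (Finset.mem_univ i)).trans
        (le_add_self (b := M₀))
      exact_mod_cast this
    refine ⟨M₀ + ∑ i, M i, fun t ht => SobolevBound.succ
      (((hM₀ t ht).mono hle0).imp_zero) fun i => ?_, fun s hs t ht => SobolevBound.succ
      (((hM₀' s hs t ht).mono (mul_le_mul_left hle0 _)).imp_zero) fun i => ?_⟩
    · exact ⟨_, (hw.hasWeakPartial hK hN hT haδ' π i).1 t ⟨hδ'.trans_le ht.1, ht.2⟩,
        (hM i t ht).mono (hle i)⟩
    · exact ⟨_, (hw.hasWeakPartial hK hN hT haδ' π i).2 s ⟨hδ'.trans_le hs.1, hs.2⟩ t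
        ⟨hδ'.trans_le ht.1, ht.2⟩, (hM' i s hs t ht).mono (mul_le_mul_left (hle i) _)⟩

end LipschitzInTime

/-! ### The length of a solution of a harmonic map heat flow equation -/

section NormSq

variable {n : ℕ} {H : Type} [NormedAddCommGroup H] [InnerProductSpace ℝ H] [CompleteSpace H]

theorem sum_apply_smul_e (z : E n) : ∑ i, z i • e i = z := by
  have := (EuclideanSpace.basisFun (Fin n) ℝ).sum_repr z
  simpa [e] using this

omit [CompleteSpace H] in
theorem integral_heatKernel_mul_normSq {h : ℝ} (hh : 0 < h) (L : E n →L[ℝ] H) :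
    ∫ z : E n, heatKernel h z * ‖L z‖ ^ 2 = 2 * h * ∑ i, ‖L (e i)‖ ^ 2 := by
  have h1 : ∀ z : E n, heatKernel h z * ‖L z‖ ^ 2
      = ∑ i, ∑ j, inner ℝ (L (e i)) (L (e j)) * (z i * z j * heatKernel h z) := by
    intro z
    have h2 : L z = ∑ i, z i • L (e i) := by
      conv_lhs => rw [← sum_apply_smul_e z]
      simp
    rw [← real_inner_self_eq_norm_sq, h2, sum_inner, Finset.mul_sum]
    refine Finset.sum_congr rfl fun i _ => ?_
    rw [inner_sum, Finset.mul_sum]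
    refine Finset.sum_congr rfl fun j _ => ?_
    rw [real_inner_smul_left, real_inner_smul_right]
    ring
  have hint : ∀ i j, Integrable fun z : E n => z i * z j * heatKernel h z := by
    intro i j
    refine Integrable.mono' (integrable_norm_pow_mul_heatKernel (n := n) hh (k := 2) (by norm_num))
      (by
        have := continuous_heatKernel (n := n) h
        exact Continuous.aestronglyMeasurable (by fun_prop)) (Eventually.of_forall fun z => ?_)
    rw [norm_mul, norm_mul, Real.norm_of_nonneg (heatKernel_nonneg hh z), sq]
    have := heatKernel_nonneg hh z
    gcongr
    · exact abs_coord_le z i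
    · exact abs_coord_le z j
  simp_rw [h1]
  rw [integral_finsetSum _ fun i _ => integrable_finsetSum _ fun j _ => (hint i j).const_mul _,
    Finset.mul_sum]
  refine Finset.sum_congr rfl fun i _ => ?_
  rw [integral_finsetSum _ fun j _ => (hint i j).const_mul _]
  simp_rw [integral_const_mul, integral_coord_mul_coord_mul_heatKernel hh]
  simp [mul_comm]

/-- The variance identity for f under the probability density of the heat kernel, centred at f(x);
the last term corrects for the difference between f(x) and the mean. -/
theorem integral_heatKernel_mul_norm_sub_sq {h : ℝ} (hh : 0 < h) {f : E n → H}
    (hf : AEStronglyMeasurable f volume) {M : ℝ} (hM : ∀ y, ‖f y‖ ≤ M) (x : E n) :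
    ∫ z, heatKernel h z * ‖f (x - z) - f x‖ ^ 2
      = heat h (fun y => ‖f y‖ ^ 2) x - ‖heat h f x‖ ^ 2 + ‖heat h f x - f x‖ ^ 2 := by
  have hG := integrable_heatKernel (n := n) hh
  have hM0 : 0 ≤ M := (norm_nonneg _).trans (hM 0)
  have hfx := aestronglyMeasurable_comp_sub_left hf x
  have i1 : Integrable fun z => heatKernel h z * ‖f (x - z)‖ ^ 2 :=
    hG.mul_bdd (c := M ^ 2) (hfx.norm.pow 2) (Eventually.of_forall fun z => by
      rw [norm_pow, norm_norm]; gcongr; exact hM _)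
  have i2 : Integrable fun z => heatKernel h z • f (x - z) :=
    hG.smul_bdd M hfx (Eventually.of_forall fun z => hM _)
  have e1 : heat h (fun y => ‖f y‖ ^ 2) x = ∫ z, heatKernel h z * ‖f (x - z)‖ ^ 2 := by
    rw [heat_of_pos hh, conv_eq_integral_sub]; rfl
  have e2 : heat h f x = ∫ z, heatKernel h z • f (x - z) := by
    rw [heat_of_pos hh, conv_eq_integral_sub]
  have e3 : inner ℝ (f x) (heat h f x) = ∫ z, heatKernel h z * inner ℝ (f x) (f (x - z)) := by
    rw [e2, ← integral_inner i2]
    simp_rw [real_inner_smul_right]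
  have i3 : Integrable fun z => heatKernel h z * inner ℝ (f x) (f (x - z)) := by
    have := i2.const_inner (𝕜 := ℝ) (f x)
    simpa only [real_inner_smul_right] using this
  have e4 : ∀ z, heatKernel h z * ‖f (x - z) - f x‖ ^ 2 = heatKernel h z * ‖f (x - z)‖ ^ 2
      - 2 * (heatKernel h z * inner ℝ (f x) (f (x - z))) + heatKernel h z * ‖f x‖ ^ 2 := by
    intro z
    rw [norm_sub_sq_real, real_inner_comm]
    ring
  simp_rw [e4]
  have i4 : Integrable fun z => heatKernel h z * ‖f (x - z)‖ ^ 2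
      - 2 * (heatKernel h z * inner ℝ (f x) (f (x - z))) := i1.sub (i3.const_mul 2)
  rw [integral_add i4 (hG.mul_const _), integral_sub i1 (i3.const_mul 2), integral_const_mul,
    integral_mul_const, integral_heatKernel hh, ← e1, ← e3, norm_sub_sq_real, real_inner_comm]
  ring

/-- The discrete counterpart of Δ|f|² - 2f·Δf = 2|∇f|². The variance of f is that of its linear part
up to third moments, O(h^{3/2}), and the displacement of the mean enters squared, as O(h²). -/
theorem abs_heat_normSq_sub_le {h : ℝ} (hh : 0 < h) (h1 : h ≤ 1) {f : E n → H}
    (hf : AEStronglyMeasurable f volume) {M : ℝ} (hM : ∀ y, ‖f y‖ ≤ M) {Λ : ℝ} (hΛ : 0 ≤ Λ)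
    {x : E n} {L : E n →L[ℝ] H} (htaylor : ∀ z, ‖f (x + z) - f x - L z‖ ≤ Λ * ‖z‖ ^ 2)
    (hL : ‖L‖ ≤ Λ) (hlip : ∀ y, ‖f y - f x‖ ≤ Λ * ‖y - x‖) :
    |heat h (fun y => ‖f y‖ ^ 2) x - ‖heat h f x‖ ^ 2 - 2 * h * ∑ i, ‖L (e i)‖ ^ 2|
      ≤ ((Λ * (16 * gaussConst n)) ^ 2 + 2 * Λ ^ 2 * (48 * gaussConst n)) * (h * √h) := by
  have hg := one_le_gaussConst n
  have hG := integrable_heatKernel (n := n) hh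
  have hid := integral_heatKernel_mul_norm_sub_sq hh hf hM x
  have hr := norm_heat_sub_self_le_of_taylor hh.le hf hM hΛ htaylor
  have hsq : h ≤ √h := by
    rw [Real.le_sqrt hh.le hh.le]; nlinarith
  have hs0 := Real.sqrt_nonneg h
  have i3 := integrable_norm_pow_mul_heatKernel (n := n) hh (k := 3) (by norm_num)
  have b3 := integral_norm_pow_mul_heatKernel_le (n := n) hh (k := 3) (by norm_num)
  have hcubic : √(8 * h) ^ 3 ≤ 24 * (h * √h) := by
    have h8 : √(8 * h) ≤ 3 * √h := by
      rw [show 3 * √h = √(9 * h) by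
        rw [Real.sqrt_mul (by norm_num), show (9 : ℝ) = 3 ^ 2 by norm_num,
          Real.sqrt_sq (by norm_num)]]
      exact Real.sqrt_le_sqrt (by linarith)
    rw [pow_succ, Real.sq_sqrt (by positivity)]
    nlinarith
  have hpt : ∀ z, |‖f (x - z) - f x‖ ^ 2 - ‖L z‖ ^ 2| ≤ 2 * Λ ^ 2 * ‖z‖ ^ 3 := by
    intro z
    have p1 : ‖f (x - z) - f x‖ ≤ Λ * ‖z‖ := by simpa using hlip (x - z)
    have p2 : ‖L z‖ ≤ Λ * ‖z‖ := (L.le_opNorm z).trans (by gcongr)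
    have p3 : |‖f (x - z) - f x‖ - ‖L z‖| ≤ Λ * ‖z‖ ^ 2 := by
      have q := htaylor (-z)
      rw [map_neg, norm_neg, ← sub_eq_add_neg] at q
      have := abs_norm_sub_norm_le (f (x - z) - f x) (-L z)
      rw [norm_neg] at this
      exact this.trans q
    rw [sq_sub_sq, abs_mul, abs_of_nonneg (by positivity)]
    calc _ ≤ (Λ * ‖z‖ + Λ * ‖z‖) * (Λ * ‖z‖ ^ 2) := by gcongr
      _ = _ := by ring
  have hfx := aestronglyMeasurable_comp_sub_left hf x
  have hM0 : 0 ≤ M := (norm_nonneg _).trans (hM 0)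
  have j1 : Integrable fun z => heatKernel h z * ‖f (x - z) - f x‖ ^ 2 :=
    hG.mul_bdd (c := (M + M) ^ 2) ((hfx.sub aestronglyMeasurable_const).norm.pow 2)
      (Eventually.of_forall fun z => by
        rw [norm_pow, norm_norm]
        gcongr
        exact (norm_sub_le _ _).trans (add_le_add (hM _) (hM _)))
  have j2 : Integrable fun z : E n => heatKernel h z * ‖L z‖ ^ 2 := by
    refine Integrable.mono' ((integrable_norm_pow_mul_heatKernel (n := n) hh (k := 2)
      (by norm_num)).const_mul (‖L‖ ^ 2)) (by
        have := continuous_heatKernel (n := n) h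
        exact Continuous.aestronglyMeasurable (by fun_prop)) (Eventually.of_forall fun z => ?_)
    have hk := heatKernel_nonneg hh z
    rw [Real.norm_of_nonneg (by positivity)]
    calc heatKernel h z * ‖L z‖ ^ 2 ≤ heatKernel h z * (‖L‖ * ‖z‖) ^ 2 := by
          gcongr; exact L.le_opNorm z
      _ = _ := by ring
  have hdiff : |∫ z, (heatKernel h z * ‖f (x - z) - f x‖ ^ 2 - heatKernel h z * ‖L z‖ ^ 2)|
      ≤ 2 * Λ ^ 2 * (48 * gaussConst n) * (h * √h) := by
    rw [← Real.norm_eq_abs]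
    refine (norm_integral_le_of_norm_le (i3.const_mul (2 * Λ ^ 2))
      (Eventually.of_forall fun z => ?_)).trans ?_
    · rw [← mul_sub, norm_mul, Real.norm_of_nonneg (heatKernel_nonneg hh z), Real.norm_eq_abs]
      have := mul_le_mul_of_nonneg_left (hpt z) (heatKernel_nonneg hh z)
      linarith
    · rw [integral_const_mul]
      calc _ ≤ 2 * Λ ^ 2 * (2 * gaussConst n * (24 * (h * √h))) := by
            gcongr
            exact b3.trans (by gcongr)
        _ = _ := by ring
  rw [integral_sub j1 j2, hid, integral_heatKernel_mul_normSq hh] at hdiff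
  have hr2 : ‖heat h f x - f x‖ ^ 2 ≤ (Λ * (16 * gaussConst n)) ^ 2 * (h * √h) := by
    calc ‖heat h f x - f x‖ ^ 2 ≤ (Λ * (16 * gaussConst n * h)) ^ 2 := by gcongr
      _ = (Λ * (16 * gaussConst n)) ^ 2 * (h * h) := by ring
      _ ≤ _ := by gcongr
  have hr3 := sq_nonneg ‖heat h f x - f x‖
  rw [abs_le] at hdiff ⊢
  constructor <;> linarith [hdiff.1, hdiff.2]

set_option maxHeartbeats 400000 in
/-- A consistency estimate for one time step of length `h` of the equation
`d_t + (v · ∇) d = Δ d + |∇ d|² d`. -/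
theorem exists_abs_normSq_step_le (n : ℕ) {M Λ U R L₀ : ℝ} (hM0 : 0 ≤ M) (hΛ : 0 ≤ Λ) (hU : 0 ≤ U)
    (hR : 0 ≤ R) (hL₀ : 0 ≤ L₀) : ∃ C, 0 ≤ C ∧ ∀ (h : ℝ) (f : E n → H) (f' : E n → E n →L[ℝ] H)
      (x v : E n) (y : H) (S : ℝ), 0 < h → h ≤ 1 → (∀ y, ‖f y‖ ≤ M) →
      (∀ x, HasFDerivAt f (f' x) x) → (∀ x y, ‖f' x - f' y‖ ≤ Λ * ‖x - y‖) → (∀ x, ‖f' x‖ ≤ Λ) →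
      ‖v‖ ≤ U → ∑ i, ‖f' x (e i)‖ ^ 2 ≤ L₀ →
      ‖y - (heat h f x + h • ((∑ i, ‖f' x (e i)‖ ^ 2) • f x - f' x v))‖ ≤ R * (h * √h) →
      (∀ x, |‖f x‖ ^ 2 - 1| ≤ S) → |‖y‖ ^ 2 - 1| ≤ (1 + 2 * L₀ * h) * S + C * (h * √h) := by
  have hg := one_le_gaussConst n
  set g := gaussConst n
  set Φ := L₀ * M + Λ * U with hΦ
  have hΦ0 : 0 ≤ Φ := by positivity
  set Λ₂ := 2 * (Λ * Λ + M * Λ) with hΛ₂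
  have hΛ₂0 : 0 ≤ Λ₂ := by positivity
  -- Sources of error: c₁ the variance expansion, c₂ the transport shift, c₃ the replacement of the
  -- mean a by f(x) against the force, c₄ the remainder r against a, c₅ the square of the increment.
  obtain ⟨c₁, hc₁⟩ : ∃ c, c = (Λ * (16 * g)) ^ 2 + 2 * Λ ^ 2 * (48 * g) := ⟨_, rfl⟩
  obtain ⟨c₂, hc₂⟩ : ∃ c, c = Λ₂ * (U + U ^ 2) * (6 * g) := ⟨_, rfl⟩
  obtain ⟨c₃, hc₃⟩ : ∃ c, c = 2 * (Λ * (16 * g)) * Φ := ⟨_, rfl⟩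
  obtain ⟨c₄, hc₄⟩ : ∃ c, c = 2 * M * R := ⟨_, rfl⟩
  obtain ⟨c₅, hc₅⟩ : ∃ c, c = (Φ + R) ^ 2 := ⟨_, rfl⟩
  refine ⟨c₁ + c₂ + c₃ + c₄ + c₅, by rw [hc₁, hc₂, hc₃, hc₄, hc₅]; positivity,
    fun h f f' x v y S hh h1 hM hd hf' hfΛ hv hD hy hS => ?_⟩
  have hsq : h ≤ √h := by
    rw [Real.le_sqrt hh.le hh.le]; nlinarith
  have hs0 := Real.sqrt_nonneg h
  have hs1 : √h ≤ 1 := by rw [Real.sqrt_le_left (by norm_num)]; simpa using h1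
  have hf : Continuous f := continuous_iff_continuousAt.2 fun x => (hd x).continuousAt
  have hlip : ∀ x y, ‖f y - f x‖ ≤ Λ * ‖y - x‖ := fun x y =>
    convex_univ.norm_image_sub_le_of_norm_hasFDerivWithin_le
      (fun z _ => (hd z).hasFDerivWithinAt) (fun z _ => hfΛ z) (mem_univ x) (mem_univ y)
  have htay := norm_taylor_le hd hΛ hf'
  set a := heat h f x with ha
  set D := ∑ i, ‖f' x (e i)‖ ^ 2 with hDd
  have hD0 : 0 ≤ D := by positivity
  set F := D • f x - f' x v with hF
  have hFΦ : ‖F‖ ≤ Φ := by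
    refine (norm_sub_le _ _).trans (add_le_add ?_ ?_)
    · rw [norm_smul, Real.norm_of_nonneg hD0]; gcongr; exact hM x
    · refine ((f' x).le_opNorm v).trans ?_
      gcongr; exact hfΛ x
  have haM : ‖a‖ ≤ M := norm_heat_le hh.le hM x
  have har : ‖a - f x‖ ≤ Λ * (16 * g) * h := by
    have := norm_heat_sub_self_le_of_taylor hh.le hf.aestronglyMeasurable hM hΛ (htay x)
    rwa [← mul_assoc] at this
  have hvar := abs_heat_normSq_sub_le hh h1 hf.aestronglyMeasurable hM hΛ (htay x) (hfΛ x)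
    (fun y => hlip x y)
  -- the squared norm
  have hψd : ∀ x, HasFDerivAt (fun y => ‖f y‖ ^ 2) (2 • (innerSL ℝ (f x)).comp (f' x)) x :=
    fun x => (hd x).norm_sq
  have hψ' : ∀ x y, ‖(2 • (innerSL ℝ (f x)).comp (f' x) : E n →L[ℝ] ℝ)
      - 2 • (innerSL ℝ (f y)).comp (f' y)‖ ≤ Λ₂ * ‖x - y‖ := by
    intro x y
    refine ContinuousLinearMap.opNorm_le_bound _ (by positivity) fun z => ?_
    have e1 : ((2 • (innerSL ℝ (f x)).comp (f' x) : E n →L[ℝ] ℝ)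
      - 2 • (innerSL ℝ (f y)).comp (f' y)) z
      = 2 * (inner ℝ (f x - f y) (f' x z) + inner ℝ (f y) ((f' x - f' y) z)) := by
      simp [inner_sub_left, inner_sub_right]
      ring
    rw [e1, norm_mul, Real.norm_of_nonneg (by norm_num : (0 : ℝ) ≤ 2), hΛ₂]
    have q1 : ‖inner ℝ (f x - f y) (f' x z)‖ ≤ (Λ * ‖x - y‖) * (Λ * ‖z‖) :=
      (norm_inner_le_norm _ _).trans (mul_le_mul (hlip y x)
        (((f' x).le_opNorm z).trans (by gcongr; exact hfΛ x)) (norm_nonneg _) (by positivity))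
    have q2 : ‖inner ℝ (f y) ((f' x - f' y) z)‖ ≤ M * (Λ * ‖x - y‖ * ‖z‖) :=
      (norm_inner_le_norm _ _).trans (mul_le_mul (hM y)
        (((f' x - f' y).le_opNorm z).trans (by gcongr; exact hf' x y)) (norm_nonneg _) hM0)
    have := norm_add_le (inner ℝ (f x - f y) (f' x z)) (inner ℝ (f y) ((f' x - f' y) z))
    linarith
  have hψM : ∀ y, ‖‖f y‖ ^ 2‖ ≤ M ^ 2 := fun y => by
    rw [norm_pow, norm_norm]; gcongr; exact hM y
  have hψm : AEStronglyMeasurable (fun y => ‖f y‖ ^ 2) (volume : Measure (E n)) :=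
    (hf.norm.pow 2).aestronglyMeasurable
  -- The transport term is absorbed by evaluating e^{hΔ}|f|² at x - hv. As an average, this value
  -- differs from 1 by at most S, so no gradient of |f|² - 1 has to be estimated.
  have hshift := norm_heat_shift_sub_le hh h1 hψm hψM hΛ₂0 (norm_taylor_le hψd hΛ₂0 hψ') hψ' x (-v)
  have hshift' : ‖heat h (fun y => ‖f y‖ ^ 2) (x + h • -v)
      - (heat h (fun y => ‖f y‖ ^ 2) x - 2 * h * inner ℝ (f x) (f' x v))‖
      ≤ Λ₂ * (U + U ^ 2) * (6 * g) * (h * √h) := by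
    refine (le_of_eq ?_).trans (hshift.trans ?_)
    · congr 2
      simp
      ring
    · rw [norm_neg]
      gcongr
  have hρ : |heat h (fun y => ‖f y‖ ^ 2) (x + h • -v) - 1| ≤ S := by
    have h2 := norm_heat_sub_const_le hh hψm (Eventually.of_forall hψM) (x + h • -v) (1 : ℝ)
      (c₀ := S) (c₁ := 0) (c₂ := 0) le_rfl le_rfl (Eventually.of_forall fun z => by
        simpa using hS (x + h • -v - z))
    simpa using h2
  -- expansion of the new squared norm
  obtain ⟨r, hr⟩ : ∃ r, y = a + (h • F + r) := ⟨y - (a + h • F), by abel⟩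
  have hrR : ‖r‖ ≤ R * (h * √h) := by
    have : r = y - (a + h • F) := by rw [hr]; abel
    rw [this]; exact hy
  have hexp : ‖y‖ ^ 2 = ‖a‖ ^ 2 + 2 * h * inner ℝ (f x) F + 2 * h * inner ℝ (a - f x) F
      + 2 * inner ℝ a r + ‖h • F + r‖ ^ 2 := by
    rw [hr, norm_add_sq_real, inner_add_right, real_inner_smul_right, inner_sub_left]
    ring
  have hfF : inner ℝ (f x) F = D * ‖f x‖ ^ 2 - inner ℝ (f x) (f' x v) := by
    rw [hF, inner_sub_right, real_inner_smul_right, real_inner_self_eq_norm_sq]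
  have t1 : |2 * h * inner ℝ (a - f x) F| ≤ 2 * (Λ * (16 * g)) * Φ * (h * √h) := by
    rw [abs_mul, abs_of_nonneg (by positivity)]
    calc 2 * h * |inner ℝ (a - f x) F| ≤ 2 * h * ((Λ * (16 * g) * h) * Φ) := by
          gcongr
          exact (abs_real_inner_le_norm _ _).trans (by gcongr)
      _ = 2 * (Λ * (16 * g)) * Φ * (h * h) := by ring
      _ ≤ _ := by gcongr
  have t2 : |2 * inner ℝ a r| ≤ 2 * M * R * (h * √h) := by
    rw [abs_mul, abs_of_nonneg (by positivity)]
    calc 2 * |inner ℝ a r| ≤ 2 * (M * (R * (h * √h))) := by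
          gcongr
          exact (abs_real_inner_le_norm _ _).trans (by gcongr)
      _ = _ := by ring
  have t3 : ‖h • F + r‖ ^ 2 ≤ (Φ + R) ^ 2 * (h * √h) := by
    have : ‖h • F + r‖ ≤ (Φ + R) * h := by
      refine (norm_add_le _ _).trans ?_
      rw [norm_smul, Real.norm_of_nonneg hh.le, add_mul]
      refine add_le_add (by rw [mul_comm]; gcongr) (hrR.trans ?_)
      gcongr
      exact mul_le_of_le_one_right hh.le hs1
    calc _ ≤ ((Φ + R) * h) ^ 2 := by gcongr
      _ = (Φ + R) ^ 2 * (h * h) := by ring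
      _ ≤ _ := by gcongr
  have t4 : |2 * h * D * (‖f x‖ ^ 2 - 1)| ≤ 2 * L₀ * h * S := by
    rw [abs_mul, abs_of_nonneg (by positivity)]
    calc 2 * h * D * |‖f x‖ ^ 2 - 1| ≤ 2 * h * L₀ * S := by
          gcongr
          exact hS x
      _ = _ := by ring
  have t5 : 0 ≤ ‖h • F + r‖ ^ 2 := by positivity
  have t6 : 0 ≤ c₅ * (h * √h) := t5.trans (hc₅ ▸ t3)
  rw [Real.norm_eq_abs] at hshift'
  rw [← hc₁] at hvar
  rw [← hc₂] at hshift'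
  rw [← hc₃] at t1
  rw [← hc₄] at t2
  rw [← hc₅] at t3
  clear hc₁ hc₂ hc₃ hc₄ hc₅
  rw [abs_le] at hvar hshift' hρ t1 t2 t4 ⊢
  obtain ⟨v1, v2⟩ := hvar
  obtain ⟨s1, s2⟩ := hshift'
  have hS0 : (1 + 2 * L₀ * h) * S = S + 2 * L₀ * h * S := by ring
  have hC : (c₁ + c₂ + c₃ + c₄ + c₅) * (h * √h) = c₁ * (h * √h) + c₂ * (h * √h) + c₃ * (h * √h)
    + c₄ * (h * √h) + c₅ * (h * √h) := by ring
  -- The term 2hD cancels the variance -2hD of the heat step. What remains is the shift, and the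
  -- reaction 2hD(|f|² - 1), which causes the growth factor 1 + 2L₀h.
  have hD' : 2 * h * (D * ‖f x‖ ^ 2 - inner ℝ (f x) (f' x v))
      = 2 * h * D * (‖f x‖ ^ 2 - 1) + 2 * h * D - 2 * h * inner ℝ (f x) (f' x v) := by ring
  rw [hexp, hfF, hS0, hC, hD']
  generalize c₁ * (h * √h) = q₁ at *
  generalize c₂ * (h * √h) = q₂ at *
  generalize c₃ * (h * √h) = q₃ at *
  generalize c₄ * (h * √h) = q₄ at *
  generalize c₅ * (h * √h) = q₅ at *
  constructor
  · linarith [hρ.1, t1.1, t2.1, t4.1]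
  · linarith [hρ.2, t1.2, t2.2, t4.2]

end NormSq

/-! ### Propagation of the unit length by small time steps -/

section SphereConstraint

variable {n : ℕ} {ι : Type} [Fintype ι] {V : Type} [NormedAddCommGroup V] [NormedSpace ℝ V]
  {H : Type} [NormedAddCommGroup H] [InnerProductSpace ℝ H] [CompleteSpace H]
  {K : ι → ℝ → E n → ℝ} {N : ι → V → V} {α₀ : ι} {c : ℝ}

/-- A discrete Gronwall inequality with an error of order `3/2` in the step size. -/
theorem le_exp_mul_of_step_le {L C a t : ℝ} (hL : 0 ≤ L) (hC : 0 ≤ C) (hat : a ≤ t)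
    {P : ℝ → ℝ → Prop}
    (hstep : ∀ s h S, a ≤ s → 0 < h → h ≤ 1 → s + h ≤ t → P s S →
      P (s + h) ((1 + L * h) * S + C * (h * √h))) {S₀ : ℝ} (hS₀ : 0 ≤ S₀) (h0 : P a S₀) :
    ∀ ε > 0, ∃ S, P t S ∧ S ≤ Real.exp (L * (t - a)) * S₀ + ε := by
  intro ε hε
  rcases hat.eq_or_lt with rfl | hat
  · exact ⟨S₀, h0, by simp; exact hε.le⟩
  have hta : 0 < t - a := sub_pos.2 hat
  have hlim : Tendsto (fun k : ℕ => Real.exp (L * (t - a)) * ((t - a) * C * √((t - a) / (k + 1 : ℝ))))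
      atTop (𝓝 (Real.exp (L * (t - a)) * ((t - a) * C * √0))) := by
    have h1 : Tendsto (fun k : ℕ => (t - a) / ((k : ℝ) + 1)) atTop (𝓝 0) :=
      by
      simpa [div_eq_mul_inv] using tendsto_one_div_add_atTop_nhds_zero_nat.const_mul (t - a)
    exact (((Real.continuous_sqrt.tendsto 0).comp h1).const_mul _).const_mul _
  rw [Real.sqrt_zero, mul_zero, mul_zero] at hlim
  have hlim2 : Tendsto (fun k : ℕ => (t - a) / ((k : ℝ) + 1)) atTop (𝓝 0) :=
      by
      simpa [div_eq_mul_inv] using tendsto_one_div_add_atTop_nhds_zero_nat.const_mul (t - a)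
  -- With k + 1 steps of length h the errors C h^{3/2} add up to (t - a)C√h, times the exponential
  -- factor; k is chosen to make this less than ε and h less than one.
  obtain ⟨k, hk1, hk2⟩ := ((hlim.eventually_lt_const hε).and
    (hlim2.eventually_lt_const one_pos)).exists
  set h := (t - a) / ((k : ℝ) + 1) with hh
  have hh0 : 0 < h := by positivity
  have hkh : ((k : ℝ) + 1) * h = t - a := by rw [hh]; field_simp
  have key : ∀ j : ℕ, j ≤ k + 1 → ∃ S, 0 ≤ S ∧ P (a + j * h) S ∧
      S ≤ Real.exp (L * (j * h)) * (S₀ + j * (C * (h * √h))) := by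
    intro j
    induction j with
    | zero => intro _; exact ⟨S₀, hS₀, by simpa using h0, by simp⟩
    | succ j ih =>
      intro hj
      obtain ⟨S, hS, hPS, hle⟩ := ih (by omega)
      have hjk : ((j : ℝ) + 1) ≤ k + 1 := by exact_mod_cast hj
      have e1 : a + ((j + 1 : ℕ) : ℝ) * h = a + j * h + h := by push_cast; ring
      refine ⟨(1 + L * h) * S + C * (h * √h), by positivity, ?_, ?_⟩
      · rw [e1]
        refine hstep _ _ _ (by nlinarith [(Nat.cast_nonneg j : (0 : ℝ) ≤ j)]) hh0 hk2.le ?_ hPS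
        have : ((j : ℝ) + 1) * h ≤ (k + 1) * h := by gcongr
        linarith
      · have hexp : 1 + L * h ≤ Real.exp (L * h) := by
          have := Real.add_one_le_exp (L * h); linarith
        have h1 : 1 ≤ Real.exp (L * (((j + 1 : ℕ) : ℝ) * h)) := Real.one_le_exp (by positivity)
        have hX : 0 ≤ C * (h * √h) := by positivity
        calc (1 + L * h) * S + C * (h * √h)
            ≤ Real.exp (L * h) * (Real.exp (L * (j * h)) * (S₀ + j * (C * (h * √h))))
              + Real.exp (L * (((j + 1 : ℕ) : ℝ) * h)) * (C * (h * √h)) := by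
              refine add_le_add (by gcongr) (le_mul_of_one_le_left hX h1)
          _ = _ := by
              rw [← mul_assoc, ← Real.exp_add, show L * h + L * (j * h)
                = L * (((j + 1 : ℕ) : ℝ) * h) by push_cast; ring]
              push_cast
              ring
  obtain ⟨S, -, hPS, hle⟩ := key (k + 1) le_rfl
  push_cast at hPS hle
  rw [hkh] at hle
  rw [hkh, add_sub_cancel] at hPS
  refine ⟨S, hPS, hle.trans ?_⟩
  have e2 : ((k : ℝ) + 1) * (C * (h * √h)) = (t - a) * C * √h := by rw [← hkh]; ring
  rw [e2, mul_add]
  gcongr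

variable [FiniteDimensional ℝ V] {π : V →L[ℝ] H} {b T₀ a T : ℝ} {w : ℝ → E n → V}

/-- The force is frozen at time s and at the point x. The heat flow moves the Lipschitz force by
O(√h), its variation in time is O(√h), and integration over a step of length h gives O(h^{3/2}). -/
theorem IsSol.norm_proj_sub_heat_le (hK : KernelFamily K b T₀)
    (hN : ∀ α, ContDiff ℝ (⊤ : ℕ∞) (N α)) (hw : IsSol K N a T w) (hh : HeatDriven K N α₀ c π)
    (hT : T - a ≤ T₀) {δ : ℝ} (haδ : a < δ) :
    ∃ R, 0 ≤ R ∧ ∀ s h, δ ≤ s → 0 < h → s + h ≤ T → ∀ x,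
      ‖π (w (s + h) x) - (heat h (fun y => π (w s y)) x + h • (c • π (N α₀ (w s x))))‖
        ≤ R * (h * √h) := by
  have hNc : ∀ α, Continuous (N α) := fun α => (hN α).continuous
  obtain ⟨M, hM⟩ := hw.bddMeas
  obtain ⟨B, hB⟩ := hM.comp hNc
  obtain ⟨L, hL, hLip⟩ := exists_lipschitz_of_contDiff hN M
  obtain ⟨Λ, hΛ, hlip⟩ := hw.lipschitz hK hN hT haδ
  obtain ⟨Θ, hΘ, hhol⟩ := hw.norm_sub_le_sqrt hK hNc hT haδ.le hΛ hlip
  have hg := one_le_gaussConst n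
  refine ⟨|c| * (‖π‖ * (L * Λ) * (6 * gaussConst n) + ‖π‖ * (L * Θ)), by positivity,
    fun s h hs hh0 hsT x => ?_⟩
  have hsI : s ∈ Icc δ T := ⟨hs, by linarith⟩
  have hws := hw.restart hK hNc hT (haδ.le.trans hs)
  obtain ⟨hI, he⟩ := hws.proj_eq hK hNc hh (by linarith [hsI.1]) (t := s + h)
    ⟨by linarith, hsT⟩ x
  have hconst : h • (c • π (N α₀ (w s x))) = ∫ _ in s..s + h, c • π (N α₀ (w s x)) := by
    rw [intervalIntegral.integral_const, add_sub_cancel_left]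
  rw [he, add_sub_cancel_left, add_sub_add_left_eq_sub, hconst,
    ← intervalIntegral.integral_sub hI (by simp)]
  have hbd : ∀ r ∈ uIoc s (s + h), ‖c • heat (s + h - r) (fun y => π (N α₀ (w r y))) x
      - c • π (N α₀ (w s x))‖
      ≤ |c| * (‖π‖ * (L * Λ) * (6 * gaussConst n) + ‖π‖ * (L * Θ)) * √h := by
    intro r hr
    rw [uIoc_of_le (by linarith)] at hr
    have hrI : r ∈ Icc δ T := ⟨hs.trans hr.1.le, hr.2.trans hsT⟩
    rw [← smul_sub, norm_smul, Real.norm_eq_abs, mul_assoc]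
    gcongr
    have h1 := norm_heat_sub_self_le (h := s + h - r) (sub_nonneg.2 hr.2)
      (f := fun y => π (N α₀ (w r y))) (x := x) (M := ‖π‖ * B) (Λ := ‖π‖ * (L * Λ))
      (π.continuous.comp_aestronglyMeasurable ((hB α₀).slice r).aestronglyMeasurable)
      (Eventually.of_forall fun y => (π.le_opNorm _).trans
        (by gcongr; exact (hB α₀).bound r y)) (by positivity)
      (Eventually.of_forall fun y => by
        rw [← map_sub]
        refine (π.le_opNorm _).trans ?_
        rw [mul_assoc, mul_assoc]
        gcongr
        exact (hLip α₀ _ _ (hM.bound r y) (hM.bound r x)).trans (by gcongr; exact hlip r hrI y x))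
    have h2 : ‖π (N α₀ (w r x)) - π (N α₀ (w s x))‖ ≤ ‖π‖ * (L * (Θ * √|r - s|)) := by
      rw [← map_sub]
      refine (π.le_opNorm _).trans ?_
      gcongr
      exact (hLip α₀ _ _ (hM.bound r x) (hM.bound s x)).trans
        (by gcongr; exact hhol s hsI r hrI x)
    have h3 : √(s + h - r) ≤ √h := Real.sqrt_le_sqrt (by linarith [hr.1])
    have h4 : √|r - s| ≤ √h := by
      rw [abs_of_pos (sub_pos.2 hr.1)]
      exact Real.sqrt_le_sqrt (by linarith [hr.2])
    calc _ ≤ _ := norm_sub_le_norm_sub_add_norm_sub _ (π (N α₀ (w r x))) _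
      _ ≤ ‖π‖ * (L * Λ) * (6 * gaussConst n * √(s + h - r)) + ‖π‖ * (L * (Θ * √|r - s|)) :=
        add_le_add h1 h2
      _ ≤ ‖π‖ * (L * Λ) * (6 * gaussConst n * √h) + ‖π‖ * (L * (Θ * √h)) := by gcongr
      _ = _ := by ring
  refine (intervalIntegral.norm_integral_le_of_norm_le_const hbd).trans (le_of_eq ?_)
  rw [add_sub_cancel_left, abs_of_pos hh0]
  ring

/-- A solution of `d_t + (v · ∇) d = Δ d + |∇ d|² d` stays close to the unit sphere. -/
theorem IsSol.abs_normSq_sub_one_le (hK : KernelFamily K b T₀)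
    (hN : ∀ α, ContDiff ℝ (⊤ : ℕ∞) (N α)) (hw : IsSol K N a T w) (hh : HeatDriven K N α₀ c π)
    (hT : T - a ≤ T₀) {v : ℝ → E n → E n} {U L₀ : ℝ} (hU : 0 ≤ U) (hL₀ : 0 ≤ L₀)
    (hv : ∀ t x, ‖v t x‖ ≤ U)
    (hforce : ∀ t ∈ Ioc a T, ∀ x, c • π (N α₀ (w t x))
      = (∑ i, ‖π (fderiv ℝ (w t) x (e i))‖ ^ 2) • π (w t x) - π (fderiv ℝ (w t) x (v t x)))
    (hD : ∀ t ∈ Ioc a T, ∀ x, ∑ i, ‖π (fderiv ℝ (w t) x (e i))‖ ^ 2 ≤ L₀)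
    {δ t : ℝ} (haδ : a < δ) (hδt : δ ≤ t) (htT : t ≤ T) {S : ℝ} (hS0 : 0 ≤ S)
    (hS : ∀ x, |‖π (w δ x)‖ ^ 2 - 1| ≤ S) (x : E n) :
    |‖π (w t x)‖ ^ 2 - 1| ≤ Real.exp (2 * L₀ * (t - δ)) * S := by
  obtain ⟨M, hM⟩ := hw.bddMeas
  have hM0 : 0 ≤ M := (norm_nonneg _).trans (hM.bound 0 0)
  obtain ⟨R, hR, hR'⟩ := hw.norm_proj_sub_heat_le hK hN hh hT haδ
  obtain ⟨Λ, hΛ, hΛ'⟩ := hw.exists_fderiv_lipschitz hK hN hT haδ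
  obtain ⟨C, hC, hC'⟩ := exists_abs_normSq_step_le (H := H) n (M := ‖π‖ * M) (Λ := ‖π‖ * Λ)
    (by positivity) (by positivity) hU hR hL₀
  refine le_of_forall_pos_le_add fun ε hε => ?_
  obtain ⟨S', hS', hle⟩ := le_exp_mul_of_step_le (L := 2 * L₀) (C := C) (a := δ) (t := t)
    (by positivity) hC hδt (P := fun s S => ∀ x, |‖π (w s x)‖ ^ 2 - 1| ≤ S)
    (fun s h S hs hh0 hh1 hst hPS x => by
      have hsI : s ∈ Icc δ T := ⟨hs, by linarith⟩
      have hsI' : s ∈ Ioc a T := ⟨haδ.trans_le hs, hsI.2⟩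
      obtain ⟨hd, hd', hdb⟩ := hΛ' s hsI
      refine hC' h (fun y => π (w s y)) (fun y => π ∘L fderiv ℝ (w s) y) x (v s x)
        (π (w (s + h) x)) S hh0 hh1 (fun y => (π.le_opNorm _).trans (by gcongr; exact hM.bound s y))
        (fun y => π.hasFDerivAt.comp y (hd y)) (fun y z => ?_) (fun y => ?_) (hv s x)
        (hD s hsI' x) ?_ hPS
      · rw [← ContinuousLinearMap.comp_sub, mul_assoc]
        exact (ContinuousLinearMap.opNorm_comp_le _ _).trans (by gcongr; exact hd' y z)
      · exact (ContinuousLinearMap.opNorm_comp_le _ _).trans (by gcongr; exact hdb y)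
      · have := hR' s h hs hh0 (hst.trans htT) x
        rw [hforce s hsI' x] at this
        exact this) hS0 hS ε hε
  exact (hS' x).trans hle

end SphereConstraint

/-! ### Weak derivatives of convolutions and mollification -/

section Mollification

variable {n : ℕ} {V : Type} [NormedAddCommGroup V] [NormedSpace ℝ V]

theorem conv_comm [CompleteSpace V] {g k : E n → ℝ} (hg : Integrable g) (hk : Integrable k)
    {f : E n → V} (hf : AEStronglyMeasurable f volume) {M : ℝ} (hM : ∀ᵐ y, ‖f y‖ ≤ M) (x : E n) :
    conv g (conv k f) x = conv k (conv g f) x := by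
  rw [conv_conv hg hk hf hM, conv_conv hk hg hf hM]
  congr 1; ext z
  rw [← integral_sub_left_eq_self (fun y => g (z - y) * k y) volume z]
  congr 1; ext y
  rw [sub_sub_cancel, mul_comm]

theorem IsTest.integrable {φ : E n → ℝ} (hφ : IsTest φ) : Integrable φ :=
  hφ.1.continuous.integrable_of_hasCompactSupport hφ.2

theorem IsTest.comp_sub_left {φ : E n → ℝ} (hφ : IsTest φ) (x : E n) :
    IsTest fun y => φ (x - y) :=
  ⟨hφ.1.comp (contDiff_const.sub contDiff_id),
    hφ.2.comp_homeomorph (Homeomorph.subLeft x)⟩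

theorem IsTest.comp_sub_right {φ : E n → ℝ} (hφ : IsTest φ) (x : E n) :
    IsTest fun y => φ (y - x) :=
  ⟨hφ.1.comp (contDiff_id.sub contDiff_const),
    hφ.2.comp_homeomorph (Homeomorph.subRight x)⟩

/-- Testing against φ is a convolution evaluated at 0. Identities for weak derivatives of
convolutions thereby reduce to commutativity and associativity. -/
theorem integral_smul_eq_conv (φ : E n → ℝ) (f : E n → V) :
    ∫ x, φ x • f x = conv (fun z => φ (-z)) f 0 := by
  simp [conv]

omit [NormedSpace ℝ V] in
theorem locallyIntegrable_of_stronglyMeasurable {f : E n → V} (hf : StronglyMeasurable f) {M : ℝ}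
    (hM : ∀ y, ‖f y‖ ≤ M) : LocallyIntegrable f volume :=
  locallyIntegrable_of_bound hf.aestronglyMeasurable (Eventually.of_forall hM)

theorem hasWeakPartial_conv [CompleteSpace V] {k : E n → ℝ} (hk : Integrable k)
    (hkm : Measurable k) {i : Fin n} {f g : E n → V} (hf : StronglyMeasurable f)
    (hg : StronglyMeasurable g) {M M' : ℝ} (hM : ∀ y, ‖f y‖ ≤ M) (hM' : ∀ y, ‖g y‖ ≤ M')
    (h : HasWeakPartial (fun _ : Fin 1 => i) f g) :
    HasWeakPartial (fun _ : Fin 1 => i) (conv k f) (conv k g) := by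
  rw [hasWeakPartial_one_iff] at h ⊢
  refine ⟨locallyIntegrable_of_stronglyMeasurable (stronglyMeasurable_conv k hkm hf)
      (fun x => norm_conv_le hk (Eventually.of_forall hM) x),
    locallyIntegrable_of_stronglyMeasurable (stronglyMeasurable_conv k hkm hg)
      (fun x => norm_conv_le hk (Eventually.of_forall hM') x), fun φ hφ => ?_⟩
  have hφ' := hφ.fderiv_apply (e i)
  rw [integral_smul_eq_conv, integral_smul_eq_conv,
    conv_comm hφ'.integrable.comp_neg hk hf.aestronglyMeasurable (Eventually.of_forall hM),
    conv_comm hφ.integrable.comp_neg hk hg.aestronglyMeasurable (Eventually.of_forall hM')]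
  have : conv (fun z => fderiv ℝ φ (-z) (e i)) f = fun y => -conv (fun z => φ (-z)) g y := by
    ext y
    have h1 := h.2.2 _ (hφ.comp_sub_right y)
    unfold conv
    simp only [neg_sub]
    rw [← h1]
    congr 1; ext z
    congr 1
    have h2 := (((hφ.1.differentiable (by simp)) (z - y)).hasFDerivAt).comp z
      ((hasFDerivAt_id z).sub_const y)
    have h3 := h2.fderiv
    simp only [Function.comp_def, id] at h3
    rw [h3]
    simp
  rw [this]
  unfold conv
  rw [← integral_neg]
  simp_rw [smul_neg]

theorem hasWeakPartial_heat_gradKernel [CompleteSpace V] {r : ℝ} (hr : 0 < r) (i : Fin n)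
    {f : E n → V} (hf : StronglyMeasurable f) {M : ℝ} (hM : ∀ y, ‖f y‖ ≤ M) :
    HasWeakPartial (fun _ : Fin 1 => i) (conv (heatKernel r) f) (conv (gradKernel r i) f) := by
  have hG := integrable_heatKernel (n := n) hr
  have hD := integrable_gradKernel (n := n) hr i
  rw [hasWeakPartial_one_iff]
  refine ⟨locallyIntegrable_of_stronglyMeasurable (stronglyMeasurable_conv _
      (continuous_heatKernel r).measurable hf)
      (fun x => norm_conv_le hG (Eventually.of_forall hM) x),
    locallyIntegrable_of_stronglyMeasurable (stronglyMeasurable_conv _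
      (continuous_gradKernel r i).measurable hf)
      (fun x => norm_conv_le hD (Eventually.of_forall hM) x), fun φ hφ => ?_⟩
  have hφ' := hφ.fderiv_apply (e i)
  rw [integral_smul_eq_conv, integral_smul_eq_conv,
    conv_conv hφ'.integrable.comp_neg hG hf.aestronglyMeasurable (Eventually.of_forall hM),
    conv_conv hφ.integrable.comp_neg hD hf.aestronglyMeasurable (Eventually.of_forall hM)]
  have hbd : ∀ {ψ : E n → ℝ}, IsTest ψ → ∀ {k : E n → ℝ}, Integrable k →
      Integrable fun y => ψ y * k y := fun {ψ} hψ {k} hk => by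
    obtain ⟨C, hC⟩ := hψ.2.exists_bound_of_continuous hψ.1.continuous
    exact hk.bdd_mul hψ.1.continuous.aestronglyMeasurable (Eventually.of_forall hC)
  have : (fun z => ∫ y, fderiv ℝ φ (-(z - y)) (e i) * heatKernel r y)
      = fun z => -∫ y, φ (-(z - y)) * gradKernel r i y := by
    ext z
    have hψ := hφ.comp_sub_right z
    have hd : ∀ y, HasFDerivAt (fun y => φ (y - z)) (fderiv ℝ φ (y - z)) y := fun y =>
      (((hφ.1.differentiable (by simp)) (y - z)).hasFDerivAt).comp y
        ((hasFDerivAt_id y).sub_const z)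
    have := integral_bilinear_hasFDerivAt_right_eq_neg_left_of_integrable
      (μ := (volume : Measure (E n))) (B := ContinuousLinearMap.mul ℝ ℝ) (f := fun y => φ (y - z))
      (f' := fun y => fderiv ℝ φ (y - z)) (g := heatKernel r)
      (g' := fun y => fderiv ℝ (heatKernel r) y) (v := e i)
      (hbd (hφ'.comp_sub_right z) hG) (by
        simp only [fderiv_heatKernel_apply]
        exact hbd hψ hD) (hbd hψ hG) (fun y _ => hd y)
      (fun y _ => (hasFDerivAt_heatKernel (t := r) y).differentiableAt.hasFDerivAt)
    simp only [ContinuousLinearMap.mul_apply', fderiv_heatKernel_apply] at this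
    simp only [neg_sub]
    rw [this, neg_neg]
  rw [this]
  unfold conv
  rw [← integral_neg]
  simp_rw [neg_smul]

/-- Fubini against a test function; the singular majorant is integrable in time, so weak derivatives
pass through the Duhamel integral. -/
theorem hasWeakPartial_intervalIntegral {i : Fin n} {p q : ℝ → E n → V} {a t B : ℝ} (hat : a ≤ t)
    (hp : StronglyMeasurable (Function.uncurry fun x s => p s x))
    (hq : StronglyMeasurable (Function.uncurry fun x s => q s x))
    (hpB : ∀ s ∈ Ioo a t, ∀ x, ‖p s x‖ ≤ B * (t - s) ^ (-(1 / 2) : ℝ))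
    (hqB : ∀ s ∈ Ioo a t, ∀ x, ‖q s x‖ ≤ B * (t - s) ^ (-(1 / 2) : ℝ))
    (h : ∀ s ∈ Ioo a t, HasWeakPartial (fun _ : Fin 1 => i) (p s) (q s)) :
    HasWeakPartial (fun _ : Fin 1 => i) (fun x => ∫ s in a..t, p s x)
      (fun x => ∫ s in a..t, q s x) := by
  have hg := (intervalIntegrable_sub_rpow a t).const_mul B
  have hne : ∀ᵐ s : ℝ, s ≠ t := by simp [ae_iff, measure_singleton]
  have hIoo : ∀ᵐ s ∂volume.restrict (Ioc a t), s ∈ Ioo a t := by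
    refine (ae_restrict_iff' measurableSet_Ioc).2 ?_
    filter_upwards [hne] with s hs hs'
    exact ⟨hs'.1, lt_of_le_of_ne hs'.2 hs⟩
  have hg' := hg
  rw [intervalIntegrable_iff_integrableOn_Ioc_of_le hat] at hg'
  have hloc : ∀ {p : ℝ → E n → V}, StronglyMeasurable (Function.uncurry fun x s => p s x) →
      (∀ s ∈ Ioo a t, ∀ x, ‖p s x‖ ≤ B * (t - s) ^ (-(1 / 2) : ℝ)) →
      LocallyIntegrable (fun x => ∫ s in a..t, p s x) volume := by
    intro p hp hpB
    refine locallyIntegrable_of_stronglyMeasurable (M := ∫ s in a..t, B * (t - s) ^ (-(1 / 2) : ℝ))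
      ?_ fun x => ?_
    · simp_rw [intervalIntegral.integral_of_le hat]
      exact StronglyMeasurable.integral_prod_right hp
    · refine intervalIntegral.norm_integral_le_of_norm_le hat ?_ hg
      filter_upwards [hne] with s hs hs'
      exact hpB s ⟨hs'.1, lt_of_le_of_ne hs'.2 hs⟩ x
  have hswap : ∀ {p : ℝ → E n → V}, StronglyMeasurable (Function.uncurry fun x s => p s x) →
      (∀ s ∈ Ioo a t, ∀ x, ‖p s x‖ ≤ B * (t - s) ^ (-(1 / 2) : ℝ)) →
      ∀ {φ : E n → ℝ}, IsTest φ →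
      ∫ x, φ x • (∫ s in a..t, p s x) = ∫ s in a..t, ∫ x, φ x • p s x := by
    intro p hp hpB φ hφ
    have hI : Integrable (Function.uncurry fun x s => φ x • p s x)
        (volume.prod (volume.restrict (Ioc a t))) := by
      refine Integrable.mono' (hφ.integrable.norm.mul_prod hg') ?_ ?_
      · exact (hφ.1.continuous.comp continuous_fst).aestronglyMeasurable.smul
          hp.aestronglyMeasurable
      · have h'' : ∀ᵐ p : E n × ℝ ∂(volume.prod (volume.restrict (Ioc a t))), p.2 ∈ Ioo a t :=
          Measure.quasiMeasurePreserving_snd.ae hIoo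
        filter_upwards [h''] with z hz
        rw [Function.uncurry, norm_smul]
        gcongr
        exact hpB _ hz _
    simp_rw [intervalIntegral.integral_of_le hat, ← integral_smul]
    exact integral_integral_swap hI
  rw [hasWeakPartial_one_iff]
  refine ⟨hloc hp hpB, hloc hq hqB, fun φ hφ => ?_⟩
  rw [hswap hp hpB (hφ.fderiv_apply (e i)), hswap hq hqB hφ, ← intervalIntegral.integral_neg]
  refine intervalIntegral.integral_congr_ae ?_
  filter_upwards [hne] with s hs hs'
  rw [uIoc_of_le hat] at hs'
  exact (hasWeakPartial_one_iff.1 (h s ⟨hs'.1, lt_of_le_of_ne hs'.2 hs⟩)).2.2 φ hφ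

theorem exists_mollifier (n : ℕ) : ∃ ψ : ℕ → E n → ℝ, (∀ j, IsTest (ψ j)) ∧ (∀ j x, 0 ≤ ψ j x) ∧
    (∀ j, ∫ x, ψ j x = 1) ∧ ∀ {V : Type} [NormedAddCommGroup V] [NormedSpace ℝ V]
      [CompleteSpace V] {f : E n → V}, LocallyIntegrable f volume →
      ∀ᵐ x, Tendsto (fun j => conv (ψ j) f x) atTop (𝓝 (f x)) := by
  -- The fixed ratio 2 between outer and inner radius is what makes mollification converge almost
  -- everywhere for merely locally integrable functions.
  let φ : ℕ → ContDiffBump (0 : E n) := fun j =>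
    ⟨1 / ((j : ℝ) + 1), 2 * (1 / ((j : ℝ) + 1)), by positivity, by
      have : 0 < 1 / ((j : ℝ) + 1) := by positivity
      linarith⟩
  refine ⟨fun j => (φ j).normed volume, fun j => ⟨(φ j).contDiff_normed,
    (φ j).hasCompactSupport_normed⟩, fun j => (φ j).nonneg_normed,
    fun j => (φ j).integral_normed, fun hf => ?_⟩
  have h1 : Tendsto (fun j => (φ j).rOut) atTop (𝓝 0) := by
    have := (tendsto_one_div_add_atTop_nhds_zero_nat (𝕜 := ℝ)).const_mul 2
    simpa [φ] using this
  filter_upwards [ContDiffBump.ae_convolution_tendsto_right_of_locallyIntegrable (K := 2) h1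
    (Eventually.of_forall fun j => le_rfl) hf] with x hx
  refine hx.congr fun j => ?_
  rw [conv_eq_integral_sub]
  rfl

theorem IsTest.hasFDerivAt_conv [CompleteSpace V] {ψ : E n → ℝ} (hψ : IsTest ψ) {f : E n → V}
    (hf : LocallyIntegrable f volume) (x : E n) :
    ∃ L : E n →L[ℝ] V, HasFDerivAt (conv ψ f) L x ∧
      ∀ i, L (e i) = conv (fun z => fderiv ℝ ψ z (e i)) f x := by
  have h := hψ.2.hasFDerivAt_convolution_left (ContinuousLinearMap.lsmul ℝ ℝ)
    (hψ.1.of_le (by exact_mod_cast le_top)) hf x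
  have he : MeasureTheory.convolution ψ f (ContinuousLinearMap.lsmul ℝ ℝ) volume = conv ψ f := by
    ext y
    rw [conv_eq_integral_sub]
    rfl
  rw [he] at h
  refine ⟨_, h, fun i => ?_⟩
  have hex := (hψ.2.fderiv (𝕜 := ℝ)).convolutionExists_left
    ((ContinuousLinearMap.lsmul ℝ ℝ : ℝ →L[ℝ] V →L[ℝ] V).precompL (E n))
    (hψ.1.continuous_fderiv (by simp)) hf x
  rw [convolution_def, ContinuousLinearMap.integral_apply hex, conv_eq_integral_sub]
  rfl

theorem opNorm_le_card_mul {L : E n →L[ℝ] V} {B : ℝ} (hB : 0 ≤ B) (h : ∀ i, ‖L (e i)‖ ≤ B) :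
    ‖L‖ ≤ n * B := by
  refine L.opNorm_le_bound (by positivity) fun z => ?_
  conv_lhs => rw [← sum_apply_smul_e z]
  rw [map_sum]
  refine (norm_sum_le_of_le (Finset.univ) (f := fun i => L (z i • e i)) (n := fun _ => B * ‖z‖)
    fun i _ => ?_).trans (le_of_eq (by simp; ring))
  rw [map_smul, norm_smul, mul_comm, Real.norm_eq_abs]
  gcongr
  · exact h i
  · exact abs_coord_le z i

/-- A bounded function with bounded weak derivatives is Lipschitz up to a null set. -/
theorem exists_ae_lipschitz [CompleteSpace V] {f : E n → V} {g : Fin n → E n → V} {M : ℝ}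
    (hM : ∀ i, ∀ᵐ y, ‖g i y‖ ≤ M)
    (h : ∀ i, HasWeakPartial (fun _ : Fin 1 => i) f (g i)) :
    ∃ Λ, 0 ≤ Λ ∧ ∀ᵐ x, ∀ᵐ y, ‖f y - f x‖ ≤ Λ * ‖y - x‖ := by
  rcases isEmpty_or_nonempty (Fin n) with hn | ⟨⟨i₀⟩⟩
  · refine ⟨0, le_rfl, Eventually.of_forall fun x => Eventually.of_forall fun y => ?_⟩
    have : y = x := by ext i; exact hn.elim i
    simp [this]
  have hM0 : 0 ≤ M := by
    obtain ⟨y, hy⟩ := (hM i₀).exists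
    exact (norm_nonneg _).trans hy
  obtain ⟨ψ, hψ, hψ0, hψ1, hlim⟩ := exists_mollifier n
  have hfl := (h i₀).1
  refine ⟨n * M, by positivity, ?_⟩
  -- The partial derivatives of ψ_j * f are ψ_j * g_i, bounded by M, which makes the mollifications
  -- uniformly Lipschitz. The bound then passes to the limit at points of convergence.
  have hb : ∀ j x y, ‖conv (ψ j) f y - conv (ψ j) f x‖ ≤ n * M * ‖y - x‖ := by
    intro j x y
    choose L hL hL' using fun z => (hψ j).hasFDerivAt_conv hfl z
    refine convex_univ.norm_image_sub_le_of_norm_hasFDerivWithin_le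
      (fun z _ => (hL z).hasFDerivWithinAt) (fun z _ => opNorm_le_card_mul hM0 fun i => ?_)
      (mem_univ x) (mem_univ y)
    rw [hL' z i]
    have h1 := (hasWeakPartial_one_iff.1 (h i)).2.2 _ ((hψ j).comp_sub_left z)
    have h2 : conv (fun w => fderiv ℝ (ψ j) w (e i)) f z = conv (ψ j) (g i) z := by
      unfold conv
      rw [← neg_inj, ← h1, ← integral_neg]
      congr 1; ext y
      rw [← neg_smul]
      congr 1
      have h3 := ((((hψ j).1.differentiable (by simp)) (z - y)).hasFDerivAt).comp y
        ((hasFDerivAt_id y).const_sub z)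
      have h4 := h3.fderiv
      simp only [Function.comp_def] at h4
      rw [h4]
      simp
    rw [h2]
    refine (norm_conv_le (hψ j).integrable (hM i) z).trans (le_of_eq ?_)
    simp_rw [abs_of_nonneg (hψ0 j _)]
    rw [hψ1, one_mul]
  filter_upwards [hlim hfl] with x hx
  filter_upwards [hlim hfl] with y hy
  exact le_of_tendsto' (hy.sub hx).norm fun j => hb j x y

/-- Mollification commutes with the heat flow, so ψ_j * e^{tΔ}f is bounded by B for arbitrarily
small t. As ψ_j * f is Lipschitz, its heat flow converges to it uniformly as t → 0; hence ψ_j * f is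
bounded by B, and so is its limit f. -/
theorem ae_norm_le_of_frequently_heat [CompleteSpace V] {f : E n → V}
    (hf : StronglyMeasurable f) {M : ℝ} (hM : ∀ y, ‖f y‖ ≤ M) {B : ℝ}
    (h : ∃ᶠ t in 𝓝[>] (0 : ℝ), ∀ᵐ x, ‖heat t f x‖ ≤ B) : ∀ᵐ x, ‖f x‖ ≤ B := by
  obtain ⟨ψ, hψ, hψ0, hψ1, hlim⟩ := exists_mollifier n
  have hfl := locallyIntegrable_of_stronglyMeasurable hf hM
  have hM0 : 0 ≤ M := (norm_nonneg _).trans (hM 0)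
  have key : ∀ j x, ‖conv (ψ j) f x‖ ≤ B := by
    intro j x
    have hfm := stronglyMeasurable_conv (ψ j) (hψ j).1.continuous.measurable hf
    have hfb : ∀ y, ‖conv (ψ j) f y‖ ≤ (∫ y, |ψ j y|) * M := fun y =>
      norm_conv_le (hψ j).integrable (Eventually.of_forall hM) y
    obtain ⟨C, hC0, hC⟩ : ∃ C, 0 ≤ C ∧ ∀ x y, ‖conv (ψ j) f y - conv (ψ j) f x‖ ≤ C * ‖y - x‖ := by
      choose L hL hL' using fun z => (hψ j).hasFDerivAt_conv hfl z
      refine ⟨n * ∑ i, (∫ y, |fderiv ℝ (ψ j) y (e i)|) * M, by positivity, fun x y => ?_⟩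
      refine convex_univ.norm_image_sub_le_of_norm_hasFDerivWithin_le
        (fun z _ => (hL z).hasFDerivWithinAt)
        (fun z _ => opNorm_le_card_mul (by positivity) fun i => ?_) (mem_univ x) (mem_univ y)
      rw [hL' z i]
      refine (norm_conv_le ((hψ j).fderiv_apply (e i)).integrable
        (Eventually.of_forall hM) z).trans ?_
      exact Finset.single_le_sum (f := fun i => (∫ y, |fderiv ℝ (ψ j) y (e i)|) * M)
        (fun _ _ => by positivity) (Finset.mem_univ i)
    have hT : Tendsto (fun t : ℝ => B + C * (6 * gaussConst n * √t)) (𝓝[>] 0) (𝓝 B) := by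
      have : Continuous fun t : ℝ => B + C * (6 * gaussConst n * √t) := by fun_prop
      simpa using (this.tendsto 0).mono_left nhdsWithin_le_nhds
    refine ge_of_tendsto_of_frequently hT ?_
    refine (h.and_eventually self_mem_nhdsWithin).mono fun t ⟨ht, ht0⟩ => ?_
    have ht0' : 0 < t := ht0
    have h1 : heat t (conv (ψ j) f) x = conv (ψ j) (heat t f) x := by
      rw [heat_of_pos ht0', heat_of_pos ht0']
      exact conv_comm (integrable_heatKernel ht0') (hψ j).integrable hf.aestronglyMeasurable
        (Eventually.of_forall hM) x
    have h2 : ‖heat t (conv (ψ j) f) x‖ ≤ B := by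
      rw [h1]
      refine (norm_conv_le (hψ j).integrable ht x).trans (le_of_eq ?_)
      simp_rw [abs_of_nonneg (hψ0 j _)]
      rw [hψ1, one_mul]
    have h3 := norm_heat_sub_self_le ht0'.le hfm.aestronglyMeasurable (Eventually.of_forall hfb)
      hC0 (x := x) (Eventually.of_forall fun y => hC x y)
    have h4 := norm_le_insert (heat t (conv (ψ j) f) x) (conv (ψ j) f x)
    linarith
  filter_upwards [hlim hfl] with x hx
  exact le_of_tendsto' hx.norm fun j => key j x

end Mollification

/-! ### Continuity of the sup norms -/

section SupNorm

variable {n : ℕ} {V : Type} [NormedAddCommGroup V] [NormedSpace ℝ V]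

omit [NormedSpace ℝ V]

theorem supNorm_nonneg (f : E n → V) : 0 ≤ supNorm f := ENNReal.toReal_nonneg

theorem supNorm_le {f : E n → V} {B : ℝ} (hB : 0 ≤ B) (h : ∀ᵐ x, ‖f x‖ ≤ B) : supNorm f ≤ B :=
  ENNReal.toReal_le_of_le_ofReal hB (eLpNorm_top_le_of_norm_le h)

theorem ae_norm_le_supNorm {f : E n → V} (h : eLpNorm f ⊤ volume ≠ ⊤) :
    ∀ᵐ x, ‖f x‖ ≤ supNorm f := by
  filter_upwards [ae_le_eLpNormEssSup (f := f) (μ := volume)] with x hx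
  rw [← eLpNorm_exponent_top] at hx
  have := ENNReal.toReal_mono h hx
  simpa [supNorm] using this

theorem eLpNorm_top_ne_top {f : E n → V} {M : ℝ} (h : ∀ᵐ x, ‖f x‖ ≤ M) :
    eLpNorm f ⊤ volume ≠ ⊤ :=
  ((eLpNorm_top_le_of_norm_le h).trans_lt ENNReal.ofReal_lt_top).ne

theorem supNorm_congr {f g : E n → V} (h : f =ᵐ[volume] g) : supNorm f = supNorm g := by
  rw [supNorm, supNorm, eLpNorm_congr_ae h]

theorem abs_supNorm_sub_le {f g : E n → V} {M B : ℝ} (hf : ∀ᵐ x, ‖f x‖ ≤ M)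
    (hg : ∀ᵐ x, ‖g x‖ ≤ M) (hB : ∀ᵐ x, ‖f x - g x‖ ≤ B) : |supNorm f - supNorm g| ≤ B := by
  have hB0 : 0 ≤ B := by
    obtain ⟨x, hx⟩ := hB.exists
    exact (norm_nonneg _).trans hx
  have h1 : supNorm f ≤ supNorm g + B := by
    refine supNorm_le (add_nonneg (supNorm_nonneg g) hB0) ?_
    filter_upwards [ae_norm_le_supNorm (eLpNorm_top_ne_top hg), hB] with x h1 h2
    have := norm_le_insert' (f x) (g x)
    linarith
  have h2 : supNorm g ≤ supNorm f + B := by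
    refine supNorm_le (add_nonneg (supNorm_nonneg f) hB0) ?_
    filter_upwards [ae_norm_le_supNorm (eLpNorm_top_ne_top hf), hB] with x h1 h2
    have := norm_le_insert (f x) (g x)
    linarith
  rw [abs_le]
  constructor <;> linarith

variable [NormedSpace ℝ V]

theorem norm_heat_le_of_ae {t : ℝ} (ht : 0 < t) {f : E n → V} {M : ℝ} (hM : ∀ᵐ y, ‖f y‖ ≤ M)
    (x : E n) : ‖heat t f x‖ ≤ M := by
  rw [heat_of_pos ht]
  refine (norm_conv_le (integrable_heatKernel ht) hM x).trans (le_of_eq ?_)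
  simp_rw [abs_of_nonneg (heatKernel_nonneg ht _)]
  rw [integral_heatKernel ht, one_mul]

/-- Convergence of e^{tΔ}f in L^∞ may fail for discontinuous f, yet the norms converge: contraction
bounds them above, and a smaller limit value along some times would bound f itself. -/
theorem tendsto_supNorm_heat [CompleteSpace V] {f : E n → V} (hf : StronglyMeasurable f) {M : ℝ}
    (hM : ∀ y, ‖f y‖ ≤ M) :
    Tendsto (fun t => supNorm (heat t f)) (𝓝[>] 0) (𝓝 (supNorm f)) := by
  have hMae := Eventually.of_forall (f := ae (volume : Measure (E n))) hM
  have hle : ∀ t > 0, ∀ x, ‖heat t f x‖ ≤ supNorm f := fun t ht x =>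
    norm_heat_le_of_ae ht (ae_norm_le_supNorm (eLpNorm_top_ne_top hMae)) x
  refine tendsto_order.2 ⟨fun B hB => ?_, fun B hB => ?_⟩
  · by_contra hcon
    rw [not_eventually] at hcon
    have h1 : ∃ᶠ t in 𝓝[>] (0 : ℝ), ∀ᵐ x, ‖heat t f x‖ ≤ B :=
      (hcon.and_eventually self_mem_nhdsWithin).mono fun t ⟨ht, ht0⟩ => by
        filter_upwards [ae_norm_le_supNorm (eLpNorm_top_ne_top
          (Eventually.of_forall (hle t ht0)))] with x hx
        exact hx.trans (not_lt.1 ht)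
    have h2 := ae_norm_le_of_frequently_heat hf hM h1
    have hB0 : 0 ≤ B := by
      obtain ⟨x, hx⟩ := h2.exists
      exact (norm_nonneg _).trans hx
    exact absurd (supNorm_le hB0 h2) (not_le.2 hB)
  · filter_upwards [self_mem_nhdsWithin] with t ht
    exact (supNorm_le (supNorm_nonneg f) (Eventually.of_forall (hle t ht))).trans_lt hB

variable {ι : Type} [Fintype ι] [FiniteDimensional ℝ V] {W : Type} [NormedAddCommGroup W]
  [NormedSpace ℝ W] [CompleteSpace W] {K : ι → ℝ → E n → ℝ} {N : ι → V → V} {b T₀ a T : ℝ}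
  {w : ℝ → E n → V}

/-- At the initial time the Duhamel term is O(√(t - a)), so the norm is compared with that of the
heat flow of the datum. At later times the Hölder bound in time suffices. -/
theorem IsSol.continuousOn_supNorm (hK : KernelFamily K b T₀)
    (hN : ∀ α, ContDiff ℝ (⊤ : ℕ∞) (N α)) (hw : IsSol K N a T w) (hT : T - a ≤ T₀)
    (π : V →L[ℝ] W) : ContinuousOn (fun t => supNorm fun x => π (w t x)) (Icc a T) := by
  have := FiniteDimensional.complete ℝ V
  have hNc : ∀ α, Continuous (N α) := fun α => (hN α).continuous
  obtain ⟨M, hM⟩ := hw.bddMeas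
  have hM0 : 0 ≤ M := (norm_nonneg _).trans (hM.bound 0 0)
  obtain ⟨B, hB⟩ := hM.comp hNc
  have hb : ∀ t, ∀ᵐ x, ‖π (w t x)‖ ≤ ‖π‖ * M := fun t => Eventually.of_forall fun x =>
    (π.le_opNorm _).trans (by gcongr; exact hM.bound t x)
  have hπm : ∀ t, StronglyMeasurable fun x => π (w t x) := fun t =>
    π.continuous.comp_stronglyMeasurable (hM.slice t)
  intro t ht
  rcases ht.1.eq_or_lt with rfl | hat
  · rcases ht.2.eq_or_lt with rfl | haT
    · simp
    have h1 : Tendsto (fun t => supNorm fun x => π (w t x)) (𝓝[>] a)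
        (𝓝 (supNorm fun x => π (w a x))) := by
      have h2 : Tendsto (fun t => supNorm (heat (t - a) fun x => π (w a x))) (𝓝[>] a)
          (𝓝 (supNorm fun x => π (w a x))) := by
        refine (tendsto_supNorm_heat (hπm a) (M := ‖π‖ * M) fun x => (π.le_opNorm _).trans
          (by gcongr; exact hM.bound a x)).comp ?_
        refine tendsto_nhdsWithin_iff.2 ⟨?_, ?_⟩
        · have : Continuous fun t : ℝ => t - a := by fun_prop
          simpa using (this.tendsto a).mono_left nhdsWithin_le_nhds
        · filter_upwards [self_mem_nhdsWithin] with t ht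
          exact sub_pos.2 (mem_Ioi.1 ht)
      have h3 : Tendsto (fun t => (supNorm fun x => π (w t x))
          - supNorm (heat (t - a) fun x => π (w a x))) (𝓝[>] a) (𝓝 0) := by
        have hc : Tendsto (fun t : ℝ => ‖π‖ * (Fintype.card ι * b * (2 * √(t - a) * B)))
            (𝓝[>] a) (𝓝 0) := by
          have : Continuous fun t : ℝ => ‖π‖ * (Fintype.card ι * b * (2 * √(t - a) * B)) := by
            fun_prop
          simpa using (this.tendsto a).mono_left nhdsWithin_le_nhds
        refine squeeze_zero_norm' ?_ hc
        filter_upwards [Ioc_mem_nhdsGT haT] with t ht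
        have hta : 0 < t - a := sub_pos.2 ht.1
        refine abs_supNorm_sub_le (M := ‖π‖ * M) (hb t) (Eventually.of_forall fun x =>
          norm_heat_le_of_ae hta (hb a) x) (Eventually.of_forall fun x => ?_)
        have e1 : heat (t - a) (fun x => π (w a x)) x = π (heat (t - a) (w a) x) := by
          simp only [heat_of_pos hta]
          exact (clm_conv π (integrable_heatKernel hta) (hM.slice a).aestronglyMeasurable
            (Eventually.of_forall (hM.bound a)) x).symm
        rw [e1, ← map_sub, hw.eq t ht x, add_sub_cancel_left]
        refine (π.le_opNorm _).trans ?_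
        gcongr
        exact hK.norm_duhamel_le ht.1.le (by linarith [ht.2])
          (fun α s _ => Eventually.of_forall ((hB α).bound s)) x
      have := h3.add h2
      simpa using this
    have h4 : ContinuousWithinAt (fun t => supNorm fun x => π (w t x)) (Ici a) a :=
      continuousWithinAt_Ioi_iff_Ici.1 h1
    exact h4.mono Icc_subset_Ici_self
  · obtain ⟨δ, haδ, hδt⟩ := exists_between hat
    obtain ⟨Λ, hΛ, hlip⟩ := hw.lipschitz hK hN hT haδ
    obtain ⟨H, hH, hhol⟩ := hw.norm_sub_le_sqrt hK hNc hT haδ.le hΛ hlip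
    have h1 : ContinuousWithinAt (fun t => supNorm fun x => π (w t x)) (Icc δ T) t := by
      unfold ContinuousWithinAt
      rw [tendsto_iff_norm_sub_tendsto_zero]
      have hc : Tendsto (fun s : ℝ => ‖π‖ * (H * √|s - t|)) (𝓝[Icc δ T] t) (𝓝 0) := by
        have : Continuous fun s : ℝ => ‖π‖ * (H * √|s - t|) := by fun_prop
        simpa using (this.tendsto t).mono_left nhdsWithin_le_nhds
      refine squeeze_zero' (Eventually.of_forall fun _ => norm_nonneg _) ?_ hc
      filter_upwards [self_mem_nhdsWithin] with s hs
      refine abs_supNorm_sub_le (hb s) (hb t) (Eventually.of_forall fun x => ?_)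
      rw [← map_sub]
      refine (π.le_opNorm _).trans ?_
      gcongr
      exact hhol t ⟨hδt.le, ht.2⟩ s hs x
    refine h1.mono_of_mem_nhdsWithin ?_
    have : Icc a T ∩ Ioi δ ⊆ Icc δ T := fun s hs => ⟨le_of_lt hs.2, hs.1.2⟩
    exact mem_of_superset (inter_mem_nhdsWithin _ (Ioi_mem_nhds hδt)) this

end SupNorm

/-! ### The liquid crystal system as a semilinear system -/

section LiquidCrystalSystem

/-- Values of the triple `(u, d, ∇ d)`. -/
abbrev State (n m : ℕ) : Type := E n × E m × Grad n m

/-- Indices of the kernels `e^{tΔ}`, `e^{tΔ} ∂ₖ` and `e^{tΔ} ℙᵢⱼ ∂ₖ`. -/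
abbrev KernelIndex (n : ℕ) : Type := Unit ⊕ Fin n ⊕ (Fin n × Fin n × Fin n)

variable {n m : ℕ}

/-- The kernels of the system satisfied by `(u / A, d, ∇ d / A)`. -/
def sysKernel (A : ℝ) : KernelIndex n → ℝ → E n → ℝ
  | Sum.inl _ => fun t x => A ^ 2 * heatKernel t x
  | Sum.inr (Sum.inl k) => fun t x => A * gradKernel t k x
  | Sum.inr (Sum.inr q) => fun t x => A * projKernel t q.1 q.2.1 q.2.2 x

/-- The expression `|∇ d|² d - (u · ∇) d`. -/
def force (w : State n m) : E m := ‖w.2.2‖ ^ 2 • w.2.1 - ∑ i, w.1 i • w.2.2 i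

/-- The matrix `u ⊗ u + ∇ d ⊙ ∇ d`. -/
def stressEntry (j k : Fin n) (w : State n m) : ℝ :=
  w.1 j * w.1 k + inner ℝ (w.2.2 j) (w.2.2 k)

/-- The embedding of `E m` as the `k`-th partial derivative. -/
def gradSingle (k : Fin n) : E m →ₗ[ℝ] Grad n m where
  toFun a := PiLp.single 2 (β := fun _ : Fin n => E m) k a
  map_add' _ _ := PiLp.single_add 2 k
  map_smul' c a := by
    ext i : 1
    rcases eq_or_ne i k with rfl | h
    · simp
    · simp [h]

/-- The nonlinearities of the system satisfied by `(u / A, d, ∇ d / A)`. -/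
def sysNonlin : KernelIndex n → State n m → State n m
  | Sum.inl _ => fun w => (0, force w, 0)
  | Sum.inr (Sum.inl k) => fun w => (0, 0, gradSingle k (force w))
  | Sum.inr (Sum.inr q) => fun w => (-(stressEntry q.2.1 q.2.2 w) • e q.1, 0, 0)

theorem kernelFamily_sysKernel {A T : ℝ} (hA : 0 < A) (hAT : A ^ 2 * T ≤ 1) :
    KernelFamily (sysKernel (n := n) A) (A * kernelConst n) T := by
  have hκ := one_le_kernelConst n
  refine ⟨by positivity, ?_, ?_, ?_, ?_⟩
  · rintro (_ | k | ⟨i, j, k⟩)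
    · exact measurable_heatKernel.const_mul (A ^ 2)
    · exact (measurable_gradKernel k).const_mul A
    · exact (measurable_projKernel i j k).const_mul A
  · rintro (_ | k | ⟨i, j, k⟩) t ht
    · exact (integrable_heatKernel ht).const_mul _
    · exact (integrable_gradKernel ht k).const_mul _
    · exact (integrable_projKernel ht i j k).const_mul _
  · rintro (_ | k | ⟨i, j, k⟩) t ht htT
    · simp only [sysKernel, abs_mul, abs_of_nonneg (heatKernel_nonneg ht _)]
      rw [integral_const_mul, integral_heatKernel ht, mul_one, abs_of_nonneg (by positivity)]
      -- The kernel A²G has the constant mass A². Since A²t ≤ 1, one factor A is at most t^{-1/2},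
      -- which gives the same bound as for the kernels of order one.
      have h1 : A ≤ t ^ (-(1 / 2) : ℝ) := by
        rw [Real.rpow_neg ht.le, ← Real.sqrt_eq_rpow, ← Real.sqrt_inv]
        refine Real.le_sqrt_of_sq_le ?_
        rw [← one_div, le_div_iff₀ ht]
        exact (mul_le_mul_of_nonneg_left htT (sq_nonneg A)).trans hAT
      have h2 : 0 ≤ t ^ (-(1 / 2) : ℝ) := by positivity
      calc A ^ 2 = A * 1 * A := by ring
        _ ≤ A * kernelConst n * t ^ (-(1 / 2) : ℝ) := by gcongr
    · simp only [sysKernel, abs_mul, abs_of_pos hA]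
      rw [integral_const_mul, mul_assoc]
      gcongr
      exact integral_abs_gradKernel_le_kernelConst ht k
    · simp only [sysKernel, abs_mul, abs_of_pos hA]
      rw [integral_const_mul, mul_assoc]
      gcongr
      exact integral_abs_projKernel_le ht i j k
  · rintro (_ | k | ⟨i, j, k⟩) a t x ha ht
    · simp only [sysKernel, mul_left_comm _ (A ^ 2)]
      rw [integral_const_mul, heatKernel_conv_heatKernel ha ht]
    · simp only [sysKernel, mul_left_comm _ A]
      rw [integral_const_mul, heatKernel_conv_gradKernel ha ht]
    · simp only [sysKernel, mul_left_comm _ A]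
      rw [integral_const_mul, heatKernel_conv_projKernel ha ht]

theorem contDiff_force : ContDiff ℝ (⊤ : ℕ∞) (force (n := n) (m := m)) := by
  unfold force
  have h : ContDiff ℝ (⊤ : ℕ∞) fun w : State n m => ‖w.2.2‖ ^ 2 :=
    (contDiff_snd.comp contDiff_snd).norm_sq ℝ
  refine (h.smul (contDiff_fst.comp contDiff_snd)).sub ?_
  fun_prop

theorem contDiff_stressEntry (j k : Fin n) :
    ContDiff ℝ (⊤ : ℕ∞) (stressEntry (m := m) j k) := by
  unfold stressEntry
  have h : ContDiff ℝ (⊤ : ℕ∞) fun w : State n m => inner ℝ (w.2.2 j) (w.2.2 k) :=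
    ContDiff.inner ℝ (by fun_prop) (by fun_prop)
  have h' : ContDiff ℝ (⊤ : ℕ∞) fun w : State n m => w.1 j * w.1 k := by fun_prop
  exact h'.add h

theorem norm_gradSingle (k : Fin n) (a : E m) : ‖(gradSingle k a : Grad n m)‖ = ‖a‖ := by
  have : (gradSingle k a : Grad n m) = PiLp.single 2 k a := rfl
  rw [this]
  simp

theorem contDiff_sysNonlin (α : KernelIndex n) : ContDiff ℝ (⊤ : ℕ∞) (sysNonlin (m := m) α) := by
  rcases α with _ | k | ⟨i, j, k⟩
  · exact contDiff_const.prodMk (contDiff_force.prodMk contDiff_const)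
  · have h : ContDiff ℝ (⊤ : ℕ∞) fun a : E m => (gradSingle k a : Grad n m) :=
      ((gradSingle k).isLinear.with_bound 1 fun a => by rw [norm_gradSingle, one_mul]).contDiff
    exact contDiff_const.prodMk (contDiff_const.prodMk (h.comp contDiff_force))
  · exact (((contDiff_stressEntry j k).neg).smul contDiff_const).prodMk contDiff_const

theorem sysNonlin_zero (α : KernelIndex n) : sysNonlin α (0 : State n m) = 0 := by
  rcases α with _ | k | ⟨i, j, k⟩ <;> simp [sysNonlin, force, stressEntry]

theorem norm_sum_smul_le (v : E n) (D : Grad n m) : ‖∑ i, v i • D i‖ ≤ ‖v‖ * ‖D‖ := by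
  calc ‖∑ i, v i • D i‖ ≤ ∑ i, |v i| * ‖D i‖ :=
        norm_sum_le_of_le _ fun i _ => by rw [norm_smul, Real.norm_eq_abs]
    _ ≤ √(∑ i, |v i| ^ 2) * √(∑ i, ‖D i‖ ^ 2) := Real.sum_mul_le_sqrt_mul_sqrt _ _ _
    _ = ‖v‖ * ‖D‖ := by
        rw [EuclideanSpace.norm_eq, PiLp.norm_eq_of_L2]
        simp

/-- On the ball of radius two, 16 = 4 + 8 + 2 + 2: the change of d in |∇d|²d, the change of |∇d|²,
and the two halves of the transport term. -/
theorem norm_force_sub_le {w w' : State n m} (hw : ‖w‖ ≤ 2) (hw' : ‖w'‖ ≤ 2) :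
    ‖force w - force w'‖ ≤ 16 * ‖w - w'‖ := by
  obtain ⟨u, d, D⟩ := w
  obtain ⟨u', d', D'⟩ := w'
  simp only [Prod.norm_mk, max_le_iff] at hw hw'
  obtain ⟨hu, hd, hD⟩ := hw
  obtain ⟨hu', hd', hD'⟩ := hw'
  set ε := ‖((u, d, D) : State n m) - (u', d', D')‖ with hε
  have h1 : ‖u - u'‖ ≤ ε := norm_fst_le ((u, d, D) - (u', d', D'))
  have h23 : ‖(d - d', D - D')‖ ≤ ε := norm_snd_le ((u, d, D) - (u', d', D'))
  have h2 : ‖d - d'‖ ≤ ε := (norm_fst_le (d - d', D - D')).trans h23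
  have h3 : ‖D - D'‖ ≤ ε := (norm_snd_le (d - d', D - D')).trans h23
  have hε0 : 0 ≤ ε := norm_nonneg _
  have hsum : ∑ i, u i • D i - ∑ i, u' i • D' i
      = ∑ i, (u - u') i • D i + ∑ i, u' i • (D - D') i := by
    rw [← Finset.sum_sub_distrib, ← Finset.sum_add_distrib]
    refine Finset.sum_congr rfl fun i _ => ?_
    simp only [PiLp.sub_apply, sub_smul, smul_sub]
    abel
  have he : force (u, d, D) - force (u', d', D') = ‖D‖ ^ 2 • (d - d')
      + (‖D‖ ^ 2 - ‖D'‖ ^ 2) • d' - (∑ i, (u - u') i • D i + ∑ i, u' i • (D - D') i) := by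
    rw [← hsum]
    simp only [force, smul_sub, sub_smul]
    abel
  rw [he]
  have t1 : ‖‖D‖ ^ 2 • (d - d')‖ ≤ 4 * ε := by
    rw [norm_smul, Real.norm_of_nonneg (by positivity)]
    calc ‖D‖ ^ 2 * ‖d - d'‖ ≤ 2 ^ 2 * ε := by gcongr
      _ = _ := by ring
  have t2 : ‖(‖D‖ ^ 2 - ‖D'‖ ^ 2) • d'‖ ≤ 8 * ε := by
    rw [norm_smul, sq_sub_sq, norm_mul, Real.norm_of_nonneg (by positivity)]
    calc (‖D‖ + ‖D'‖) * ‖‖D‖ - ‖D'‖‖ * ‖d'‖ ≤ (2 + 2) * ε * 2 := by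
          gcongr
          exact (abs_norm_sub_norm_le D D').trans h3
      _ = _ := by ring
  have t3 : ‖∑ i, (u - u') i • D i‖ ≤ 2 * ε := by
    refine (norm_sum_smul_le _ _).trans ?_
    rw [mul_comm]; gcongr
  have t4 : ‖∑ i, u' i • (D - D') i‖ ≤ 2 * ε := by
    refine (norm_sum_smul_le _ _).trans ?_
    gcongr
  have s1 := norm_sub_le (‖D‖ ^ 2 • (d - d') + (‖D‖ ^ 2 - ‖D'‖ ^ 2) • d')
    (∑ i, (u - u') i • D i + ∑ i, u' i • (D - D') i)
  have s2 := norm_add_le (‖D‖ ^ 2 • (d - d')) ((‖D‖ ^ 2 - ‖D'‖ ^ 2) • d')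
  have s3 := norm_add_le (∑ i, (u - u') i • D i) (∑ i, u' i • (D - D') i)
  linarith

theorem norm_grad_apply_le (D : Grad n m) (i : Fin n) : ‖D i‖ ≤ ‖D‖ := PiLp.norm_apply_le D i

theorem abs_stressEntry_sub_le (j k : Fin n) {w w' : State n m} (hw : ‖w‖ ≤ 2) (hw' : ‖w'‖ ≤ 2) :
    |stressEntry j k w - stressEntry j k w'| ≤ 16 * ‖w - w'‖ := by
  obtain ⟨u, d, D⟩ := w
  obtain ⟨u', d', D'⟩ := w'
  simp only [Prod.norm_mk, max_le_iff] at hw hw'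
  obtain ⟨hu, hd, hD⟩ := hw
  obtain ⟨hu', hd', hD'⟩ := hw'
  set ε := ‖((u, d, D) : State n m) - (u', d', D')‖ with hε
  have h1 : ‖u - u'‖ ≤ ε := norm_fst_le ((u, d, D) - (u', d', D'))
  have h23 : ‖(d - d', D - D')‖ ≤ ε := norm_snd_le ((u, d, D) - (u', d', D'))
  have h3 : ‖D - D'‖ ≤ ε := (norm_snd_le (d - d', D - D')).trans h23
  have hε0 : 0 ≤ ε := norm_nonneg _
  have he : stressEntry j k (u, d, D) - stressEntry j k (u', d', D')
      = u j * (u - u') k + (u - u') j * u' k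
        + inner ℝ (D j) ((D - D') k) + inner ℝ ((D - D') j) (D' k) := by
    simp only [stressEntry, PiLp.sub_apply, inner_sub_left, inner_sub_right]
    ring
  rw [he]
  have t1 : |u j * (u - u') k| ≤ 2 * ε := by
    rw [abs_mul]
    exact mul_le_mul ((abs_coord_le u j).trans hu) ((abs_coord_le _ k).trans h1) (abs_nonneg _)
      (by norm_num)
  have t2 : |(u - u') j * u' k| ≤ ε * 2 := by
    rw [abs_mul]
    exact mul_le_mul ((abs_coord_le _ j).trans h1) ((abs_coord_le u' k).trans hu') (abs_nonneg _)
      hε0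
  have t3 : |inner ℝ (D j) ((D - D') k)| ≤ 2 * ε :=
    (abs_real_inner_le_norm _ _).trans (mul_le_mul ((norm_grad_apply_le D j).trans hD)
      ((norm_grad_apply_le _ k).trans h3) (norm_nonneg _) (by norm_num))
  have t4 : |inner ℝ ((D - D') j) (D' k)| ≤ ε * 2 :=
    (abs_real_inner_le_norm _ _).trans (mul_le_mul ((norm_grad_apply_le _ j).trans h3)
      ((norm_grad_apply_le D' k).trans hD') (norm_nonneg _) hε0)
  have s1 := abs_add_le (u j * (u - u') k + (u - u') j * u' k + inner ℝ (D j) ((D - D') k))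
    (inner ℝ ((D - D') j) (D' k))
  have s2 := abs_add_le (u j * (u - u') k + (u - u') j * u' k) (inner ℝ (D j) ((D - D') k))
  have s3 := abs_add_le (u j * (u - u') k) ((u - u') j * u' k)
  linarith

theorem norm_e (i : Fin n) : ‖(e i : E n)‖ = 1 := by simp [e]

theorem norm_sysNonlin_sub_le (α : KernelIndex n) (w w' : State n m) (hw : ‖w‖ ≤ 2)
    (hw' : ‖w'‖ ≤ 2) : ‖sysNonlin α w - sysNonlin α w'‖ ≤ 16 * ‖w - w'‖ := by
  rcases α with _ | k | ⟨i, j, k⟩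
  · have : sysNonlin (Sum.inl ()) w - sysNonlin (Sum.inl ()) w'
        = ((0, force w - force w', 0) : State n m) := by simp [sysNonlin]
    rw [this]
    simpa using norm_force_sub_le hw hw'
  · have : sysNonlin (Sum.inr (Sum.inl k)) w - sysNonlin (Sum.inr (Sum.inl k)) w'
        = ((0, 0, gradSingle k (force w - force w')) : State n m) := by simp [sysNonlin]
    rw [this]
    rw [Prod.norm_mk, Prod.norm_mk, norm_zero, norm_zero, norm_gradSingle,
      max_eq_right (norm_nonneg _), max_eq_right (norm_nonneg _)]
    exact norm_force_sub_le hw hw'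
  · have : sysNonlin (Sum.inr (Sum.inr (i, j, k))) w - sysNonlin (Sum.inr (Sum.inr (i, j, k))) w'
        = ((-(stressEntry j k w - stressEntry j k w') • e i, 0, 0) : State n m) := by
      simp only [sysNonlin, Prod.mk_sub_mk, sub_self, ← sub_smul]
      congr 2
      ring
    rw [this]
    rw [Prod.norm_mk, Prod.norm_mk, norm_zero, norm_zero, max_self, norm_smul, norm_e, mul_one,
      norm_neg, max_eq_left (norm_nonneg _)]
    exact abs_stressEntry_sub_le j k hw hw'

theorem heatDriven_sysKernel (A : ℝ) : HeatDriven (sysKernel (n := n) A) (sysNonlin (m := m))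
    (Sum.inl ()) (A ^ 2) (ContinuousLinearMap.fst ℝ (E m) (Grad n m) ∘L
      ContinuousLinearMap.snd ℝ (E n) (E m × Grad n m)) := by
  refine ⟨fun t x => rfl, ?_⟩
  rintro (_ | k | ⟨i, j, k⟩) hα v
  · exact absurd rfl hα
  · rfl
  · rfl

end LiquidCrystalSystem

/-! ### The components of the system -/

section Components

variable {n m : ℕ}

theorem conv_smul_const {V : Type} [NormedAddCommGroup V] [NormedSpace ℝ V] [CompleteSpace V]
    (k c : E n → ℝ) (v : V) (x : E n) :
    conv k (fun y => c y • v) x = (∫ y, k (x - y) * c y) • v := by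
  unfold conv
  rw [← integral_smul_const]
  simp_rw [smul_smul]

theorem conv_const_mul {V : Type} [NormedAddCommGroup V] [NormedSpace ℝ V]
    (c : ℝ) (k : E n → ℝ) (f : E n → V) (x : E n) :
    conv (fun z => c * k z) f x = conv k (fun y => c • f y) x := by
  unfold conv
  simp_rw [smul_smul, mul_comm c]

theorem conv_zero_right {V : Type} [NormedAddCommGroup V] [NormedSpace ℝ V]
    (k : E n → ℝ) (x : E n) : conv k (fun _ => (0 : V)) x = 0 := by
  simp [conv]

theorem HasWeakPartial.add {V : Type*} [NormedAddCommGroup V] [NormedSpace ℝ V] {i : Fin n}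
    {f g f' g' : E n → V} (h : HasWeakPartial (fun _ : Fin 1 => i) f g)
    (h' : HasWeakPartial (fun _ : Fin 1 => i) f' g') :
    HasWeakPartial (fun _ : Fin 1 => i) (fun x => f x + f' x) (fun x => g x + g' x) := by
  rw [hasWeakPartial_one_iff] at *
  refine ⟨h.1.add h'.1, h.2.1.add h'.2.1, fun φ hφ => ?_⟩
  have hφ' := hφ.fderiv_apply (e i)
  simp_rw [smul_add]
  rw [integral_add (integrable_test_smul hφ' h.1) (integrable_test_smul hφ' h'.1),
    integral_add (integrable_test_smul hφ h.2.1) (integrable_test_smul hφ h'.2.1),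
    h.2.2 φ hφ, h'.2.2 φ hφ, neg_add]

/-- The right hand side of the integral equation, evaluated on the triple `F`. -/
def sysMild (A : ℝ) (w₀ : E n → State n m) (F : ℝ → E n → State n m) (t : ℝ) (x : E n) :
    State n m :=
  heat t w₀ x + duhamel (sysKernel A) (fun α s y => sysNonlin α (F s y)) 0 t x

/-- The velocity of a state field in rescaled variables. -/
def velocity (A : ℝ) (F : E n → State n m) (y : E n) : E n := A • (F y).1

/-- The director of a state field. -/
def director (F : E n → State n m) (y : E n) : E m := (F y).2.1

/-- The gradient of the director of a state field in rescaled variables. -/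
def directorGrad (A : ℝ) (F : E n → State n m) (y : E n) : Grad n m := A • (F y).2.2

theorem dForce_eq (A : ℝ) (F : E n → State n m) (y : E n) :
    dForce (velocity A F) (director F) (directorGrad A F) y = A ^ 2 • force (F y) := by
  simp only [dForce, velocity, director, directorGrad, force, norm_smul, mul_pow, smul_sub,
    Finset.smul_sum, PiLp.smul_apply, smul_smul, smul_eq_mul, Real.norm_eq_abs, sq_abs]
  congr 1
  refine Finset.sum_congr rfl fun i _ => ?_
  congr 1
  ring

theorem stress_eq (A : ℝ) (F : E n → State n m) (y : E n) (j k : Fin n) :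
    stress (velocity A F) (directorGrad A F) y j k = A ^ 2 * stressEntry j k (F y) := by
  simp only [stress, velocity, directorGrad, stressEntry, Matrix.of_apply, PiLp.smul_apply,
    smul_eq_mul, real_inner_smul_left, real_inner_smul_right]
  ring

theorem BddMeas.dForce {A M : ℝ} {F : ℝ → E n → State n m} (hF : BddMeas M F) :
    ∃ B, BddMeas B fun s =>
      LiquidCrystal.dForce (velocity A (F s)) (director (F s)) (directorGrad A (F s)) := by
  have hc := (contDiff_force (n := n) (m := m)).continuous
  obtain ⟨B, hB⟩ := hF.comp (N := fun (_ : Unit) w => A ^ 2 • force w) (fun _ => by fun_prop)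
  refine ⟨B, ?_⟩
  have : (fun s => LiquidCrystal.dForce (velocity A (F s)) (director (F s)) (directorGrad A (F s)))
      = fun s y => A ^ 2 • force (F s y) := by
    funext s y
    exact dForce_eq A (F s) y
  rw [this]
  exact hB ()

variable {A T M M₀ : ℝ} {w₀ : E n → State n m} {F : ℝ → E n → State n m}

/-- The field F is arbitrary and not assumed to be a solution: for uniqueness, the right-hand side
has to be evaluated at a measurable version of another mild solution. -/
theorem clm_sysMild (hA : 0 < A) (hAT : A ^ 2 * T ≤ 1) (hw₀ : StronglyMeasurable w₀)
    (hM₀ : ∀ x, ‖w₀ x‖ ≤ M₀) (hF : BddMeas M F) {W : Type} [NormedAddCommGroup W] [NormedSpace ℝ W]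
    [CompleteSpace W] (L : State n m →L[ℝ] W) {t : ℝ} (ht : t ∈ Ioc 0 T) (x : E n)
    {I : ℝ → W}
    (hI : ∀ s ∈ Ioo 0 t, ∑ α, conv (sysKernel A α (t - s)) (fun y => L (sysNonlin α (F s y))) x
      = I s) :
    L (sysMild A w₀ F t x) = heat t (fun y => L (w₀ y)) x + ∫ s in (0 : ℝ)..t, I s := by
  have hK := kernelFamily_sysKernel (n := n) hA hAT
  obtain ⟨B, hB⟩ := hF.comp (fun α => (contDiff_sysNonlin (n := n) (m := m) α).continuous)
  rw [sysMild, map_add, hK.clm_duhamel L hB ht.1.le (by linarith [ht.2])]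
  congr 1
  · simp only [heat_of_pos ht.1]
    exact clm_conv L (integrable_heatKernel ht.1) hw₀.aestronglyMeasurable
      (Eventually.of_forall hM₀) x
  · refine intervalIntegral.integral_congr_ae ?_
    have h' : ∀ᵐ s : ℝ, s ≠ t := by simp [ae_iff, measure_singleton]
    filter_upwards [h'] with s hs hs'
    rw [uIoc_of_le ht.1.le] at hs'
    exact hI s ⟨hs'.1, lt_of_le_of_ne hs'.2 hs⟩

theorem velocity_sysMild (hA : 0 < A) (hAT : A ^ 2 * T ≤ 1) (hw₀ : StronglyMeasurable w₀)
    (hM₀ : ∀ x, ‖w₀ x‖ ≤ M₀) (hF : BddMeas M F) {t : ℝ} (ht : t ∈ Ioc 0 T) (x : E n) :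
    velocity A (sysMild A w₀ F t) x = heat t (velocity A w₀) x
      - ∫ s in (0 : ℝ)..t, heatProjDiv (t - s) (stress (velocity A (F s)) (directorGrad A (F s)))
        x := by
  have h := clm_sysMild hA hAT hw₀ hM₀ hF (A • ContinuousLinearMap.fst ℝ (E n) (E m × Grad n m))
    ht x (I := fun s => -heatProjDiv (t - s)
      (stress (velocity A (F s)) (directorGrad A (F s))) x) (fun s hs => ?_)
  · rw [intervalIntegral.integral_neg, ← sub_eq_add_neg] at h
    exact h
  · simp only [Fintype.sum_sum_type, Fintype.sum_prod_type]
    simp only [sysKernel, sysNonlin, smul_apply, ContinuousLinearMap.coe_fst', smul_zero,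
      conv_zero_right, Finset.sum_const_zero, zero_add, smul_smul, conv_smul_const]
    ext i'
    simp only [heatProjDiv, PiLp.neg_apply, WithLp.ofLp_sum, Finset.sum_apply, PiLp.smul_apply]
    rw [Finset.sum_eq_single i']
    · rw [← Finset.sum_neg_distrib]
      refine Finset.sum_congr rfl fun j _ => ?_
      rw [← Finset.sum_neg_distrib]
      refine Finset.sum_congr rfl fun k _ => ?_
      simp only [stress_eq]
      rw [← integral_neg]
      simp only [e, PiLp.single_apply, if_true, smul_eq_mul, mul_one]
      congr 1
      ext y
      ring
    · intro i _ hi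
      simp [e, hi.symm]
    · simp

theorem director_sysMild (hA : 0 < A) (hAT : A ^ 2 * T ≤ 1) (hw₀ : StronglyMeasurable w₀)
    (hM₀ : ∀ x, ‖w₀ x‖ ≤ M₀) (hF : BddMeas M F) {t : ℝ} (ht : t ∈ Ioc 0 T) (x : E n) :
    director (sysMild A w₀ F t) x = heat t (director w₀) x
      + ∫ s in (0 : ℝ)..t, conv (heatKernel (t - s))
        (dForce (velocity A (F s)) (director (F s)) (directorGrad A (F s))) x := by
  refine clm_sysMild hA hAT hw₀ hM₀ hF (ContinuousLinearMap.fst ℝ (E m) (Grad n m) ∘L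
      ContinuousLinearMap.snd ℝ (E n) (E m × Grad n m))
    ht x (fun s hs => ?_)
  simp only [Fintype.sum_sum_type, Fintype.sum_prod_type]
  simp only [sysKernel, sysNonlin, ContinuousLinearMap.comp_apply, ContinuousLinearMap.coe_fst',
    ContinuousLinearMap.coe_snd', conv_zero_right, Finset.sum_const_zero, add_zero,
    Finset.univ_unique, Finset.sum_singleton, conv_const_mul]
  congr 1
  funext y
  rw [dForce_eq]

theorem directorGrad_sysMild (hA : 0 < A) (hAT : A ^ 2 * T ≤ 1) (hw₀ : StronglyMeasurable w₀)
    (hM₀ : ∀ x, ‖w₀ x‖ ≤ M₀) (hF : BddMeas M F) {t : ℝ} (ht : t ∈ Ioc 0 T) (i : Fin n) (x : E n) :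
    directorGrad A (sysMild A w₀ F t) x i = heat t (fun y => directorGrad A w₀ y i) x
      + ∫ s in (0 : ℝ)..t, conv (gradKernel (t - s) i)
        (dForce (velocity A (F s)) (director (F s)) (directorGrad A (F s))) x := by
  refine clm_sysMild hA hAT hw₀ hM₀ hF (A • (PiLp.proj 2 (𝕜 := ℝ) (fun _ : Fin n => E m) i ∘L
      ContinuousLinearMap.snd ℝ (E m) (Grad n m) ∘L
      ContinuousLinearMap.snd ℝ (E n) (E m × Grad n m)))
    ht x (fun s hs => ?_)
  simp only [Fintype.sum_sum_type, Fintype.sum_prod_type]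
  simp only [sysKernel, sysNonlin, ContinuousLinearMap.comp_apply, smul_apply, smul_zero, map_zero,
    ContinuousLinearMap.coe_snd', conv_zero_right, Finset.sum_const_zero, add_zero, zero_add,
    Finset.univ_unique, conv_const_mul]
  rw [Finset.sum_eq_single i]
  · congr 1
    funext y
    rw [dForce_eq, smul_smul, ← sq]
    congr 1
    simp [gradSingle]
  · intro k _ hk
    have : ∀ a : E m, (gradSingle k a : Grad n m) i = 0 := fun a => by
      simp [gradSingle, hk.symm]
    simp [this, conv_zero_right]
  · simp

/-- The third equation is the spatial derivative of the second: the derivative falls on the data in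
the heat term and on the kernel in the Duhamel term. Hence only the data have to be compatible,
whatever F is. -/
theorem hasWeakGrad_sysMild (hA : 0 < A) (hAT : A ^ 2 * T ≤ 1) (hw₀ : StronglyMeasurable w₀)
    (hM₀ : ∀ x, ‖w₀ x‖ ≤ M₀) (hF : BddMeas M F)
    (h₀ : HasWeakGrad (director w₀) (directorGrad A w₀)) {t : ℝ} (ht : t ∈ Ioc 0 T) :
    HasWeakGrad (director (sysMild A w₀ F t)) (directorGrad A (sysMild A w₀ F t)) := by
  intro i
  have e1 : director (sysMild A w₀ F t) = fun x => conv (heatKernel t) (director w₀) x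
      + ∫ s in (0 : ℝ)..t, conv (heatKernel (t - s))
        (dForce (velocity A (F s)) (director (F s)) (directorGrad A (F s))) x := funext fun x => by
    rw [director_sysMild hA hAT hw₀ hM₀ hF ht, heat_of_pos ht.1]
  have e2 : (fun x => directorGrad A (sysMild A w₀ F t) x i)
      = fun x => conv (heatKernel t) (fun y => directorGrad A w₀ y i) x
      + ∫ s in (0 : ℝ)..t, conv (gradKernel (t - s) i)
        (dForce (velocity A (F s)) (director (F s)) (directorGrad A (F s))) x := funext fun x => by
    rw [directorGrad_sysMild hA hAT hw₀ hM₀ hF ht, heat_of_pos ht.1]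
  rw [e1, e2]
  obtain ⟨B, hB⟩ := hF.dForce (A := A)
  have hB0 : 0 ≤ B := (norm_nonneg _).trans (hB.bound 0 0)
  have hκ := one_le_kernelConst n
  have hmeas : ∀ {k : ℝ → E n → ℝ}, Measurable (Function.uncurry k) →
      StronglyMeasurable (Function.uncurry fun x s => conv (k (t - s))
        (dForce (velocity A (F s)) (director (F s)) (directorGrad A (F s))) x) := fun hk =>
    (stronglyMeasurable_conv_param hk hB.measurable).comp_measurable
      (g := fun p : E n × ℝ => ((t, p.1), p.2)) (by fun_prop)
  refine HasWeakPartial.add ?_ ?_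
  · refine hasWeakPartial_conv (integrable_heatKernel ht.1) (continuous_heatKernel t).measurable
      ?_ ?_ (M := M₀) (M' := A * M₀) (fun y => ?_) (fun y => ?_) (h₀ i)
    · exact hw₀.snd.fst
    · have hc : Continuous fun w : State n m => (A • w.2.2) i := by fun_prop
      exact hc.comp_stronglyMeasurable hw₀
    · exact (norm_fst_le (w₀ y).2).trans ((norm_snd_le (w₀ y)).trans (hM₀ y))
    · refine (norm_grad_apply_le _ i).trans ?_
      rw [directorGrad, norm_smul, Real.norm_of_nonneg hA.le]
      gcongr
      exact (norm_snd_le (w₀ y).2).trans ((norm_snd_le (w₀ y)).trans (hM₀ y))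
  -- The heat kernel term is bounded without a singularity; this inequality puts it under the common
  -- majorant (t - s)^{-1/2}.
  · have hpow : ∀ s ∈ Ioo 0 t, 0 < t - s ∧ 1 ≤ √t * (t - s) ^ (-(1 / 2) : ℝ) := fun s hs => by
      have h1 : 0 < t - s := sub_pos.2 hs.2
      refine ⟨h1, ?_⟩
      calc 1 = √(t - s) * (t - s) ^ (-(1 / 2) : ℝ) := (sqrt_mul_rpow_neg_half h1).symm
        _ ≤ _ := by gcongr; linarith [hs.1]
    refine hasWeakPartial_intervalIntegral (B := (√t + kernelConst n) * B) ht.1.le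
      (hmeas measurable_heatKernel) (hmeas (measurable_gradKernel i)) (fun s hs x => ?_)
      (fun s hs x => ?_) (fun s hs => ?_)
    · obtain ⟨h1, h2⟩ := hpow s hs
      rw [← heat_of_pos h1]
      refine (norm_heat_le h1.le (hB.bound s) x).trans ?_
      have h3 : 0 ≤ (t - s) ^ (-(1 / 2) : ℝ) := by positivity
      calc B = 1 * B := (one_mul B).symm
        _ ≤ (√t * (t - s) ^ (-(1 / 2) : ℝ) + kernelConst n * (t - s) ^ (-(1 / 2) : ℝ)) * B := by
          gcongr
          have : 0 ≤ kernelConst n * (t - s) ^ (-(1 / 2) : ℝ) := by positivity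
          linarith
        _ = _ := by ring
    · obtain ⟨h1, h2⟩ := hpow s hs
      refine (norm_conv_le (integrable_gradKernel h1 i) (Eventually.of_forall (hB.bound s)) x).trans
        ?_
      calc _ ≤ (kernelConst n * (t - s) ^ (-(1 / 2) : ℝ)) * B := by
            gcongr
            exact integral_abs_gradKernel_le_kernelConst h1 i
        _ ≤ (√t * (t - s) ^ (-(1 / 2) : ℝ) + kernelConst n * (t - s) ^ (-(1 / 2) : ℝ)) * B := by
          gcongr
          have : 0 ≤ √t * (t - s) ^ (-(1 / 2) : ℝ) := by positivity
          linarith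
        _ = _ := by ring
    · exact hasWeakPartial_heat_gradKernel (hpow s hs).1 i (hB.slice s) (hB.bound s)

end Components

/-! ### Weak gradients and initial data -/

section WeakGradients

variable {n m : ℕ}

theorem exists_bounded_representative {V : Type} [NormedAddCommGroup V] {f : E n → V}
    (hf : AEStronglyMeasurable f volume) {M : ℝ} (hM0 : 0 ≤ M) (hM : ∀ᵐ x, ‖f x‖ ≤ M) :
    ∃ g : E n → V, StronglyMeasurable g ∧ (∀ x, ‖g x‖ ≤ M) ∧ f =ᵐ[volume] g := by
  refine ⟨{x | ‖hf.mk f x‖ ≤ M}.indicator (hf.mk f), hf.stronglyMeasurable_mk.indicator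
    (measurableSet_le hf.stronglyMeasurable_mk.norm.measurable measurable_const), fun x => ?_, ?_⟩
  · by_cases h : ‖hf.mk f x‖ ≤ M
    · rwa [indicator_of_mem (show x ∈ {x | ‖hf.mk f x‖ ≤ M} from h)]
    · rw [indicator_of_notMem (show x ∉ {x | ‖hf.mk f x‖ ≤ M} from h), norm_zero]
      exact hM0
  · filter_upwards [hf.ae_eq_mk, hM] with x hx hxM
    rw [indicator_of_mem (show x ∈ {x | ‖hf.mk f x‖ ≤ M} by show ‖hf.mk f x‖ ≤ M; rw [← hx]; exact hxM), hx]

/-- An infimum over the empty family is ⊤, so a finite norm provides a weak derivative. By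
uniqueness up to null sets all candidates have the same norm, so any one attains the infimum. -/
theorem exists_hasWeakPartial_of_sobolevNorm_le {V : Type} [NormedAddCommGroup V]
    [NormedSpace ℝ V] [CompleteSpace V] {k : ℕ} {f : E n → V} {M : ℝ≥0} (h : sobolevNorm k f ≤ M)
    {l : ℕ} (hl : l ≤ k) (α : Fin l → Fin n) :
    ∃ g, HasWeakPartial α f g ∧ ∀ᵐ x, ‖g x‖ ≤ M := by
  have h1 : ⨅ (g : E n → V) (_ : HasWeakPartial α f g), eLpNorm g ⊤ volume ≤ M :=
    (le_iSup_of_le l (le_iSup_of_le hl (le_iSup (fun α : Fin l → Fin n =>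
      ⨅ (g : E n → V) (_ : HasWeakPartial α f g), eLpNorm g ⊤ volume) α))).trans h
  have h2 : ∃ g, HasWeakPartial α f g := by
    by_contra hcon
    push Not at hcon
    have : ⨅ (g : E n → V) (_ : HasWeakPartial α f g), eLpNorm g ⊤ volume = ⊤ := by
      simp [hcon]
    rw [this] at h1
    simp at h1
  obtain ⟨g, hg⟩ := h2
  refine ⟨g, hg, ?_⟩
  have h3 : eLpNorm g ⊤ volume ≤ M := by
    refine le_trans (le_iInf₂ fun g' hg' => le_of_eq ?_) h1
    exact eLpNorm_congr_ae (hg.unique hg' (ae_eq_refl f))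
  filter_upwards [ae_le_eLpNormEssSup (f := g) (μ := volume)] with x hx
  rw [← eLpNorm_exponent_top] at hx
  have := hx.trans h3
  rw [enorm_le_coe] at this
  exact_mod_cast this

theorem hasWeakGrad_weakGrad {f : E n → E m} {g : E n → Grad n m} (h : HasWeakGrad f g) :
    HasWeakGrad f (weakGrad f) := by
  have h' : ∃ g, HasWeakGrad f g := ⟨g, h⟩
  rw [weakGrad, dif_pos h']
  exact h'.choose_spec

theorem HasWeakGrad.unique {f f' : E n → E m} {g g' : E n → Grad n m} (h : HasWeakGrad f g)
    (h' : HasWeakGrad f' g') (hff' : f =ᵐ[volume] f') : g =ᵐ[volume] g' := by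
  have : ∀ᵐ x, ∀ i, g x i = g' x i := ae_all_iff.2 fun i => (h i).unique (h' i) hff'
  filter_upwards [this] with x hx
  ext i : 1
  exact hx i

theorem weakGrad_ae_eq {f f' : E n → E m} {g : E n → Grad n m} (h : HasWeakGrad f' g)
    (hff' : f =ᵐ[volume] f') : weakGrad f =ᵐ[volume] g := by
  have h1 : HasWeakGrad f g := fun i => (h i).congr hff'.symm (ae_eq_refl _)
  exact (hasWeakGrad_weakGrad h1).unique h1 (ae_eq_refl f)

theorem norm_grad_le {D : Grad n m} {M : ℝ} (hM : 0 ≤ M) (h : ∀ i, ‖D i‖ ≤ M) :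
    ‖D‖ ≤ √n * M := by
  rw [PiLp.norm_eq_of_L2, ← Real.sqrt_sq hM, ← Real.sqrt_mul (by positivity)]
  refine Real.sqrt_le_sqrt ?_
  calc ∑ i, ‖D i‖ ^ 2 ≤ ∑ _i : Fin n, M ^ 2 := by
        refine Finset.sum_le_sum fun i _ => ?_
        have := h i
        gcongr
    _ = n * M ^ 2 := by simp

theorem hasWeakGrad_of_sobolevNorm_le {f : E n → E m} {M : ℝ≥0} (h : sobolevNorm 1 f ≤ M) :
    HasWeakGrad f (weakGrad f) ∧ AEStronglyMeasurable f volume ∧ (∀ᵐ x, ‖f x‖ ≤ M) ∧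
      AEStronglyMeasurable (weakGrad f) volume ∧ ∀ᵐ x, ‖weakGrad f x‖ ≤ √n * M := by
  obtain ⟨f', hf', hfM⟩ := exists_hasWeakPartial_of_sobolevNorm_le h (Nat.zero_le 1) Fin.elim0
  have hff' : f =ᵐ[volume] f' :=
    (HasWeakPartial.of_zero hf'.1 Fin.elim0).unique hf' (ae_eq_refl f)
  choose g hg hgM using fun i : Fin n =>
    exists_hasWeakPartial_of_sobolevNorm_le h le_rfl (fun _ : Fin 1 => i)
  have hG : HasWeakGrad f (fun x => (WithLp.toLp 2 fun i => g i x : Grad n m)) := fun i => hg i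
  have hw := hasWeakGrad_weakGrad hG
  have heq := weakGrad_ae_eq hG (ae_eq_refl f)
  refine ⟨hw, hf'.1.aestronglyMeasurable, ?_, ?_, ?_⟩
  · filter_upwards [hff', hfM] with x h1 h2
    rwa [h1]
  · refine AEStronglyMeasurable.congr ?_ heq.symm
    refine (PiLp.continuous_toLp 2 (fun _ : Fin n => E m)).comp_aestronglyMeasurable
      (f := fun x i => g i x) ?_
    exact (aemeasurable_pi_lambda _ fun i =>
      (hg i).2.1.aestronglyMeasurable.aemeasurable).aestronglyMeasurable
  · filter_upwards [heq, ae_all_iff.2 hgM] with x h1 h2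
    rw [h1]
    exact norm_grad_le M.2 h2

theorem ae_norm_le_of_sobolevNorm_zero_le {V : Type} [NormedAddCommGroup V]
    [NormedSpace ℝ V] [CompleteSpace V] {f : E n → V} {M : ℝ≥0} (h : sobolevNorm 0 f ≤ M) :
    ∀ᵐ x, ‖f x‖ ≤ M := by
  obtain ⟨f', hf', hfM⟩ := exists_hasWeakPartial_of_sobolevNorm_le h le_rfl Fin.elim0
  have hff' : f =ᵐ[volume] f' :=
    (HasWeakPartial.of_zero hf'.1 Fin.elim0).unique hf' (ae_eq_refl f)
  filter_upwards [hff', hfM] with x h1 h2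
  rwa [h1]

theorem heatProjDiv_congr_ae {t : ℝ} {F G : E n → Matrix (Fin n) (Fin n) ℝ}
    (h : F =ᵐ[volume] G) (x : E n) : heatProjDiv t F x = heatProjDiv t G x := by
  unfold heatProjDiv
  congr 1
  funext i
  refine Finset.sum_congr rfl fun j _ => Finset.sum_congr rfl fun k _ => integral_congr_ae ?_
  filter_upwards [h] with y hy
  rw [hy]

theorem stress_congr_ae {u u' : E n → E n} {D D' : E n → Grad n m} (hu : u =ᵐ[volume] u')
    (hD : D =ᵐ[volume] D') : stress u D =ᵐ[volume] stress u' D' := by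
  filter_upwards [hu, hD] with x h1 h2
  ext j k
  simp only [stress, Matrix.of_apply, h1, h2]

theorem dForce_congr_ae {u u' : E n → E n} {d d' : E n → E m} {D D' : E n → Grad n m}
    (hu : u =ᵐ[volume] u') (hd : d =ᵐ[volume] d') (hD : D =ᵐ[volume] D') :
    dForce u d D =ᵐ[volume] dForce u' d' D' := by
  filter_upwards [hu, hd, hD] with x h1 h2 h3
  simp only [dForce, h1, h2, h3]

theorem heat_congr_ae {V : Type} [NormedAddCommGroup V] [NormedSpace ℝ V] {t : ℝ} (ht : 0 ≤ t)
    {f g : E n → V} (h : f =ᵐ[volume] g) : heat t f =ᵐ[volume] heat t g := by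
  rcases ht.eq_or_lt with rfl | ht
  · simpa only [heat_zero] using h
  · rw [heat_of_pos ht, heat_of_pos ht]
    exact Eventually.of_forall fun x => conv_congr_ae h x

end WeakGradients

/-! ### Solutions of the rescaled system and mild solutions -/

section MildSolutions

variable {n m : ℕ} {A T : ℝ} {w : ℝ → E n → State n m} {u₀ : E n → E n} {d₀ : E n → E m}

theorem IsSol.eq_sysMild (hw : IsSol (sysKernel A) sysNonlin 0 T w) {t : ℝ} (ht : t ∈ Ioc 0 T) :
    w t = sysMild A (w 0) w t := by
  funext x
  have := hw.eq t ht x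
  rwa [sub_zero] at this

theorem IsSol.hasWeakGrad (hA : 0 < A) (hAT : A ^ 2 * T ≤ 1)
    (hw : IsSol (sysKernel A) sysNonlin 0 T w)
    (h₀ : HasWeakGrad (director (w 0)) (directorGrad A (w 0))) {t : ℝ} (ht : t ∈ Icc 0 T) :
    HasWeakGrad (director (w t)) (directorGrad A (w t)) := by
  obtain ⟨M, hM⟩ := hw.bddMeas
  rcases ht.1.eq_or_lt with rfl | ht0
  · exact h₀
  · rw [hw.eq_sysMild ⟨ht0, ht.2⟩]
    exact hasWeakGrad_sysMild hA hAT (hM.slice 0) (hM.bound 0) hM h₀ ⟨ht0, ht.2⟩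

theorem IsSol.isMildSolution (hA : 0 < A) (hAT : A ^ 2 * T ≤ 1)
    (hw : IsSol (sysKernel A) sysNonlin 0 T w)
    (h₀ : HasWeakGrad (director (w 0)) (directorGrad A (w 0)))
    (hu₀ : u₀ =ᵐ[volume] velocity A (w 0)) (hd₀ : d₀ =ᵐ[volume] director (w 0)) :
    IsMildSolution T u₀ d₀ (fun t => velocity A (w t)) (fun t => director (w t)) := by
  obtain ⟨M, hM⟩ := hw.bddMeas
  have hM0 : 0 ≤ M := (norm_nonneg _).trans (hM.bound 0 0)
  have hgrad : ∀ t ∈ Icc 0 T, weakGrad (director (w t)) =ᵐ[volume] directorGrad A (w t) :=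
    fun t ht => weakGrad_ae_eq (hw.hasWeakGrad hA hAT h₀ ht) (ae_eq_refl _)
  have hmu : StronglyMeasurable (Function.uncurry fun t => velocity A (w t)) :=
    hM.measurable.fst.const_smul A
  have hmd : StronglyMeasurable (Function.uncurry fun t => director (w t)) := hM.measurable.snd.fst
  have hmD : StronglyMeasurable (Function.uncurry fun t => directorGrad A (w t)) :=
    hM.measurable.snd.snd.const_smul A
  have hub : ∀ t x, ‖velocity A (w t) x‖ ≤ A * M := fun t x => by
    rw [velocity, norm_smul, Real.norm_of_nonneg hA.le]
    gcongr
    exact (norm_fst_le _).trans (hM.bound t x)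
  have hdb : ∀ t x, ‖director (w t) x‖ ≤ M := fun t x =>
    (norm_fst_le (w t x).2).trans ((norm_snd_le _).trans (hM.bound t x))
  have hDb : ∀ t x, ‖directorGrad A (w t) x‖ ≤ A * M := fun t x => by
    rw [directorGrad, norm_smul, Real.norm_of_nonneg hA.le]
    gcongr
    exact (norm_snd_le (w t x).2).trans ((norm_snd_le _).trans (hM.bound t x))
  refine ⟨hmu.aestronglyMeasurable, hmd.aestronglyMeasurable, ⟨_, hmD.aestronglyMeasurable,
    fun t ht => (hgrad t ht).symm⟩, ⟨Real.toNNReal (A * M + M), fun t ht => ⟨?_, ?_⟩⟩, ?_, ?_⟩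
  · refine SobolevBound.sobolevNorm_le ((sobolevBound_zero (M := A * M) ?_
      (Eventually.of_forall (hub t))).mono (ENNReal.ofReal_le_ofReal (by linarith)))
    exact (hmu.comp_measurable measurable_prodMk_left).aestronglyMeasurable
  · refine SobolevBound.sobolevNorm_le (SobolevBound.succ
      ((sobolevBound_zero (M := M) ?_ (Eventually.of_forall (hdb t))).mono
        (ENNReal.ofReal_le_ofReal (by nlinarith))) fun i => ⟨fun x => directorGrad A (w t) x i,
          hw.hasWeakGrad hA hAT h₀ ht i, (sobolevBound_zero (M := A * M) ?_
            (Eventually.of_forall fun x => (norm_grad_apply_le _ i).trans (hDb t x))).mono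
          (ENNReal.ofReal_le_ofReal (by linarith))⟩)
    · exact (hmd.comp_measurable measurable_prodMk_left).aestronglyMeasurable
    · exact (hw.hasWeakGrad hA hAT h₀ ht i).2.1.aestronglyMeasurable
  · intro t ht
    rcases ht.1.eq_or_lt with rfl | ht0
    · filter_upwards [hu₀] with x hx
      simp [heat_zero, hx]
    · filter_upwards [heat_congr_ae ht0.le hu₀] with x hx
      rw [hx]
      conv_lhs => rw [hw.eq_sysMild ⟨ht0, ht.2⟩]
      rw [velocity_sysMild hA hAT (hM.slice 0) (hM.bound 0) hM ⟨ht0, ht.2⟩]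
      congr 1
      refine intervalIntegral.integral_congr fun s hs => ?_
      rw [uIcc_of_le ht0.le] at hs
      exact heatProjDiv_congr_ae (stress_congr_ae (ae_eq_refl _)
        (hgrad s ⟨hs.1, hs.2.trans ht.2⟩).symm) x
  · intro t ht
    rcases ht.1.eq_or_lt with rfl | ht0
    · filter_upwards [hd₀] with x hx
      simp [heat_zero, hx]
    · filter_upwards [heat_congr_ae ht0.le hd₀] with x hx
      rw [hx]
      conv_lhs => rw [hw.eq_sysMild ⟨ht0, ht.2⟩]
      rw [director_sysMild hA hAT (hM.slice 0) (hM.bound 0) hM ⟨ht0, ht.2⟩]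
      congr 1
      refine intervalIntegral.integral_congr_ae ?_
      have h' : ∀ᵐ s : ℝ, s ≠ t := by simp [ae_iff, measure_singleton]
      filter_upwards [h'] with s hs hs'
      rw [uIoc_of_le ht0.le] at hs'
      rw [heat_of_pos (sub_pos.2 (lt_of_le_of_ne hs'.2 hs))]
      exact conv_congr_ae (dForce_congr_ae (ae_eq_refl _) (ae_eq_refl _)
        (hgrad s ⟨hs'.1.le, hs'.2.trans ht.2⟩).symm) x

/-- The rescaled triple of the other mild solution has a bounded, jointly measurable version F. The
Picard map applied to F gives a field z defined at every point that represents the same solution.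
Then z solves the pointwise system with the same initial value, and `IsSol.unique` applies. -/
theorem IsSol.ae_eq_of_isMildSolution (hA : 0 < A) (hAT : A ^ 2 * T ≤ 1)
    (hw : IsSol (sysKernel A) sysNonlin 0 T w)
    (h₀ : HasWeakGrad (director (w 0)) (directorGrad A (w 0)))
    (hu₀ : u₀ =ᵐ[volume] velocity A (w 0)) (hd₀ : d₀ =ᵐ[volume] director (w 0))
    {v : ℝ → E n → E n} {b : ℝ → E n → E m} (hvb : IsMildSolution T u₀ d₀ v b) {t : ℝ}
    (ht : t ∈ Icc 0 T) : v t =ᵐ[volume] velocity A (w t) ∧ b t =ᵐ[volume] director (w t) := by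
  have hK := kernelFamily_sysKernel (n := n) hA hAT
  have hNc : ∀ α, Continuous (sysNonlin (n := n) (m := m) α) := fun α =>
    (contDiff_sysNonlin α).continuous
  obtain ⟨M₀, hM₀⟩ := hw.bddMeas
  obtain ⟨Dd, hDm, hDd⟩ := hvb.measurable_grad
  obtain ⟨M, hM⟩ := hvb.bounded
  have hA' : A ≠ 0 := hA.ne'
  have hbd := fun t ht => hasWeakGrad_of_sobolevNorm_le (hM t ht).2
  have hvM := fun t ht => ae_norm_le_of_sobolevNorm_zero_le (hM t ht).1
  -- a bounded, strongly measurable version of the solution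
  set B : ℝ := A⁻¹ * M + M + A⁻¹ * (√n * M) with hB
  have hB0 : 0 ≤ B := by positivity
  have hWm : AEStronglyMeasurable (fun p : ℝ × E n =>
      ((A⁻¹ • v p.1 p.2, b p.1 p.2, A⁻¹ • Dd p.1 p.2) : State n m))
      ((volume.restrict (Icc 0 T)).prod volume) :=
    (hvb.measurable_u.const_smul A⁻¹).prodMk (hvb.measurable_d.prodMk (hDm.const_smul A⁻¹))
  set G := hWm.mk _ with hG
  have hGm : StronglyMeasurable G := hWm.stronglyMeasurable_mk
  -- Truncation at the level B yields a bound at all points; for almost every time it alters only a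
  -- null set, by the essential bounds.
  let F : ℝ → E n → State n m := fun s y => if ‖G (s, y)‖ ≤ B then G (s, y) else 0
  have hF : BddMeas B F := by
    refine ⟨?_, fun s y => ?_⟩
    · have : Function.uncurry F = fun p => if ‖G p‖ ≤ B then G p else 0 := by
        ext p : 1; rfl
      rw [this]
      exact StronglyMeasurable.ite (measurableSet_le hGm.norm.measurable measurable_const) hGm
        stronglyMeasurable_const
    · simp only [F]
      split_ifs with h
      · exact h
      · simpa using hB0
  -- Equality almost everywhere in the product gives this only for almost every s. That is enough
  -- under the time integral.
  have hFae : ∀ᵐ s, s ∈ Icc 0 T → velocity A (F s) =ᵐ[volume] v s ∧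
      director (F s) =ᵐ[volume] b s ∧ directorGrad A (F s) =ᵐ[volume] weakGrad (b s) := by
    have h1 := Measure.ae_ae_of_ae_prod hWm.ae_eq_mk
    rw [ae_restrict_iff' measurableSet_Icc] at h1
    filter_upwards [h1] with s hs hsI
    have h2 : ∀ᵐ y, F s y = (A⁻¹ • v s y, b s y, A⁻¹ • weakGrad (b s) y) := by
      filter_upwards [hs hsI, hDd s hsI, hvM s hsI, (hbd s hsI).2.2.1, (hbd s hsI).2.2.2.2]
        with y e1 e2 e3 e4 e5
      have e6 : G (s, y) = (A⁻¹ • v s y, b s y, A⁻¹ • weakGrad (b s) y) := by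
        rw [← e2]; exact e1.symm
      have e7 : ‖G (s, y)‖ ≤ B := by
        have hAi : 0 < A⁻¹ := by positivity
        rw [e6, Prod.norm_mk, Prod.norm_mk, norm_smul, norm_smul, Real.norm_of_nonneg hAi.le]
        have p1 : A⁻¹ * ‖v s y‖ ≤ A⁻¹ * M := by gcongr
        have p2 : A⁻¹ * ‖weakGrad (b s) y‖ ≤ A⁻¹ * (√n * M) := by gcongr
        have q1 : 0 ≤ A⁻¹ * (M : ℝ) := by positivity
        have q2 : 0 ≤ A⁻¹ * (√n * (M : ℝ)) := by positivity
        have q3 : 0 ≤ (M : ℝ) := M.2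
        refine max_le ?_ (max_le ?_ ?_) <;> rw [hB] <;> linarith
      simp only [F]
      rw [if_pos e7, e6]
    refine ⟨?_, ?_, ?_⟩
    · filter_upwards [h2] with y hy
      rw [velocity, hy, smul_smul, mul_inv_cancel₀ hA', one_smul]
    · filter_upwards [h2] with y hy
      rw [director, hy]
    · filter_upwards [h2] with y hy
      rw [directorGrad, hy, smul_smul, mul_inv_cancel₀ hA', one_smul]
  -- the pointwise representative
  set z := picard (sysKernel A) sysNonlin T (w 0) F with hz
  have hz0 : z 0 = w 0 := by
    funext x; simp [hz, picard]
  have hzt : ∀ t ∈ Ioc 0 T, z t = sysMild A (w 0) F t := fun t ht => by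
    funext x
    simp only [hz, picard, not_le.2 ht.1, if_false, ht.2, if_true, sysMild]
  have hzae : ∀ t ∈ Icc 0 T, v t =ᵐ[volume] velocity A (z t) ∧ b t =ᵐ[volume] director (z t) ∧
      weakGrad (b t) =ᵐ[volume] directorGrad A (z t) := by
    intro t ht
    rcases ht.1.eq_or_lt with rfl | ht0
    · have e1 : v 0 =ᵐ[volume] velocity A (w 0) := by
        filter_upwards [hvb.eq_u 0 ht, hu₀] with x h1 h2
        rw [h1, heat_zero, intervalIntegral.integral_same, sub_zero, h2]
      have e2 : b 0 =ᵐ[volume] director (w 0) := by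
        filter_upwards [hvb.eq_d 0 ht, hd₀] with x h1 h2
        rw [h1, heat_zero, intervalIntegral.integral_same, add_zero, h2]
      rw [hz0]
      exact ⟨e1, e2, weakGrad_ae_eq h₀ e2⟩
    · have htI : t ∈ Ioc 0 T := ⟨ht0, ht.2⟩
      have h' : ∀ᵐ s : ℝ, s ≠ t := by simp [ae_iff, measure_singleton]
      rw [hzt t htI]
      have e1 : v t =ᵐ[volume] velocity A (sysMild A (w 0) F t) := by
        filter_upwards [hvb.eq_u t ht, heat_congr_ae ht0.le hu₀] with x h1 h2
        rw [h1, velocity_sysMild hA hAT (hM₀.slice 0) (hM₀.bound 0) hF htI, h2]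
        congr 1
        refine intervalIntegral.integral_congr_ae ?_
        filter_upwards [hFae] with s hs hs'
        rw [uIoc_of_le ht0.le] at hs'
        obtain ⟨p1, p2, p3⟩ := hs ⟨hs'.1.le, hs'.2.trans ht.2⟩
        exact heatProjDiv_congr_ae (stress_congr_ae p1.symm p3.symm) x
      have e2 : b t =ᵐ[volume] director (sysMild A (w 0) F t) := by
        filter_upwards [hvb.eq_d t ht, heat_congr_ae ht0.le hd₀] with x h1 h2
        rw [h1, director_sysMild hA hAT (hM₀.slice 0) (hM₀.bound 0) hF htI, h2]
        congr 1
        refine intervalIntegral.integral_congr_ae ?_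
        filter_upwards [hFae, h'] with s hs hst hs'
        rw [uIoc_of_le ht0.le] at hs'
        obtain ⟨p1, p2, p3⟩ := hs ⟨hs'.1.le, hs'.2.trans ht.2⟩
        rw [heat_of_pos (sub_pos.2 (lt_of_le_of_ne hs'.2 hst))]
        exact conv_congr_ae (dForce_congr_ae p1.symm p2.symm p3.symm) x
      exact ⟨e1, e2, weakGrad_ae_eq
        (hasWeakGrad_sysMild hA hAT (hM₀.slice 0) (hM₀.bound 0) hF h₀ htI) e2⟩
  -- All three components of F and z agree, including the gradients, because z inherits a compatible
  -- gradient from the data. Replacing F by z inside the Duhamel term makes z a fixed point.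
  have hFz : ∀ᵐ s, s ∈ Icc 0 T → F s =ᵐ[volume] z s := by
    filter_upwards [hFae] with s hs hsI
    obtain ⟨p1, p2, p3⟩ := hs hsI
    obtain ⟨q1, q2, q3⟩ := hzae s hsI
    filter_upwards [p1, p2, p3, q1, q2, q3] with y a1 a2 a3 b1 b2 b3
    have c1 : A • (F s y).1 = A • (z s y).1 := a1.trans b1
    have c2 : (F s y).2.1 = (z s y).2.1 := a2.trans b2
    have c3 : A • (F s y).2.2 = A • (z s y).2.2 := a3.trans b3
    exact Prod.ext (smul_right_injective _ hA' c1)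
      (Prod.ext c2 (smul_right_injective _ hA' c3))
  have hzsol : IsSol (sysKernel A) sysNonlin 0 T z := by
    refine ⟨exists_bddMeas_picard hK hNc (hM₀.slice 0) (hM₀.bound 0) hF, fun t ht x => ?_⟩
    rw [hzt t ht, sub_zero, hz0, sysMild]
    congr 1
    refine duhamel_congr ht.1.le (fun α => ?_) x
    filter_upwards [hFz] with s hs hs'
    filter_upwards [hs ⟨hs'.1.le, hs'.2.le.trans ht.2⟩] with y hy
    rw [hy]
  have heq := hzsol.unique hK contDiff_sysNonlin hw hz0 (by simp) t ht
  rw [← heq]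
  exact ⟨(hzae t ht).1, (hzae t ht).2.1⟩

end MildSolutions

/-! ### The constraint on the length of the director -/

section UnitLength

variable {n m : ℕ} {A T : ℝ} {w : ℝ → E n → State n m}

theorem forall_le_of_ae_le {f : E n → ℝ} (hf : Continuous f) {c : ℝ} (h : ∀ᵐ x, f x ≤ c) (x : E n) :
    f x ≤ c :=
  (Measure.dense_of_ae h).induction (P := fun x => f x ≤ c) (fun _ hx => hx)
    (isClosed_le hf continuous_const) x

variable (n m) in
/-- The projection to the director. -/
def directorProj : State n m →L[ℝ] E m :=
  ContinuousLinearMap.fst ℝ (E m) (Grad n m) ∘L ContinuousLinearMap.snd ℝ (E n) (E m × Grad n m)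

theorem apply_fderiv_eq_of_hasWeakPartial {V W : Type} [NormedAddCommGroup V] [NormedSpace ℝ V]
    [CompleteSpace V] [NormedAddCommGroup W] [NormedSpace ℝ W] (π : W →L[ℝ] V) {f : E n → W}
    {g : E n → V} (hd : ∀ x, HasFDerivAt f (fderiv ℝ f x) x) (hc : Continuous (fderiv ℝ f))
    (hg : Continuous g) {i : Fin n}
    (h : HasWeakPartial (fun _ : Fin 1 => i) (fun x => π (f x)) g) (x : E n) :
    π (fderiv ℝ f x (e i)) = g x := by
  have hf : Continuous f := continuous_iff_continuousAt.2 fun x => (hd x).continuousAt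
  have hc1 : Continuous fun x => π (fderiv ℝ f x (e i)) :=
    π.continuous.comp (hc.clm_apply continuous_const)
  have h1 : HasWeakPartial (fun _ : Fin 1 => i) (fun x => π (f x))
      fun x => (π ∘L fderiv ℝ f x) (e i) :=
    hasWeakPartial_of_hasFDerivAt (π.continuous.comp hf).locallyIntegrable
      (fun x => π.hasFDerivAt.comp x (hd x)) i hc1.locallyIntegrable
  exact congrFun ((hc1.ae_eq_iff_eq volume hg).1 (h1.unique h (ae_eq_refl _))) x

section

variable {ι : Type} [Fintype ι] {V : Type} [NormedAddCommGroup V] [NormedSpace ℝ V]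
  [FiniteDimensional ℝ V] {K : ι → ℝ → E n → ℝ} {b T₀ a : ℝ} {N : ι → V → V} {α₀ : ι} {c : ℝ}
  {π : V →L[ℝ] E m} {z : ℝ → E n → V}

theorem IsSol.continuous (hK : KernelFamily K b T₀) (hN : ∀ α, ContDiff ℝ (⊤ : ℕ∞) (N α))
    (hz : IsSol K N a T z) (hT : T - a ≤ T₀) {t : ℝ} (ht : t ∈ Ioc a T) : Continuous (z t) := by
  obtain ⟨δ, haδ, hδt⟩ := exists_between ht.1
  obtain ⟨Λ, -, h⟩ := hz.exists_fderiv_lipschitz hK hN hT haδ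
  exact continuous_iff_continuousAt.2 fun x => ((h t ⟨hδt.le, ht.2⟩).1 x).continuousAt

/-- Version of `IsSol.abs_normSq_sub_one_le` in terms of the weak gradient. -/
theorem IsSol.abs_normSq_sub_one_le_of_hasWeakGrad (hK : KernelFamily K b T₀)
    (hN : ∀ α, ContDiff ℝ (⊤ : ℕ∞) (N α)) (hz : IsSol K N a T z) (hh : HeatDriven K N α₀ c π)
    (hT : T - a ≤ T₀) {D : ℝ → E n → Grad n m} (hDc : ∀ t ∈ Ioc a T, Continuous (D t))
    (hD : ∀ t ∈ Ioc a T, HasWeakGrad (fun x => π (z t x)) (D t))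
    {v : ℝ → E n → E n} {U L₀ : ℝ} (hU : 0 ≤ U) (hL₀ : 0 ≤ L₀) (hv : ∀ t x, ‖v t x‖ ≤ U)
    (hforce : ∀ t ∈ Ioc a T, ∀ x, c • π (N α₀ (z t x)) = dForce (v t) (fun x => π (z t x)) (D t) x)
    (hDb : ∀ t ∈ Ioc a T, ∀ x, ‖D t x‖ ^ 2 ≤ L₀)
    {δ t : ℝ} (haδ : a < δ) (hδt : δ ≤ t) (htT : t ≤ T) {S : ℝ} (hS0 : 0 ≤ S)
    (hS : ∀ x, |‖π (z δ x)‖ ^ 2 - 1| ≤ S) (x : E n) :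
    |‖π (z t x)‖ ^ 2 - 1| ≤ Real.exp (2 * L₀ * (t - δ)) * S := by
  have hDf : ∀ t ∈ Ioc a T, ∀ i x, π (fderiv ℝ (z t) x (e i)) = D t x i := by
    intro t ht i x
    obtain ⟨δ, haδ, hδt⟩ := exists_between ht.1
    obtain ⟨Λ, hΛ, h⟩ := hz.exists_fderiv_lipschitz hK hN hT haδ
    obtain ⟨hd, hlip, -⟩ := h t ⟨hδt.le, ht.2⟩
    exact apply_fderiv_eq_of_hasWeakPartial π hd (lipschitzWith_of_norm_sub_le hΛ hlip).continuous
      ((PiLp.continuous_apply 2 (fun _ : Fin n => E m) i).comp (hDc t ht)) (hD t ht i) x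
  have hsum : ∀ t ∈ Ioc a T, ∀ x, ∑ i, ‖π (fderiv ℝ (z t) x (e i))‖ ^ 2 = ‖D t x‖ ^ 2 :=
    fun t ht x => by simp_rw [hDf t ht]; rw [PiLp.norm_sq_eq_of_L2]
  refine hz.abs_normSq_sub_one_le hK hN hh hT hU hL₀ hv (fun t ht x => ?_)
    (fun t ht x => (hsum t ht x).trans_le (hDb t ht x)) haδ hδt htT hS0 hS x
  have e2 : π (fderiv ℝ (z t) x (v t x)) = ∑ i, v t x i • D t x i := by
    conv_lhs => rw [← sum_apply_smul_e (v t x)]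
    simp only [map_sum, map_smul, hDf t ht]
  rw [hforce t ht x, hsum t ht x, e2, dForce]

end

/-- The datum is Lipschitz of length one almost everywhere; the heat flow moves it by O(√t) and the
force by O(t). Continuity at positive times extends the bound from almost every x to every x. It
supplies the starting value for the discrete Gronwall argument. -/
theorem IsSol.exists_abs_normSq_director_le (hA : 0 < A) (hAT : A ^ 2 * T ≤ 1)
    (hw : IsSol (sysKernel A) sysNonlin 0 T w)
    (h₀ : HasWeakGrad (director (w 0)) (directorGrad A (w 0)))
    (h1 : ∀ᵐ x, ‖director (w 0) x‖ = 1) :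
    ∃ C, 0 ≤ C ∧ ∀ t ∈ Ioc 0 T, ∀ x, |‖director (w t) x‖ ^ 2 - 1| ≤ C * √t := by
  have hK := kernelFamily_sysKernel (n := n) hA hAT
  obtain ⟨M, hM⟩ := hw.bddMeas
  have hM0 : 0 ≤ M := (norm_nonneg _).trans (hM.bound 0 0)
  obtain ⟨B, hB⟩ := hM.dForce (A := A)
  have hB0 : 0 ≤ B := (norm_nonneg _).trans (hB.bound 0 0)
  have hdb : ∀ t x, ‖director (w t) x‖ ≤ M := fun t x =>
    (norm_fst_le (w t x).2).trans ((norm_snd_le _).trans (hM.bound t x))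
  have hdm : StronglyMeasurable (director (w 0)) := (hM.slice 0).snd.fst
  obtain ⟨Λ, hΛ, hlip⟩ := exists_ae_lipschitz (M := A * M) (fun i => Eventually.of_forall fun y => by
    refine (norm_grad_apply_le (directorGrad A (w 0) y) i).trans ?_
    rw [directorGrad, norm_smul, Real.norm_of_nonneg hA.le]
    gcongr
    exact (norm_snd_le (w 0 y).2).trans ((norm_snd_le _).trans (hM.bound 0 y))) h₀
  have hg := one_le_gaussConst n
  refine ⟨(Λ * (6 * gaussConst n) + B * √T) * (M + 1), by positivity, fun t ht => ?_⟩
  have hwc : Continuous (w t) := hw.continuous hK contDiff_sysNonlin (by simp) ht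
  have hdc : Continuous (director (w t)) := continuous_fst.comp (continuous_snd.comp hwc)
  have hdc' : Continuous fun x => |‖director (w t) x‖ ^ 2 - 1| :=
    ((hdc.norm.pow 2).sub continuous_const).abs
  refine forall_le_of_ae_le hdc' ?_
  filter_upwards [h1, hlip] with x hx hxlip
  have e1 := norm_heat_sub_self_le ht.1.le hdm.aestronglyMeasurable
    (Eventually.of_forall (hdb 0)) hΛ hxlip
  have e2 : ‖director (w t) x - heat t (director (w 0)) x‖ ≤ B * √T * √t := by
    rw [hw.eq_sysMild ht, director_sysMild hA hAT (hM.slice 0) (hM.bound 0) hM ht,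
      add_sub_cancel_left]
    have : ‖∫ s in (0 : ℝ)..t, conv (heatKernel (t - s))
        (dForce (velocity A (w s)) (director (w s)) (directorGrad A (w s))) x‖ ≤ B * |t - 0| := by
      refine intervalIntegral.norm_integral_le_of_norm_le_const_ae ?_
      have h' : ∀ᵐ s : ℝ, s ≠ t := by simp [ae_iff, measure_singleton]
      filter_upwards [h'] with s hs hs'
      rw [uIoc_of_le ht.1.le] at hs'
      have hst : 0 < t - s := sub_pos.2 (lt_of_le_of_ne hs'.2 hs)
      rw [← heat_of_pos hst]
      exact norm_heat_le hst.le (hB.bound s) x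
    refine this.trans ?_
    rw [sub_zero, abs_of_pos ht.1, mul_assoc]
    gcongr
    calc t = √t * √t := (Real.mul_self_sqrt ht.1.le).symm
      _ ≤ √T * √t := by gcongr; exact ht.2
  have e3 : |‖director (w t) x‖ - 1| ≤ (Λ * (6 * gaussConst n) + B * √T) * √t := by
    rw [← hx]
    refine (abs_norm_sub_norm_le _ _).trans ((norm_sub_le_norm_sub_add_norm_sub _
      (heat t (director (w 0)) x) _).trans ((add_le_add e2 e1).trans (le_of_eq ?_)))
    ring
  rw [show ‖director (w t) x‖ ^ 2 - 1 = (‖director (w t) x‖ - 1) * (‖director (w t) x‖ + 1) by ring,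
    abs_mul, abs_of_nonneg (by positivity : 0 ≤ ‖director (w t) x‖ + 1)]
  calc _ ≤ ((Λ * (6 * gaussConst n) + B * √T) * √t) * (M + 1) := by
        gcongr
        exact hdb t x
    _ = _ := by ring

/-- The propagation estimate from δ to t has a factor independent of δ, while the deviation at δ is
O(√δ); letting δ tend to zero leaves no deviation at t. -/
theorem IsSol.norm_director_eq_one (hA : 0 < A) (hAT : A ^ 2 * T ≤ 1)
    (hw : IsSol (sysKernel A) sysNonlin 0 T w)
    (h₀ : HasWeakGrad (director (w 0)) (directorGrad A (w 0)))
    (h1 : ∀ᵐ x, ‖director (w 0) x‖ = 1) {t : ℝ} (ht : t ∈ Ioc 0 T) (x : E n) :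
    ‖director (w t) x‖ = 1 := by
  have hK := kernelFamily_sysKernel (n := n) hA hAT
  obtain ⟨M, hM⟩ := hw.bddMeas
  have hM0 : 0 ≤ M := (norm_nonneg _).trans (hM.bound 0 0)
  obtain ⟨C, hC, hC'⟩ := hw.exists_abs_normSq_director_le hA hAT h₀ h1
  have hDc : ∀ t ∈ Ioc 0 T, Continuous (directorGrad A (w t)) := fun t ht => by
    have h2 : Continuous fun x => (w t x).2.2 := continuous_snd.comp
      (continuous_snd.comp (hw.continuous hK contDiff_sysNonlin (by simp) ht))
    exact h2.const_smul A
  have hmain : ∀ δ ∈ Ioc 0 t, |‖director (w t) x‖ ^ 2 - 1|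
      ≤ Real.exp (2 * (A * M) ^ 2 * T) * (C * √δ) := by
    intro δ hδ
    have h2 := hw.abs_normSq_sub_one_le_of_hasWeakGrad (π := directorProj n m) hK
      contDiff_sysNonlin (heatDriven_sysKernel A) (by simp) hDc
      (fun t ht => hw.hasWeakGrad hA hAT h₀ ⟨ht.1.le, ht.2⟩) (v := fun t => velocity A (w t))
      (U := A * M) (L₀ := (A * M) ^ 2) (by positivity) (by positivity) (fun t x => by
        rw [velocity, norm_smul, Real.norm_of_nonneg hA.le]
        gcongr
        exact (norm_fst_le _).trans (hM.bound t x))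
      (fun t _ x => (dForce_eq A (w t) x).symm) (fun t ht x => by
        rw [directorGrad, norm_smul, Real.norm_of_nonneg hA.le]
        gcongr
        exact (norm_snd_le (w t x).2).trans ((norm_snd_le _).trans (hM.bound t x))) hδ.1 hδ.2 ht.2
      (S := C * √δ) (by positivity) (hC' δ ⟨hδ.1, hδ.2.trans ht.2⟩) x
    refine h2.trans ?_
    gcongr
    linarith [hδ.1, ht.2]
  have hlim : Tendsto (fun δ => Real.exp (2 * (A * M) ^ 2 * T) * (C * √δ)) (𝓝[>] 0) (𝓝 0) := by
    have : Continuous fun δ => Real.exp (2 * (A * M) ^ 2 * T) * (C * √δ) := by fun_prop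
    simpa using (this.tendsto 0).mono_left nhdsWithin_le_nhds
  have h3 : |‖director (w t) x‖ ^ 2 - 1| ≤ 0 :=
    ge_of_tendsto hlim (by
      filter_upwards [Ioc_mem_nhdsGT ht.1] with δ hδ
      exact hmain δ hδ)
  have h4 : ‖director (w t) x‖ ^ 2 = 1 := by
    have := abs_nonpos_iff.1 h3
    linarith
  exact (pow_eq_one_iff_of_nonneg (norm_nonneg _) two_ne_zero).1 h4

end UnitLength

/-! ### Existence below the threshold and properties of the solution -/

section Existence

variable {n m : ℕ}

/-- The threshold for `T (‖u₀‖ + ‖∇ d₀‖)²` in the existence theorem. -/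
def smallness (n : ℕ) : ℝ := (1 / (64 * (Fintype.card (KernelIndex n) * kernelConst n))) ^ 2

theorem one_le_card_mul_kernelConst (n : ℕ) :
    1 ≤ Fintype.card (KernelIndex n) * kernelConst n := by
  have h1 : (1 : ℝ) ≤ Fintype.card (KernelIndex n) := by
    exact_mod_cast Fintype.card_pos (α := KernelIndex n)
  exact one_le_mul_of_one_le_of_one_le h1 (one_le_kernelConst n)

theorem smallness_pos (n : ℕ) : 0 < smallness n := by
  have := one_le_card_mul_kernelConst n
  unfold smallness
  positivity

theorem smallness_le_one (n : ℕ) : smallness n ≤ 1 := by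
  have := one_le_card_mul_kernelConst n
  refine pow_le_one₀ (by positivity) ?_
  rw [div_le_one (by positivity)]
  linarith

theorem exists_isSol_sysKernel {A T : ℝ} (hA : 0 < A) (hT : 0 < T) (hAT : A ^ 2 * T = smallness n)
    {u₀ : E n → E n} {d₀ : E n → E m} {D₀ : E n → Grad n m} (hu₀ : AEStronglyMeasurable u₀ volume)
    (hu₀b : ∀ᵐ x, ‖u₀ x‖ ≤ A) (hd₀ : AEStronglyMeasurable d₀ volume) (hd₀b : ∀ᵐ x, ‖d₀ x‖ ≤ 1)
    (hD₀ : AEStronglyMeasurable D₀ volume) (hD₀b : ∀ᵐ x, ‖D₀ x‖ ≤ A) :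
    ∃ w : ℝ → E n → State n m, IsSol (sysKernel A) sysNonlin 0 T w ∧
      u₀ =ᵐ[volume] velocity A (w 0) ∧ d₀ =ᵐ[volume] director (w 0) ∧
      D₀ =ᵐ[volume] directorGrad A (w 0) := by
  have hK := kernelFamily_sysKernel (n := n) hA (hAT.trans_le (smallness_le_one n))
  obtain ⟨u', hu', hu'b, huu⟩ := exists_bounded_representative hu₀ hA.le hu₀b
  obtain ⟨d', hd', hd'b, hdd⟩ := exists_bounded_representative hd₀ zero_le_one hd₀b
  obtain ⟨D', hD', hD'b, hDD⟩ := exists_bounded_representative hD₀ hA.le hD₀b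
  have hA' : A ≠ 0 := hA.ne'
  have hAi : ‖A⁻¹‖ = A⁻¹ := Real.norm_of_nonneg (inv_nonneg.2 hA.le)
  -- The 64 in `smallness` is 2·(2·16): twice the product of the Lipschitz constant 16 and the
  -- factor 2 from integrating (t - s)^{-1/2}. The contraction factor is exactly 1/2.
  have hsmall : Fintype.card (KernelIndex n) * (A * kernelConst n) * (2 * √T * 16) ≤ 1 / 2 := by
    have h1 := one_le_card_mul_kernelConst n
    have h2 : A * √T = 1 / (64 * (Fintype.card (KernelIndex n) * kernelConst n)) := by
      have h3 : (A * √T) ^ 2 = smallness n := by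
        rw [mul_pow, Real.sq_sqrt hT.le, hAT]
      exact (sq_eq_sq₀ (by positivity) (by positivity)).1 h3
    have h4 : Fintype.card (KernelIndex n) * (A * kernelConst n) * (2 * √T * 16)
        = 32 * (Fintype.card (KernelIndex n) * kernelConst n) * (A * √T) := by ring
    rw [h4, h2]
    generalize (Fintype.card (KernelIndex n) : ℝ) * kernelConst n = κ at h1 ⊢
    refine le_of_eq ?_
    have : κ ≠ 0 := by positivity
    field_simp
    norm_num
  obtain ⟨w, hw, hw0, -⟩ := exists_isSol hK (fun α => (contDiff_sysNonlin (m := m) α).continuous)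
    (L := 16) (by norm_num) norm_sysNonlin_sub_le sysNonlin_zero hsmall
    (w₀ := fun y => (A⁻¹ • u' y, d' y, A⁻¹ • D' y))
    ((hu'.const_smul A⁻¹).prodMk (hd'.prodMk (hD'.const_smul A⁻¹))) (fun y => by
      refine max_le ?_ (max_le (hd'b y) ?_)
      · rw [norm_smul, hAi, inv_mul_le_one₀ hA]
        exact hu'b y
      · rw [norm_smul, hAi, inv_mul_le_one₀ hA]
        exact hD'b y)
  refine ⟨w, hw, huu.trans (.of_forall fun y => ?_), hdd.trans (.of_forall fun y => ?_),
    hDD.trans (.of_forall fun y => ?_)⟩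
  · simp only [velocity, hw0, smul_inv_smul₀ hA']
  · simp only [director, hw0]
  · simp only [directorGrad, hw0, smul_inv_smul₀ hA']

variable {A T : ℝ} {w : ℝ → E n → State n m}

theorem IsSol.holderSobolev_velocity (hA : 0 < A) (hAT : A ^ 2 * T ≤ 1)
    (hw : IsSol (sysKernel A) sysNonlin 0 T w) (k : ℕ) {δ : ℝ} (hδ : 0 < δ) :
    HolderSobolev (1 / 2) (Icc δ T) k fun t => velocity A (w t) := by
  obtain ⟨M, hM, hM'⟩ := hw.sobolevBound_half k (kernelFamily_sysKernel hA hAT) contDiff_sysNonlin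
    (by simp) hδ (A • ContinuousLinearMap.fst ℝ (E n) (E m × Grad n m))
  exact ⟨M, fun t ht => (hM t ht).sobolevNorm_le, fun s hs t ht => (hM' s hs t ht).sobolevNorm_le⟩

theorem IsSol.holderSobolev_director (hA : 0 < A) (hAT : A ^ 2 * T ≤ 1)
    (hw : IsSol (sysKernel A) sysNonlin 0 T w) (k : ℕ) {δ : ℝ} (hδ : 0 < δ) :
    HolderSobolev 1 (Icc δ T) k fun t => director (w t) := by
  obtain ⟨M, hM, hM'⟩ := hw.sobolevBound_lip k (kernelFamily_sysKernel hA hAT) contDiff_sysNonlin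
    (heatDriven_sysKernel A) (by simp) hδ
  exact ⟨M, fun t ht => (hM t ht).sobolevNorm_le, fun s hs t ht => (hM' s hs t ht).sobolevNorm_le⟩

theorem IsSol.continuousOn_supNorm_velocity (hA : 0 < A) (hAT : A ^ 2 * T ≤ 1)
    (hw : IsSol (sysKernel A) sysNonlin 0 T w) :
    ContinuousOn (fun t => supNorm (velocity A (w t))) (Icc 0 T) :=
  hw.continuousOn_supNorm (kernelFamily_sysKernel hA hAT) contDiff_sysNonlin (by simp)
    (A • ContinuousLinearMap.fst ℝ (E n) (E m × Grad n m))

theorem IsSol.continuousOn_supNorm_directorGrad (hA : 0 < A) (hAT : A ^ 2 * T ≤ 1)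
    (hw : IsSol (sysKernel A) sysNonlin 0 T w) :
    ContinuousOn (fun t => supNorm (directorGrad A (w t))) (Icc 0 T) :=
  hw.continuousOn_supNorm (kernelFamily_sysKernel hA hAT) contDiff_sysNonlin (by simp)
    (A • (ContinuousLinearMap.snd ℝ (E m) (Grad n m) ∘L
      ContinuousLinearMap.snd ℝ (E n) (E m × Grad n m)))

theorem tendsto_nhdsGT_of_continuousOn_Icc {f : ℝ → ℝ} {T : ℝ} (hT : 0 < T)
    (hf : ContinuousOn f (Icc 0 T)) : Tendsto f (𝓝[>] 0) (𝓝 (f 0)) :=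
  (hf 0 ⟨le_rfl, hT.le⟩).mono_left
    (nhdsWithin_le_iff.2 (mem_of_superset (Ioc_mem_nhdsGT hT) Ioc_subset_Icc_self))

end Existence

end LiquidCrystal

end

/-! ### The existence, uniqueness and regularity theorem -/

open LiquidCrystal in
theorem theorem1p1 (n : ℕ) (hn : 2 ≤ n) :
    ∃ C : ℝ, 0 < C ∧
      ∀ (m : ℕ) (u₀ : E n → E n) (d₀ : E n → E m),
        MemLp u₀ ⊤ volume → IsDivFree u₀ →
        sobolevNorm 1 d₀ < ⊤ → (∀ᵐ x ∂volume, ‖d₀ x‖ = 1) →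
        ∀ T : ℝ, 0 < T → T * (supNorm u₀ + supNorm (weakGrad d₀)) ^ 2 ≤ C →
          ∃ (u : ℝ → E n → E n) (d : ℝ → E n → E m),
            IsMildSolution T u₀ d₀ u d ∧
            (∀ t ∈ Icc 0 T, ∀ᵐ x ∂volume, ‖d t x‖ = 1) ∧
            (∀ (v : ℝ → E n → E n) (b : ℝ → E n → E m), IsMildSolution T u₀ d₀ v b →
              ∀ t ∈ Icc 0 T, v t =ᵐ[volume] u t ∧ b t =ᵐ[volume] d t) ∧
            (∀ (k : ℕ) (δ : ℝ), 0 < δ → δ < T →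
              HolderSobolev (1 / 2) (Icc δ T) k u ∧ HolderSobolev 1 (Icc δ T) (k + 1) d) ∧
            ContinuousOn (fun t => supNorm (u t)) (Icc 0 T) ∧
            ContinuousOn (fun t => supNorm (weakGrad (d t))) (Icc 0 T) ∧
            Tendsto (fun t => supNorm (u t)) (𝓝[>] 0) (𝓝 (supNorm u₀)) ∧
            Tendsto (fun t => supNorm (weakGrad (d t))) (𝓝[>] 0)
              (𝓝 (supNorm (weakGrad d₀))) := by
  refine ⟨smallness n, smallness_pos n, fun m u₀ d₀ hu₀ _ hd₀ hd₀1 T hT hTC => ?_⟩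
  have hC := smallness_pos n
  -- The scale is fixed by T and not by the size of the data. It is positive even for vanishing u₀
  -- and ∇d₀, and the hypothesis on T says precisely that the sum of the two norms is at most A.
  set A : ℝ := √(smallness n / T) with hA_def
  have hA : 0 < A := Real.sqrt_pos.2 (div_pos hC hT)
  have hAT : A ^ 2 * T = smallness n := by
    rw [hA_def, Real.sq_sqrt (div_pos hC hT).le, div_mul_cancel₀ _ hT.ne']
  have hAT' : A ^ 2 * T ≤ 1 := hAT.trans_le (smallness_le_one n)
  have hle : supNorm u₀ + supNorm (weakGrad d₀) ≤ A := by
    refine Real.le_sqrt_of_sq_le ?_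
    rwa [le_div_iff₀ hT, mul_comm]
  have hu0 := supNorm_nonneg u₀
  have hD0 := supNorm_nonneg (weakGrad d₀)
  obtain ⟨hgrad, hdm, -, hDm, hDb⟩ := hasWeakGrad_of_sobolevNorm_le
    (f := d₀) (M := (sobolevNorm 1 d₀).toNNReal) (ENNReal.coe_toNNReal hd₀.ne).ge
  have hDfin : eLpNorm (weakGrad d₀) ⊤ volume ≠ ⊤ :=
    ((eLpNorm_top_le_of_norm_le hDb).trans_lt ENNReal.ofReal_lt_top).ne
  obtain ⟨w, hw, huw, hdw, hDw⟩ := exists_isSol_sysKernel hA hT hAT hu₀.1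
    ((ae_norm_le_supNorm hu₀.2.ne).mono fun x hx => hx.trans (by linarith)) hdm
    (hd₀1.mono fun x hx => hx.le) hDm
    ((ae_norm_le_supNorm hDfin).mono fun x hx => hx.trans (by linarith))
  have h₀ : HasWeakGrad (director (w 0)) (directorGrad A (w 0)) := fun i =>
    (hgrad i).congr hdw (hDw.mono fun x hx => by simp only [hx])
  have h1 : ∀ᵐ x, ‖director (w 0) x‖ = 1 := by
    filter_upwards [hdw, hd₀1] with x hx hx1
    rw [← hx, hx1]
  have hweak : ∀ t ∈ Icc 0 T, supNorm (weakGrad (director (w t)))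
      = supNorm (directorGrad A (w t)) := fun t ht =>
    supNorm_congr (weakGrad_ae_eq (hw.hasWeakGrad hA hAT' h₀ ht) (ae_eq_refl _))
  have hcu := hw.continuousOn_supNorm_velocity hA hAT'
  have hcd : ContinuousOn (fun t => supNorm (weakGrad (director (w t)))) (Icc 0 T) :=
    (hw.continuousOn_supNorm_directorGrad hA hAT').congr hweak
  refine ⟨fun t => velocity A (w t), fun t => director (w t),
    hw.isMildSolution hA hAT' h₀ huw hdw, fun t ht => ?_,
    fun v b hvb t ht => hw.ae_eq_of_isMildSolution hA hAT' h₀ huw hdw hvb ht,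
    fun k δ hδ _ => ⟨hw.holderSobolev_velocity hA hAT' k hδ,
      hw.holderSobolev_director hA hAT' (k + 1) hδ⟩, hcu, hcd, ?_, ?_⟩
  · rcases ht.1.eq_or_lt with rfl | ht0
    · exact h1
    · exact .of_forall (hw.norm_director_eq_one hA hAT' h₀ h1 ⟨ht0, ht.2⟩)
  · rw [supNorm_congr huw]
    exact tendsto_nhdsGT_of_continuousOn_Icc hT hcu
  · rw [supNorm_congr hDw, ← hweak 0 ⟨le_rfl, hT.le⟩]
    exact tendsto_nhdsGT_of_continuousOn_Icc hT hcd
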